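/- All graphs are finite and simple, and all logarithms are to base $2$. For a graph $H$ and an integer $t\ge 0$, the blowup $H[t]$ is obtained from $H$ by replacing every vertex by an independent set of $t$ vertices and every edge by a complete bipartite graph between the two corresponding independent sets. A graph $G$ contains a graph $F$ if $F$ is isomorphic to a (not necessarily induced) subgraph of $G$, and the copies of $H$ in $G$ are the subgraphs of $G$ that are isomorphic to $H$. For an $h$-vertex graph $H$ and $\gamma>0$, let $c_H(\gamma)\in[0,\infty]$ be the supremum of all $c>0$ such that every $N$-vertex graph with at least $\gamma N^h$ copies of $H$ contains $H[t]$ for some $t\ge (c-o(1))\log N$, where the $o(1)$ term depends only on $H$, $\gamma$, $c$ and $N$ and tends to $0$ as $N\to\infty$. **Theorem.** Let $H$ be a graph with $h$ vertices. (1) $c_H(\gamma)\ge \gamma^{1/2+o(1)}$ for all $\gamma\in(0,1)$, where the $o(1)$ term depends only on $H$ and $\gamma$ and tends to $0$ as $\gamma\to 0$. (2) There is a constant $\delta_H>0$ depending only on $H$ such that for every $\gamma\in(0,\tfrac12]$ there is an $N_0$ (depending on $H$ and $\gamma$) such that for all $N\ge N_0$, every $N$-vertex graph with at least $\gamma N^h$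 copies of $H$ contains a blowup $H[t]$ with $$t\ \ge\ \frac{\delta_H\sqrt{\gamma}}{(\log\frac1\gamma)^2}\,\log N .$$ -/

import Mathlib

open Filter Topology
open scoped ENNReal

namespace Nikiforov

/-- The `t`-blowup `H[t]`: every vertex `w` of `H` is replaced by the independent set `{w} × Fin t`
of `t` vertices, and every edge of `H` by a complete bipartite graph between the two corresponding
sets. -/
def blowup {W : Type*} (H : SimpleGraph W) (t : ℕ) : SimpleGraph (W × Fin t) :=
  H.comap Prod.fst

theorem blowup_adj {W : Type*} (H : SimpleGraph W) (t : ℕ) (x y : W × Fin t) :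
    (blowup H t).Adj x y ↔ H.Adj x.1 y.1 :=
  Iff.rfl

/-- The constant `c` is admissible for `H` and `γ`: there is an error term `o(N) → 0` such that
every `N`-vertex graph with at least `γ N ^ h` (unlabelled, not necessarily induced) copies of the
`h`-vertex graph `H` contains a blowup `H[t]` with `t ≥ (c - o(N)) log₂ N`. -/
def IsAdmissible {W : Type*} [Fintype W] (H : SimpleGraph W) (γ c : ℝ) : Prop :=
  ∃ o : ℕ → ℝ, Tendsto o atTop (𝓝 0) ∧
    ∀ (N : ℕ) (G : SimpleGraph (Fin N)),
      γ * (N : ℝ) ^ Fintype.card W ≤ (G.copyCount H : ℝ) →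
        ∃ t : ℕ, (c - o N) * Real.logb 2 N ≤ (t : ℝ) ∧ (blowup H t).IsContained G

/-- The optimal constant `c_H(γ)` in Nikiforov's theorem: the supremum of all admissible `c > 0`.
It is taken in `[0, ∞]`, because every `c` is admissible when, for instance, `H` has no edges. -/
noncomputable def optConst {W : Type*} [Fintype W] (H : SimpleGraph W) (γ : ℝ) : ℝ≥0∞ :=
  sSup (ENNReal.ofReal '' {c : ℝ | 0 < c ∧ IsAdmissible H γ c})

end Nikiforov

/-! Put one copy of the vertex set in place of each vertex of `H`, so that copies become transversal
cliques of a system of relations `E i j` between parts `A i`, one for each index. If the density of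
the copies is `exp (-ℓ)` and the parts have at least `exp s` points, completely joined subsets of
size of order `exp (-(ℓ / 2)) / ℓ ^ 2 * s` are wanted; then `ℓ = log (1 / γ)` and `s = log N` give
the theorem. The proof is by induction on the number `h` of indices and plays two constructions
against each other.

Sparse pairs help along a Hamiltonian path. One part after the other is cut down to `m` points, of
order `s / ℓ`, that are completely joined to the next part and to the small parts already built
(`path_step`). If the density between two consecutive parts is at most `q`, even in subsets, the
copies concentrate on few pairs, and the relative density of the copies grows by a factor of order
`1 / q`. At the end each small part keeps about `exp (-ℓ) * ∏ 1 / q` of its `m` points, which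
suffices if `∏ q ≤ exp (-(ℓ / 2))` with a little room.

Dense pairs help in a star. Points of the part `o` are chosen one by one and the other parts are
restricted to their neighbourhoods (`exists_star`). Each time the box is first chosen to maximize
`dens * vol ^ lam` for a tiny `lam`; by maximality copies cannot concentrate outside the
neighbourhoods, so a step costs only a factor `1 - κ` of the density, with `κ` of order `lam * L /
ρ`. Here `ρ` is the product of the relative degrees at `o`, one index `j₀` excepted, and `exp (-L)`
the product of all of them. If `ρ ≥ exp (-(ℓ / 2))`, there is time for enough points, and the
induction hypothesis for the other indices completes the blowup (`HasBlowup.extend`).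

If the star process gets stuck, some pair is sparser than its current bound by a factor `K ^ 2` in a
large subbox. Then either the copies are denser by a factor of order `K` in a subbox, or deleting
edges that carry few copies lowers the hereditary bound for this pair by a factor `K`
(`exists_dense_box_or_regular`). Both can happen only a bounded number of times, as a density is at
most `1` and no pair can be much sparser than the copies. If no star satisfies the degree condition,
averaging over the omitted index and over all Hamiltonian paths produces a path that is sparse
enough (`step_alternative`). -/

section Proof

open scoped Classical

set_option linter.unusedSectionVars false

namespace Nikiforov

/-! ### Transversal copies in boxes and elementary counting -/

section Systems

variable {W V : Type*} [Fintype W] [DecidableEq W] [DecidableEq V]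

/-- The transversal copies in the box `A`: the choices of one point of every `A i` such that any two
of them are related by `E`. -/
noncomputable def copies (E : W → W → V → V → Prop) (A : W → Finset V) : Finset (W → V) :=
  (Fintype.piFinset A).filter fun f => ∀ i j, i ≠ j → E i j (f i) (f j)

/-- The number of points of the box `A`, as a real number. -/
noncomputable def vol (A : W → Finset V) : ℝ := ∏ i, ((A i).card : ℝ)

/-- There are pairwise completely related subsets of the parts of `A` of at least `t` points. -/
def HasBlowup (E : W → W → V → V → Prop) (A : W → Finset V) (t : ℝ) : Prop :=
  ∃ S : W → Finset V, (∀ i, S i ⊆ A i) ∧ (∀ i, t ≤ ((S i).card : ℝ)) ∧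
    ∀ i j, i ≠ j → ∀ x ∈ S i, ∀ y ∈ S j, E i j x y

/-- The number of related pairs in `X × Y`, as a real number. -/
noncomputable def edgeCount (R : V → V → Prop) (X Y : Finset V) : ℝ :=
  (((X ×ˢ Y).filter fun p => R p.1 p.2).card : ℝ)

theorem mem_copies {E : W → W → V → V → Prop} {A : W → Finset V} {f : W → V} :
    f ∈ copies E A ↔ (∀ i, f i ∈ A i) ∧ ∀ i j, i ≠ j → E i j (f i) (f j) := by
  simp [copies, Fintype.mem_piFinset]

theorem HasBlowup.mono {E E' : W → W → V → V → Prop} {A A' : W → Finset V} {t t' : ℝ}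
    (hE : ∀ i j x y, E i j x y → E' i j x y) (hA : ∀ i, A i ⊆ A' i) (ht : t' ≤ t)
    (h : HasBlowup E A t) : HasBlowup E' A' t' := by
  obtain ⟨S, h0, h1, h2⟩ := h
  exact ⟨S, fun i => (h0 i).trans (hA i), fun i => ht.trans (h1 i),
    fun i j hij x hx y hy => hE _ _ _ _ (h2 i j hij x hx y hy)⟩

theorem vol_nonneg (A : W → Finset V) : 0 ≤ vol A :=
  Finset.prod_nonneg fun _ _ => Nat.cast_nonneg _

theorem vol_pos {A : W → Finset V} (hA : ∀ i, (A i).Nonempty) : 0 < vol A :=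
  Finset.prod_pos fun i _ => by exact_mod_cast (hA i).card_pos

theorem vol_update (A : W → Finset V) (n : W) (C : Finset V) :
    vol (Function.update A n C) = C.card * ∏ i ∈ Finset.univ.erase n, ((A i).card : ℝ) := by
  unfold vol
  rw [← Finset.mul_prod_erase Finset.univ _ (Finset.mem_univ n)]
  simp only [Function.update_self]
  congr 1
  refine Finset.prod_congr rfl fun i hi => ?_
  rw [Function.update_of_ne (Finset.ne_of_mem_erase hi)]

theorem vol_eq_mul (A : W → Finset V) (n : W) :
    vol A = (A n).card * ∏ i ∈ Finset.univ.erase n, ((A i).card : ℝ) := by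
  rw [← vol_update, Function.update_eq_self]

/-- The coordinates in `D` are prescribed and the others are free. The cases of no, one and two
prescribed coordinates give the trivial upper bounds below. -/
theorem card_copies_filter_le (E : W → W → V → V → Prop) (A : W → Finset V) (D : Finset W)
    (g : W → V) :
    ((((copies E A).filter fun f => ∀ i ∈ D, f i = g i).card : ℕ) : ℝ) ≤
      ∏ i ∈ Finset.univ \ D, ((A i).card : ℝ) := by
  have h : ((copies E A).filter fun f => ∀ i ∈ D, f i = g i) ⊆
      Fintype.piFinset (fun i => if i ∈ D then {g i} else A i) := by
    intro f hf
    rw [Finset.mem_filter, mem_copies] at hf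
    rw [Fintype.mem_piFinset]
    intro i
    by_cases hi : i ∈ D
    · simp [hi, hf.2 i hi]
    · simp [hi, hf.1.1 i]
  have h2 := Finset.card_le_card h
  rw [Fintype.card_piFinset] at h2
  have h3 : ∏ i, (if i ∈ D then ({g i} : Finset V) else A i).card =
      ∏ i ∈ Finset.univ \ D, (A i).card := by
    rw [← Finset.prod_sdiff (Finset.subset_univ D)]
    rw [Finset.prod_eq_one (s := D)]
    · rw [mul_one]
      refine Finset.prod_congr rfl fun i hi => ?_
      simp [(Finset.mem_sdiff.1 hi).2]
    · intro i hi
      simp [hi]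
  rw [h3] at h2
  exact_mod_cast h2

theorem card_copies_le_vol (E : W → W → V → V → Prop) (A : W → Finset V) :
    ((copies E A).card : ℝ) ≤ vol A := by
  by_cases h : (copies E A).Nonempty
  · obtain ⟨g, -⟩ := h
    simpa [vol] using card_copies_filter_le E A ∅ g
  · rw [Finset.not_nonempty_iff_eq_empty.1 h]
    simpa using vol_nonneg A

theorem copies_update (E : W → W → V → V → Prop) {A : W → Finset V} {n : W} {C : Finset V}
    (hC : C ⊆ A n) :
    copies E (Function.update A n C) = (copies E A).filter fun f => f n ∈ C := by
  ext f
  simp only [mem_copies, Finset.mem_filter]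
  constructor
  · rintro ⟨h1, h2⟩
    have hn : f n ∈ C := by simpa using h1 n
    refine ⟨⟨fun i => ?_, h2⟩, hn⟩
    by_cases hi : i = n
    · subst hi; exact hC hn
    · simpa [Function.update_of_ne hi] using h1 i
  · rintro ⟨⟨h1, h2⟩, hn⟩
    refine ⟨fun i => ?_, h2⟩
    by_cases hi : i = n
    · subst hi; simpa using hn
    · simpa [Function.update_of_ne hi] using h1 i

/-- The number of copies that send `n` to `y`. -/
noncomputable def copiesAt (E : W → W → V → V → Prop) (A : W → Finset V) (n : W) (y : V) : ℝ :=
  (((copies E A).filter fun f => f n = y).card : ℝ)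

theorem copiesAt_le (E : W → W → V → V → Prop) (A : W → Finset V) (n : W) (y : V) :
    copiesAt E A n y ≤ ∏ i ∈ Finset.univ.erase n, ((A i).card : ℝ) := by
  have := card_copies_filter_le E A {n} (fun _ => y)
  simpa [copiesAt, Finset.sdiff_singleton_eq_erase] using this

theorem sum_copiesAt (E : W → W → V → V → Prop) {A : W → Finset V} {n : W} {C : Finset V}
    (hC : C ⊆ A n) :
    ∑ y ∈ C, copiesAt E A n y = ((copies E (Function.update A n C)).card : ℝ) := by
  rw [copies_update E hC, Finset.card_eq_sum_card_fiberwise (f := fun f => f n) (t := C)]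
  · push_cast
    refine Finset.sum_congr rfl fun y hy => ?_
    unfold copiesAt
    rw [Finset.filter_filter]
    congr 2
    ext f
    simp only [Finset.mem_filter]
    constructor
    · rintro ⟨h1, h2⟩; exact ⟨h1, h2 ▸ hy, h2⟩
    · rintro ⟨h1, -, h2⟩; exact ⟨h1, h2⟩
  · intro f hf
    exact (Finset.mem_filter.1 hf).2

/-- The number of copies that send `c` to `x` and `n` to `y`. -/
noncomputable def copiesAtPair (E : W → W → V → V → Prop) (A : W → Finset V) (c n : W)
    (x y : V) : ℝ :=
  (((copies E A).filter fun f => f c = x ∧ f n = y).card : ℝ)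

theorem copiesAtPair_le (E : W → W → V → V → Prop) (A : W → Finset V) {c n : W} (hcn : c ≠ n)
    (x y : V) :
    copiesAtPair E A c n x y ≤ ∏ i ∈ (Finset.univ.erase n).erase c, ((A i).card : ℝ) := by
  have := card_copies_filter_le E A {c, n} (fun i => if i = c then x else y)
  have e : (Finset.univ \ {c, n} : Finset W) = (Finset.univ.erase n).erase c := by
    ext i; simp
  rw [e] at this
  refine le_trans (le_of_eq ?_) this
  unfold copiesAtPair
  congr 2
  ext f
  simp [hcn.symm]

theorem sum_copiesAtPair (E : W → W → V → V → Prop) {A : W → Finset V} {c n : W}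
    {F : Finset (V × V)} :
    ∑ p ∈ F, copiesAtPair E A c n p.1 p.2 =
      (((copies E A).filter fun f => (f c, f n) ∈ F).card : ℝ) := by
  rw [Finset.card_eq_sum_card_fiberwise (f := fun f => (f c, f n)) (t := F)]
  · push_cast
    refine Finset.sum_congr rfl fun p hp => ?_
    unfold copiesAtPair
    rw [Finset.filter_filter]
    congr 2
    ext f
    simp only [Finset.mem_filter]
    constructor
    · rintro ⟨h1, h2, h3⟩
      have : (f c, f n) = p := by ext <;> simp [h2, h3]
      exact ⟨h1, this ▸ hp, this⟩
    · rintro ⟨h1, -, h2⟩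
      exact ⟨h1, by simp [← h2], by simp [← h2]⟩
  · intro f hf
    exact (Finset.mem_filter.1 hf).2

theorem copiesAtPair_eq_zero {E : W → W → V → V → Prop} {A : W → Finset V} {c n : W}
    (hcn : c ≠ n) {x y : V} (h : ¬ E c n x y) : copiesAtPair E A c n x y = 0 := by
  unfold copiesAtPair
  rw [Nat.cast_eq_zero, Finset.card_eq_zero, Finset.filter_eq_empty_iff]
  rintro f hf ⟨rfl, rfl⟩
  exact h ((mem_copies.1 hf).2 c n hcn)

/-- The density of the copies is at most the edge density between any two parts. -/
theorem card_copies_le_edgeCount (E : W → W → V → V → Prop) (A : W → Finset V) {c n : W}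
    (hcn : c ≠ n) :
    ((copies E A).card : ℝ) ≤
      edgeCount (E c n) (A c) (A n) * ∏ i ∈ (Finset.univ.erase n).erase c, ((A i).card : ℝ) := by
  set F := ((A c) ×ˢ (A n)).filter fun p => E c n p.1 p.2
  have h1 : ((copies E A).card : ℝ) = ∑ p ∈ F, copiesAtPair E A c n p.1 p.2 := by
    rw [sum_copiesAtPair E, Finset.filter_true_of_mem]
    intro f hf
    rw [mem_copies] at hf
    exact Finset.mem_filter.2 ⟨Finset.mem_product.2 ⟨hf.1 c, hf.1 n⟩, hf.2 c n hcn⟩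
  rw [h1]
  refine (Finset.sum_le_sum fun p _ => copiesAtPair_le E A hcn p.1 p.2).trans ?_
  rw [Finset.sum_const, nsmul_eq_mul]
  rfl

theorem vol_eq_mul_mul (A : W → Finset V) {c n : W} (hcn : c ≠ n) :
    vol A = (A c).card * (A n).card *
      ∏ i ∈ (Finset.univ.erase n).erase c, ((A i).card : ℝ) := by
  rw [vol_eq_mul A n, ← Finset.mul_prod_erase (Finset.univ.erase n) _
    (Finset.mem_erase.2 ⟨hcn, Finset.mem_univ c⟩)]
  ring

end Systems

/-! ### Joining the next part along a path -/

section Path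

variable {W V : Type*} [Fintype W] [DecidableEq W] [DecidableEq V]

theorem edgeCount_eq_sum (R : V → V → Prop) (X Y : Finset V) :
    edgeCount R X Y = ∑ y ∈ Y, ((X.filter fun x => R x y).card : ℝ) := by
  unfold edgeCount
  rw [Finset.card_filter, Finset.sum_product_right]
  push_cast
  refine Finset.sum_congr rfl fun y _ => ?_
  rw [Finset.card_filter]
  push_cast
  rfl

/-- A dense bipartite graph contains a complete bipartite graph with logarithmically many vertices
on one side and a large part of the vertices on the other. -/
theorem exists_complete_pair {R : V → V → Prop} {X Y : Finset V} {δ : ℝ} (hδ : 0 < δ)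
    (hδ1 : δ ≤ 1) {m : ℕ} (hX : X.Nonempty) (hm : (m : ℝ) ≤ δ / 4 * X.card)
    (h : δ * (X.card * Y.card) ≤ edgeCount R X Y) :
    ∃ S ⊆ X, ∃ Y' ⊆ Y, S.card = m ∧ (δ / 4) ^ m * (δ / 2) * Y.card ≤ (Y'.card : ℝ) ∧
      ∀ x ∈ S, ∀ y ∈ Y', R x y := by
  have hX0 : (0 : ℝ) < X.card := by exact_mod_cast hX.card_pos
  set deg : V → ℝ := fun y => ((X.filter fun x => R x y).card : ℝ) with hdeg
  set Y0 := Y.filter fun y => δ / 2 * X.card ≤ deg y with hY0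
  have hY0c : δ / 2 * Y.card ≤ (Y0.card : ℝ) := by
    rw [edgeCount_eq_sum] at h
    have h1 : ∑ y ∈ Y, deg y ≤ Y0.card * X.card + Y.card * (δ / 2 * X.card) := by
      rw [← Finset.sum_filter_add_sum_filter_not Y (fun y => δ / 2 * X.card ≤ deg y)]
      refine add_le_add ?_ ?_
      · rw [← nsmul_eq_mul]
        exact Finset.sum_le_card_nsmul _ _ _ fun y _ =>
          Nat.cast_le.2 (Finset.card_le_card (Finset.filter_subset _ _))
      · refine (Finset.sum_le_card_nsmul _ _ (δ / 2 * X.card) fun y hy => ?_).trans ?_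
        · exact (not_le.1 (Finset.mem_filter.1 hy).2).le
        · rw [nsmul_eq_mul]
          refine mul_le_mul_of_nonneg_right ?_ (by positivity)
          exact_mod_cast Finset.card_filter_le _ _
    have h2 : δ / 2 * Y.card * X.card ≤ Y0.card * X.card := by nlinarith
    exact le_of_mul_le_mul_right h2 hX0
  -- Greedy choice of `x`: a point of `Y0` has at least `δ / 2 * |X|` neighbours in `X`, of which
  -- the chosen set `S` takes away at most `m ≤ δ / 4 * |X|`. On average a new `x` therefore keeps a
  -- share `δ / 4` of `Y'`.
  have key : ∀ k : ℕ, k ≤ m → ∃ S ⊆ X, ∃ Y' ⊆ Y0, S.card = k ∧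
      (δ / 4) ^ k * Y0.card ≤ (Y'.card : ℝ) ∧ ∀ x ∈ S, ∀ y ∈ Y', R x y := by
    intro k
    induction k with
    | zero => exact fun _ => ⟨∅, by simp, Y0, subset_rfl, by simp, by simp, by simp⟩
    | succ k ih =>
      intro hk
      obtain ⟨S, hS, Y', hY', hSc, hYc, hR⟩ := ih (by omega)
      have hkm : (k : ℝ) + 1 ≤ m := by exact_mod_cast hk
      have hne : (X \ S).Nonempty := by
        rw [← Finset.card_pos, Finset.card_sdiff_of_subset hS, hSc, Nat.sub_pos_iff_lt]
        have : (k : ℝ) < X.card := by nlinarith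
        exact_mod_cast this
      obtain ⟨x, hx, hxd⟩ : ∃ x ∈ X \ S,
          δ / 4 * Y'.card ≤ ((Y'.filter fun y => R x y).card : ℝ) := by
        refine Finset.exists_le_of_sum_le hne ?_
        rw [Finset.sum_const, nsmul_eq_mul]
        have e : ∑ x ∈ X \ S, ((Y'.filter fun y => R x y).card : ℝ) =
            ∑ y ∈ Y', (((X \ S).filter fun x => R x y).card : ℝ) := by
          simp only [Finset.card_filter]
          push_cast
          rw [Finset.sum_comm]
        rw [e]
        have h3 : ∀ y ∈ Y', δ / 4 * X.card ≤ (((X \ S).filter fun x => R x y).card : ℝ) := by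
          intro y hy
          have h4 : δ / 2 * X.card ≤ deg y := (Finset.mem_filter.1 (hY' hy)).2
          have h5 : deg y ≤ (((X \ S).filter fun x => R x y).card : ℝ) + S.card := by
            have : (X.filter fun x => R x y) ⊆ ((X \ S).filter fun x => R x y) ∪ S := by
              intro z hz
              rw [Finset.mem_filter] at hz
              by_cases hzS : z ∈ S <;> simp [hzS, hz.1, hz.2]
            have := (Finset.card_le_card this).trans (Finset.card_union_le _ _)
            simp only [hdeg]
            exact_mod_cast this
          rw [hSc] at h5
          linarith
        have h6 := Finset.card_nsmul_le_sum Y' _ _ h3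
        rw [nsmul_eq_mul] at h6
        have h7 : ((X \ S).card : ℝ) ≤ X.card := by
          exact_mod_cast Finset.card_le_card Finset.sdiff_subset
        calc ((X \ S).card : ℝ) * (δ / 4 * Y'.card) ≤ X.card * (δ / 4 * Y'.card) := by gcongr
          _ = Y'.card * (δ / 4 * X.card) := by ring
          _ ≤ _ := h6
      rw [Finset.mem_sdiff] at hx
      refine ⟨insert x S, Finset.insert_subset hx.1 hS, Y'.filter fun y => R x y,
        (Finset.filter_subset _ _).trans hY', by rw [Finset.card_insert_of_notMem hx.2, hSc],
        ?_, ?_⟩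
      · refine le_trans ?_ hxd
        rw [pow_succ, mul_comm _ (δ / 4), mul_assoc]
        gcongr
      · intro z hz y hy
        rw [Finset.mem_filter] at hy
        rcases Finset.mem_insert.1 hz with rfl | hz
        · exact hy.2
        · exact hR z hz y hy.1
  obtain ⟨S, hS, Y', hY', hSc, hYc, hR⟩ := key m le_rfl
  refine ⟨S, hS, Y', hY'.trans (Finset.filter_subset _ _), hSc, le_trans ?_ hYc, hR⟩
  rw [mul_assoc]
  gcongr

/-- Among few classes there is a large one of large average weight. -/
theorem exists_heavy_class {T : Type*} [DecidableEq T] {Y : Finset V} {w : V → ℝ} {Z Γ k : ℝ}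
    (hY : Y.Nonempty) (hZ : 0 < Z) (hΓ : 0 < Γ) (hk : 0 < k) (hw : ∀ y ∈ Y, w y ≤ Z)
    (hsum : Γ * (Z * Y.card) ≤ ∑ y ∈ Y, w y) (key : V → T) (hkey : ((Y.image key).card : ℝ) ≤ k) :
    ∃ y₀ ∈ Y, Γ / 2 * Y.card / k ≤ ((Y.filter fun y => key y = key y₀).card : ℝ) ∧
      Γ / 2 * (Z * (Y.filter fun y => key y = key y₀).card) ≤
        ∑ y ∈ Y.filter (fun y => key y = key y₀), w y := by
  by_contra! hcon
  have hY0 : (0 : ℝ) < Y.card := by exact_mod_cast hY.card_pos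
  -- A small class is bounded by the first term, a light one by the second. Over at most `k` classes
  -- each term sums to at most half of the total weight.
  have h1 : ∀ τ ∈ Y.image key, ∑ y ∈ Y.filter (fun y => key y = τ), w y <
      Z * (Γ / 2 * Y.card / k) + Γ / 2 * (Z * (Y.filter fun y => key y = τ).card) := by
    intro τ hτ
    obtain ⟨y₀, hy₀, rfl⟩ := Finset.mem_image.1 hτ
    rcases lt_or_ge ((Y.filter fun y => key y = key y₀).card : ℝ) (Γ / 2 * Y.card / k) with h | h
    · have h2 : ∑ y ∈ Y.filter (fun y => key y = key y₀), w y ≤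
          (Y.filter fun y => key y = key y₀).card * Z := by
        rw [← nsmul_eq_mul]
        exact Finset.sum_le_card_nsmul _ _ _ fun y hy => hw y (Finset.mem_filter.1 hy).1
      have h3 : 0 < ((Y.filter fun y => key y = key y₀).card : ℝ) := by
        exact_mod_cast Finset.card_pos.2 ⟨y₀, by simp [hy₀]⟩
      have h4 : 0 < Γ / 2 * (Z * ((Y.filter fun y => key y = key y₀).card : ℝ)) := by positivity
      nlinarith
    · have := hcon y₀ hy₀ h
      have h5 : 0 < Z * (Γ / 2 * Y.card / k) := by positivity
      linarith
  have h2 : ∑ y ∈ Y, w y = ∑ τ ∈ Y.image key, ∑ y ∈ Y.filter (fun y => key y = τ), w y :=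
    (Finset.sum_fiberwise_of_maps_to (fun y hy => Finset.mem_image_of_mem key hy) w).symm
  have h3 := Finset.sum_lt_sum_of_nonempty (hY.image key) h1
  rw [← h2, Finset.sum_add_distrib, Finset.sum_const, nsmul_eq_mul, ← Finset.mul_sum,
    ← Finset.mul_sum] at h3
  have h4 : ∑ τ ∈ Y.image key, ((Y.filter fun y => key y = τ).card : ℝ) = Y.card := by
    have := Finset.card_eq_sum_card_image key Y
    exact_mod_cast this.symm
  rw [h4] at h3
  have h5 : ((Y.image key).card : ℝ) * (Z * (Γ / 2 * Y.card / k)) ≤ Γ / 2 * (Z * Y.card) := by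
    calc ((Y.image key).card : ℝ) * (Z * (Γ / 2 * Y.card / k))
        ≤ k * (Z * (Γ / 2 * Y.card / k)) := by gcongr
      _ = Γ / 2 * (Z * Y.card) := by field_simp
  linarith

/-- The size of `B i`, replaced by the upper bound `m` for the indices in `D`. -/
noncomputable def sizeBound (D : Finset W) (m : ℕ) (B : W → Finset V) (i : W) : ℝ :=
  if i ∈ D then (m : ℝ) else ((B i).card : ℝ)

theorem sizeBound_pos {D : Finset W} {m : ℕ} (hm : 0 < m) {B : W → Finset V}
    (hB : ∀ i, i ∉ D → (B i).Nonempty) (i : W) : 0 < sizeBound D m B i := by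
  unfold sizeBound
  split_ifs with h
  · exact_mod_cast hm
  · exact_mod_cast (hB i h).card_pos

theorem card_le_sizeBound {D : Finset W} {m : ℕ} {B : W → Finset V}
    (hB : ∀ i ∈ D, (B i).card ≤ m) (i : W) : ((B i).card : ℝ) ≤ sizeBound D m B i := by
  unfold sizeBound
  split_ifs with h
  · exact_mod_cast hB i h
  · exact le_rfl

theorem prod_sizeBound {D : Finset W} {m : ℕ} {B : W → Finset V} {c n : W} (hcn : c ≠ n) :
    ∏ i, sizeBound D m B i = sizeBound D m B c * sizeBound D m B n *
      ∏ i ∈ (Finset.univ.erase n).erase c, sizeBound D m B i := by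
  rw [← Finset.mul_prod_erase Finset.univ _ (Finset.mem_univ n),
    ← Finset.mul_prod_erase (Finset.univ.erase n) _
    (Finset.mem_erase.2 ⟨hcn, Finset.mem_univ c⟩)]
  ring

set_option maxHeartbeats 1000000 in
/-- If the indices in `D` and `c` are already completely joined, then `c` can be shrunk to `m`
points and the next index `n` completely joined to all these, at a loss that depends only on the
density `q` between `c` and `n`. -/
theorem path_step {E : W → W → V → V → Prop} (hE : ∀ i j x y, E i j x y → E j i y x)
    {D : Finset W} {c n : W} (hcD : c ∉ D) (hnD : n ∉ D) (hcn : c ≠ n) {B : W → Finset V} {m : ℕ}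
    {Γ q : ℝ} (hm : 0 < m) (hΓ : 0 < Γ) (hq0 : 0 < q) (hq1 : q ≤ 1)
    (hB : ∀ i ∈ D, (B i).card ≤ m)
    (hcomp : ∀ i ∈ D, ∀ j ∈ insert c D, i ≠ j → ∀ x ∈ B i, ∀ y ∈ B j, E i j x y)
    (hcop : Γ * ∏ i, sizeBound D m B i ≤ ((copies E B).card : ℝ))
    (hne : ∀ i, i ∉ D → (B i).Nonempty)
    (hq : edgeCount (E c n) (B c) (B n) ≤ q * ((B c).card * (B n).card))
    (hlarge : (m : ℝ) ≤ Γ / 8 * (B c).card) :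
    ∃ B' : W → Finset V, (∀ i, B' i ⊆ B i) ∧ (∀ i ∈ insert c D, (B' i).card ≤ m) ∧
      (∀ i ∈ insert c D, ∀ j ∈ insert n (insert c D), i ≠ j →
        ∀ x ∈ B' i, ∀ y ∈ B' j, E i j x y) ∧
      (∀ i, i ∉ insert c D → i ≠ n → B' i = B i) ∧
      Γ / (4 * q) * ∏ i, sizeBound (insert c D) m B' i ≤ ((copies E B').card : ℝ) ∧
      (Γ / 8) ^ (m + 2) / 2 ^ (m * Fintype.card W) * (B n).card ≤ ((B' n).card : ℝ) := by
  set Z := ∏ i ∈ (Finset.univ.erase n).erase c, sizeBound D m B i with hZdef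
  have hZ : 0 < Z := Finset.prod_pos fun i _ => sizeBound_pos hm hne i
  have hBc : (0 : ℝ) < (B c).card := by exact_mod_cast (hne c hcD).card_pos
  have hBn : (0 : ℝ) < (B n).card := by exact_mod_cast (hne n hnD).card_pos
  have hprod : ∏ i, sizeBound D m B i = (B c).card * (B n).card * Z := by
    rw [prod_sizeBound hcn]
    simp [sizeBound, hcD, hnD, hZdef]
  rw [hprod] at hcop
  have hcap : ∀ x y, copiesAtPair E B c n x y ≤ Z := fun x y =>
    (copiesAtPair_le E B hcn x y).trans
      (Finset.prod_le_prod (fun _ _ => Nat.cast_nonneg _) fun i _ => card_le_sizeBound hB i)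
  -- Related pairs below the threshold account for at most half of the copies, because there are at
  -- most `q * |B c| * |B n|` of them. The remaining pairs have density at least `Γ / 2`, and each
  -- is richer in copies than average by a factor of order `1 / q`; this is the gain of the step.
  set θ := Γ / (2 * q) * Z with hθ
  have hθ0 : 0 < θ := by positivity
  set R : V → V → Prop := fun x y => θ ≤ copiesAtPair E B c n x y with hR
  have hRE : ∀ x y, R x y → E c n x y := by
    intro x y h
    by_contra hn
    have := copiesAtPair_eq_zero (A := B) hcn hn
    simp only [hR] at h
    linarith
  -- many pairs lie in many copies
  have hsplit : ((copies E B).card : ℝ) ≤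
      edgeCount R (B c) (B n) * Z + edgeCount (E c n) (B c) (B n) * θ := by
    set F := ((B c) ×ˢ (B n)).filter fun p => E c n p.1 p.2 with hF
    have h1 : ((copies E B).card : ℝ) = ∑ p ∈ F, copiesAtPair E B c n p.1 p.2 := by
      rw [sum_copiesAtPair E, Finset.filter_true_of_mem]
      intro f hf
      rw [mem_copies] at hf
      exact Finset.mem_filter.2 ⟨Finset.mem_product.2 ⟨hf.1 c, hf.1 n⟩, hf.2 c n hcn⟩
    rw [h1, ← Finset.sum_filter_add_sum_filter_not F (fun p => R p.1 p.2)]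
    refine add_le_add ?_ ?_
    · refine (Finset.sum_le_card_nsmul _ _ Z fun p _ => hcap _ _).trans ?_
      rw [nsmul_eq_mul]
      refine mul_le_mul_of_nonneg_right ?_ hZ.le
      unfold edgeCount
      refine Nat.cast_le.2 (Finset.card_le_card fun p hp => ?_)
      simp only [hF, Finset.mem_filter] at hp ⊢
      exact ⟨hp.1.1, hp.2⟩
    · refine (Finset.sum_le_card_nsmul _ _ θ fun p hp => ?_).trans ?_
      · exact (not_le.1 (Finset.mem_filter.1 hp).2).le
      · rw [nsmul_eq_mul]
        refine mul_le_mul_of_nonneg_right ?_ hθ0.le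
        unfold edgeCount
        exact Nat.cast_le.2 (Finset.card_le_card (Finset.filter_subset _ _))
  have hmany : Γ / 2 * ((B c).card * (B n).card) ≤ edgeCount R (B c) (B n) := by
    have h1 : edgeCount (E c n) (B c) (B n) * θ ≤ Γ / 2 * ((B c).card * (B n).card) * Z := by
      calc edgeCount (E c n) (B c) (B n) * θ ≤ q * ((B c).card * (B n).card) * θ := by gcongr
        _ = Γ / 2 * ((B c).card * (B n).card) * Z := by rw [hθ]; field_simp
    have h2 : Γ / 2 * ((B c).card * (B n).card) * Z ≤ edgeCount R (B c) (B n) * Z := by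
      nlinarith
    exact le_of_mul_le_mul_right h2 hZ
  have hΓ1 : Γ / 2 ≤ 1 := by
    have h1 : edgeCount R (B c) (B n) ≤ 1 * ((B c).card * (B n).card) := by
      unfold edgeCount
      rw [one_mul, ← Nat.cast_mul, ← Finset.card_product]
      exact Nat.cast_le.2 (Finset.card_filter_le _ _)
    exact le_of_mul_le_mul_right (hmany.trans h1) (by positivity)
  obtain ⟨S, hS, Y, hY, hSc, hYc, hSY⟩ := exists_complete_pair (m := m) (by positivity) hΓ1
    (hne c hcD) (by linarith) hmany
  have hY0 : (0 : ℝ) < Y.card := lt_of_lt_of_le (by positivity) hYc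
  have hYne : Y.Nonempty := Finset.card_pos.1 (by exact_mod_cast hY0)
  set B₁ := Function.update (Function.update B c S) n Y with hB₁
  have hYB : Y ⊆ (Function.update B c S) n := by
    rw [Function.update_of_ne hcn.symm]; exact hY
  have hB₁n : B₁ n = Y := by simp [hB₁]
  have hB₁c : B₁ c = S := by simp [hB₁, Function.update_of_ne hcn]
  have hB₁o : ∀ i, i ≠ c → i ≠ n → B₁ i = B i := fun i h1 h2 => by
    simp [hB₁, Function.update_of_ne h1, Function.update_of_ne h2]
  have hcop1 : Γ / (2 * q) * (Z * m * Y.card) ≤ ((copies E B₁).card : ℝ) := by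
    have e : copies E B₁ = (copies E B).filter fun f => (f c, f n) ∈ S ×ˢ Y := by
      rw [hB₁, copies_update E hYB, copies_update E hS, Finset.filter_filter]
      congr 1
      ext f
      simp
    rw [e, ← sum_copiesAtPair E]
    have := Finset.card_nsmul_le_sum (S ×ˢ Y) (fun p => copiesAtPair E B c n p.1 p.2) θ
      fun p hp => by
        rw [Finset.mem_product] at hp
        exact hSY _ hp.1 _ hp.2
    refine le_trans (le_of_eq ?_) this
    rw [nsmul_eq_mul, Finset.card_product, hSc, hθ]
    push_cast
    ring
  set w : V → ℝ := fun y => copiesAt E B₁ n y with hw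
  have hwZ : ∀ y ∈ Y, w y ≤ Z * m := by
    intro y _
    refine (copiesAt_le E B₁ n y).trans ?_
    rw [← Finset.mul_prod_erase (Finset.univ.erase n) _
      (Finset.mem_erase.2 ⟨hcn, Finset.mem_univ c⟩), hB₁c, hSc, mul_comm]
    refine mul_le_mul_of_nonneg_right ?_ (Nat.cast_nonneg _)
    refine Finset.prod_le_prod (fun _ _ => Nat.cast_nonneg _) fun i hi => ?_
    simp only [Finset.mem_erase, Finset.mem_univ, and_true] at hi
    rw [hB₁o i hi.1 hi.2]
    exact card_le_sizeBound hB i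
  have hwsum : Γ / (2 * q) * (Z * m * Y.card) ≤ ∑ y ∈ Y, w y := by
    have := sum_copiesAt E (A := B₁) (n := n) (C := Y) (by rw [hB₁n])
    rw [← hB₁n, Function.update_eq_self, hB₁n] at this
    rw [this]
    exact hcop1
  -- Points of `Y` are classified by their neighbourhoods in the small parts. Within one class these
  -- parts can be cut down to the common neighbourhoods without losing a copy. The density stays
  -- measured against `m`, not against the new sizes.
  set key : V → W → Finset V := fun y i =>
    if i ∈ D then (B i).filter fun x => E i n x y else ∅ with hkey
  have hkeycard : ((Y.image key).card : ℝ) ≤ 2 ^ (m * Fintype.card W) := by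
    have h1 : Y.image key ⊆
        Fintype.piFinset (fun i => if i ∈ D then (B i).powerset else {∅}) := by
      intro τ hτ
      obtain ⟨y, -, rfl⟩ := Finset.mem_image.1 hτ
      rw [Fintype.mem_piFinset]
      intro i
      by_cases hi : i ∈ D
      · simp [hkey, hi, Finset.filter_subset]
      · simp [hkey, hi]
    have h2 := Finset.card_le_card h1
    rw [Fintype.card_piFinset] at h2
    have h3 : ∏ i, (if i ∈ D then (B i).powerset else {∅}).card ≤ ∏ _i : W, 2 ^ m := by
      refine Finset.prod_le_prod (fun _ _ => Nat.zero_le _) fun i _ => ?_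
      by_cases hi : i ∈ D
      · simp only [hi, if_true, Finset.card_powerset]
        exact Nat.pow_le_pow_right (by norm_num) (hB i hi)
      · simp only [hi, if_false, Finset.card_singleton]
        exact Nat.one_le_two_pow
    rw [Finset.prod_const, Finset.card_univ, ← pow_mul] at h3
    exact_mod_cast h2.trans h3
  obtain ⟨y₀, hy₀, hCc, hCw⟩ := exists_heavy_class hYne (mul_pos hZ (by exact_mod_cast hm))
    (by positivity : 0 < Γ / (2 * q)) (by positivity) hwZ hwsum key hkeycard
  set C := Y.filter fun y => key y = key y₀ with hC
  have hCY : C ⊆ Y := Finset.filter_subset _ _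
  set B₂ : W → Finset V := fun i =>
    if i = n then C else if i = c then S else if i ∈ D then key y₀ i else B i with hB₂
  have hB₂n : B₂ n = C := by simp [hB₂]
  have hB₂c : B₂ c = S := by simp [hB₂, hcn]
  have hB₂D : ∀ i ∈ D, B₂ i = (B i).filter fun x => E i n x y₀ := by
    intro i hi
    have h1 : i ≠ n := fun h => hnD (h ▸ hi)
    have h2 : i ≠ c := fun h => hcD (h ▸ hi)
    simp [hB₂, h1, h2, hi, hkey]
  have hB₂o : ∀ i, i ∉ insert c D → i ≠ n → B₂ i = B i := by
    intro i hi h1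
    rw [Finset.mem_insert, not_or] at hi
    simp [hB₂, h1, hi.1, hi.2]
  have hCkey : ∀ y ∈ C, ∀ i ∈ D, (B i).filter (fun x => E i n x y) =
      (B i).filter fun x => E i n x y₀ := by
    intro y hy i hi
    have := congrFun (Finset.mem_filter.1 hy).2 i
    simpa only [hkey, hi, if_true] using this
  have hsub : ∀ i, B₂ i ⊆ B i := by
    intro i
    by_cases h1 : i = n
    · subst h1; rw [hB₂n]; exact hCY.trans hY
    by_cases h2 : i = c
    · subst h2; rw [hB₂c]; exact hS
    by_cases h3 : i ∈ D
    · rw [hB₂D i h3]; exact Finset.filter_subset _ _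
    · rw [hB₂o i (by simp [h2, h3]) h1]
  refine ⟨B₂, hsub, ?_, ?_, hB₂o, ?_, ?_⟩
  · intro i hi
    rcases Finset.mem_insert.1 hi with rfl | hi
    · rw [hB₂c, hSc]
    · exact (Finset.card_le_card (hsub i)).trans (hB i hi)
  · have hDn : ∀ i ∈ D, ∀ x ∈ B₂ i, ∀ y ∈ B₂ n, E i n x y := by
      intro i hi x hx y hy
      rw [hB₂n] at hy
      rw [hB₂D i hi, ← hCkey y hy i hi] at hx
      exact (Finset.mem_filter.1 hx).2
    intro i hi j hj hij x hx y hy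
    rcases Finset.mem_insert.1 hj with rfl | hj
    · rcases Finset.mem_insert.1 hi with rfl | hi
      · rw [hB₂c] at hx
        rw [hB₂n] at hy
        exact hRE x y (hSY x hx y (hCY hy))
      · exact hDn i hi x hx y hy
    · rcases Finset.mem_insert.1 hi with rfl | hi
      · have hj' : j ∈ D := (Finset.mem_insert.1 hj).resolve_left (Ne.symm hij)
        exact hE _ _ _ _ (hcomp j hj' i (Finset.mem_insert_self _ _) (Ne.symm hij) y (hsub _ hy) x
          (hsub _ hx))
      · exact hcomp i hi j hj hij x (hsub _ hx) y (hsub _ hy)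
  · have h1 : ∏ i, sizeBound (insert c D) m B₂ i = Z * m * C.card := by
      rw [prod_sizeBound hcn]
      have h2 : ∏ i ∈ (Finset.univ.erase n).erase c, sizeBound (insert c D) m B₂ i = Z := by
        refine Finset.prod_congr rfl fun i hi => ?_
        simp only [Finset.mem_erase, Finset.mem_univ, and_true] at hi
        unfold sizeBound
        by_cases h3 : i ∈ D
        · simp [h3]
        · rw [hB₂o i (by simp [h3, hi.1]) hi.2]
          simp [h3, hi.1]
      rw [h2]
      simp only [sizeBound, Finset.mem_insert_self, if_true, Finset.mem_insert, hnD, or_false,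
        hcn.symm, if_false, hB₂n]
      ring
    rw [h1]
    have h2 : Γ / (4 * q) = Γ / (2 * q) / 2 := by field_simp; norm_num
    rw [h2]
    refine hCw.trans ?_
    rw [sum_copiesAt E (A := B₁) (n := n) (by rw [hB₁n]; exact hCY)]
    refine Nat.cast_le.2 (Finset.card_le_card fun f hf => ?_)
    rw [mem_copies] at hf ⊢
    refine ⟨fun i => ?_, hf.2⟩
    have hfn : f n ∈ C := by simpa using hf.1 n
    by_cases h1 : i = n
    · subst h1; rw [hB₂n]; exact hfn
    have hi := hf.1 i
    rw [Function.update_of_ne h1] at hi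
    by_cases h2 : i = c
    · subst h2; rw [hB₂c]; rwa [hB₁c] at hi
    rw [hB₁o i h2 h1] at hi
    by_cases h3 : i ∈ D
    · rw [hB₂D i h3, ← hCkey _ hfn i h3]
      exact Finset.mem_filter.2 ⟨hi, hf.2 i n h1⟩
    · rw [hB₂o i (by simp [h2, h3]) h1]; exact hi
  · rw [hB₂n]
    refine le_trans ?_ hCc
    have h1 : Γ / 2 ≤ Γ / (2 * q) := by
      rw [div_le_div_iff_of_pos_left hΓ (by norm_num) (by positivity)]
      linarith
    have e1 : Γ / 2 / 4 = Γ / 8 := by ring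
    rw [e1] at hYc
    rw [div_mul_eq_mul_div]
    refine div_le_div_of_nonneg_right ?_ (by positivity)
    have a0 : 0 ≤ Γ / 8 := by linarith
    have a1 : Γ / 8 ≤ Γ / (2 * q) / 2 := by linarith
    have a2 : (Γ / 8) ^ m * (Γ / 8) * (B n).card ≤ (Y.card : ℝ) :=
      le_trans (mul_le_mul_of_nonneg_right
        (mul_le_mul_of_nonneg_left (by linarith) (pow_nonneg a0 m)) hBn.le) hYc
    have a3 : (Γ / 8) ^ (m + 2) * (B n).card = Γ / 8 * ((Γ / 8) ^ m * (Γ / 8) * (B n).card) := by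
      ring
    rw [a3]
    exact mul_le_mul a1 a2 (mul_nonneg (mul_nonneg (pow_nonneg a0 m) a0) hBn.le) (a0.trans a1)

end Path

/-! ### Averaging over Hamiltonian paths -/

section HamiltonianPath

/-- The sum of `a` over the consecutive pairs of the list `c :: l`. -/
def chainSum {W : Type*} (a : W → W → ℝ) : W → List W → ℝ
  | _, [] => 0
  | c, n :: l => a c n + chainSum a n l

theorem chainSum_ofFn {W : Type*} (a : W → W → ℝ) (n : ℕ) (f : Fin (n + 1) → W) :
    chainSum a (f 0) (List.ofFn fun k : Fin n => f k.succ) =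
      ∑ k : Fin n, a (f k.castSucc) (f k.succ) := by
  induction n with
  | zero => simp [chainSum]
  | succ n ih =>
    rw [List.ofFn_succ, chainSum, Fin.sum_univ_succ]
    have := ih fun k => f k.succ
    simp only [Fin.succ_castSucc] at this ⊢
    rw [this]
    simp

/-- Double transitivity of the symmetric group: it makes the average of `a` over all orderings
independent of the two positions considered. -/
theorem exists_perm_apply_pair {X : Type*} {x y x' y' : X} (h : x ≠ y) (h' : x' ≠ y') :
    ∃ τ : Equiv.Perm X, τ x = x' ∧ τ y = y' := by
  refine ⟨(Equiv.swap x x').trans (Equiv.swap (Equiv.swap x x' y) y'), ?_, by simp⟩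
  have h1 : x' ≠ Equiv.swap x x' y := fun h2 => h <| by
    have := (Equiv.swap x x').injective (a₁ := x) (a₂ := y) (by rw [Equiv.swap_apply_left, ← h2])
    exact this
  simp [Equiv.swap_apply_of_ne_of_ne h1 h']

/-- Some Hamiltonian path has at least the average weight. -/
theorem exists_chainSum_ge {W : Type*} [Fintype W] [DecidableEq W] (a : W → W → ℝ) {n : ℕ}
    (hn : Fintype.card W = n + 1) (hn0 : 0 < n) :
    ∃ (c : W) (l : List W), (c :: l).Nodup ∧ (∀ i, i ∈ c :: l) ∧ l.length = n ∧
      (∑ i, ∑ j ∈ Finset.univ.erase i, a i j) / (n + 1) ≤ chainSum a c l := by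
  set T := ∑ i, ∑ j ∈ Finset.univ.erase i, a i j with hT
  have e0 : Fin (n + 1) ≃ W := (Fintype.equivFinOfCardEq hn).symm
  have hne : (Finset.univ : Finset (Fin (n + 1) ≃ W)).Nonempty := ⟨e0, Finset.mem_univ _⟩
  set s : Fin (n + 1) → Fin (n + 1) → ℝ := fun x y => ∑ σ : Fin (n + 1) ≃ W, a (σ x) (σ y) with hs
  have hconst : ∀ x y x' y', x ≠ y → x' ≠ y' → s x y = s x' y' := by
    intro x y x' y' h h'
    obtain ⟨τ, h1, h2⟩ := exists_perm_apply_pair h h'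
    simp only [hs]
    rw [← Equiv.sum_comp (Equiv.equivCongr τ.symm (Equiv.refl W))]
    refine Finset.sum_congr rfl fun σ _ => ?_
    simp [Equiv.equivCongr, h1, h2]
  set N : ℝ := ((Finset.univ : Finset (Fin (n + 1) ≃ W)).card : ℝ) with hN
  have hN0 : 0 < N := Nat.cast_pos.2 hne.card_pos
  have h01 : (0 : Fin (n + 1)) ≠ Fin.last n := by
    intro h; have := congrArg Fin.val h; simp at this; omega
  set s₀ := s 0 (Fin.last n) with hs₀
  -- All `(n + 1) * n` ordered pairs of positions contribute the same `s₀`, and a path uses `n` of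
  -- them; hence the quotient `n + 1`.
  have htotal : ((n : ℝ) + 1) * n * s₀ = N * T := by
    have h1 : ∑ x, ∑ y ∈ Finset.univ.erase x, s x y = N * T := by
      have h2 : ∀ σ : Fin (n + 1) ≃ W,
          ∑ x, ∑ y ∈ Finset.univ.erase x, a (σ x) (σ y) = T := by
        intro σ
        rw [hT, ← Equiv.sum_comp σ]
        refine Finset.sum_congr rfl fun x _ => ?_
        refine Finset.sum_bij (fun y _ => σ y) (fun y hy => by simpa using hy)
          (fun _ _ _ _ h => σ.injective h) (fun w hw => ⟨σ.symm w, ?_, by simp⟩) (fun _ _ => rfl)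
        have : w ≠ σ x := Finset.ne_of_mem_erase hw
        simp only [Finset.mem_erase, Finset.mem_univ, and_true]
        intro h
        exact this (by rw [← h, Equiv.apply_symm_apply])
      have h3 : ∑ x, ∑ y ∈ Finset.univ.erase x, s x y =
          ∑ σ : Fin (n + 1) ≃ W, ∑ x, ∑ y ∈ Finset.univ.erase x, a (σ x) (σ y) := by
        rw [Finset.sum_comm]
        refine Finset.sum_congr rfl fun x _ => ?_
        rw [Finset.sum_comm]
      rw [h3, Finset.sum_congr rfl fun σ _ => h2 σ, Finset.sum_const, nsmul_eq_mul]
    rw [← h1]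
    have h4 : ∀ x : Fin (n + 1), ∑ y ∈ Finset.univ.erase x, s x y = n * s₀ := by
      intro x
      rw [Finset.sum_congr rfl fun y hy =>
        hconst x y 0 (Fin.last n) (Ne.symm (Finset.ne_of_mem_erase hy)) h01]
      simp [hs₀]
    rw [Finset.sum_congr rfl fun x _ => h4 x]
    simp only [Finset.sum_const, Finset.card_univ, Fintype.card_fin, nsmul_eq_mul]
    push_cast
    ring
  obtain ⟨σ, -, hσ⟩ : ∃ σ ∈ (Finset.univ : Finset (Fin (n + 1) ≃ W)),
      T / (n + 1) ≤ ∑ k : Fin n, a (σ k.castSucc) (σ k.succ) := by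
    refine Finset.exists_le_of_sum_le hne ?_
    rw [Finset.sum_const, nsmul_eq_mul, Finset.sum_comm]
    have h5 : ∀ k : Fin n, ∑ σ : Fin (n + 1) ≃ W, a (σ k.castSucc) (σ k.succ) = s₀ := fun k =>
      hconst _ _ _ _ (Fin.castSucc_lt_succ).ne h01
    rw [Finset.sum_congr rfl fun k _ => h5 k]
    simp only [Finset.sum_const, Finset.card_univ, Fintype.card_fin, nsmul_eq_mul]
    have h6 : (n : ℝ) * s₀ = N * T / (n + 1) := by
      rw [← htotal]; field_simp
    rw [h6, hN, Finset.card_univ, mul_div_assoc]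
  refine ⟨σ 0, List.ofFn fun k : Fin n => σ k.succ, ?_, ?_, by simp, ?_⟩
  · have : (List.ofFn σ).Nodup := List.nodup_ofFn.2 σ.injective
    rwa [List.ofFn_succ] at this
  · intro i
    have : i ∈ List.ofFn σ := (List.mem_ofFn' _ _).2 ⟨σ.symm i, by simp⟩
    rwa [List.ofFn_succ] at this
  · rw [chainSum_ofFn a n σ]; exact hσ

end HamiltonianPath

/-! ### Complete systems from a sparse Hamiltonian path -/

section Path

variable {W V : Type*} [Fintype W] [DecidableEq W] [DecidableEq V]

/-- `q` bounds from above the density between any two subsets of the parts of `A` of at least `β`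
points. -/
def UpperRegular (E : W → W → V → V → Prop) (A : W → Finset V) (q : W → W → ℝ) (β : ℝ) : Prop :=
  ∀ i j, i ≠ j → ∀ X ⊆ A i, ∀ Y ⊆ A j, β ≤ (X.card : ℝ) → β ≤ (Y.card : ℝ) →
    edgeCount (E i j) X Y ≤ q i j * (X.card * Y.card)

theorem UpperRegular.mono {E : W → W → V → V → Prop} {A A' : W → Finset V} {q : W → W → ℝ} {β : ℝ}
    (h : UpperRegular E A q β) (hA : ∀ i, A' i ⊆ A i) : UpperRegular E A' q β :=
  fun i j hij X hX Y hY => h i j hij X (hX.trans (hA i)) Y (hY.trans (hA j))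

/-- Induction along the rest `l` of the path: `D` consists of the indices already shrunk to `m`
points and `c` is the current end, joined completely to `D`. Every edge changes `Γ` into `Γ / (4 *
q)`, which is at least `Γ / 4`, so that `Γ` never falls below `g`, and it costs the next part a
factor `exp (-κ)`; parts not yet reached are untouched. The last index `c'` is never shrunk to `m`
points, which is why its bound is different. -/
theorem exists_complete_of_path_aux {E : W → W → V → V → Prop}
    (hE : ∀ i j x y, E i j x y → E j i y x) {q : W → W → ℝ} (hq0 : ∀ i j, 0 < q i j)
    (hq1 : ∀ i j, q i j ≤ 1) {m : ℕ} (hm : 0 < m) {g b κ : ℝ} (hg : 0 < g) (hκ0 : 0 ≤ κ)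
    (hfloor : (m : ℝ) ≤ g / 8 * Real.exp b)
    (hκ : Real.exp (-κ) ≤ (g / 8) ^ (m + 2) / 2 ^ (m * Fintype.card W)) (l : List W) :
    ∀ (c : W) (D : Finset W) (B : W → Finset V) (Γ : ℝ), (c :: l).Nodup →
      (∀ i, i ∈ D ∨ i ∈ c :: l) → (∀ i ∈ c :: l, i ∉ D) → g * 4 ^ l.length ≤ Γ →
      UpperRegular E B q (Real.exp b) → (∀ i ∈ D, (B i).card ≤ m) →
      (∀ i ∈ D, ∀ j ∈ insert c D, i ≠ j → ∀ x ∈ B i, ∀ y ∈ B j, E i j x y) →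
      Γ * ∏ i, sizeBound D m B i ≤ ((copies E B).card : ℝ) →
      (∀ i, i ∉ D → Real.exp (b + l.length * κ) ≤ ((B i).card : ℝ)) →
      ∃ S : W → Finset V, (∀ i, S i ⊆ B i) ∧
        (∀ i j, i ≠ j → ∀ x ∈ S i, ∀ y ∈ S j, E i j x y) ∧
        ∃ c', Real.exp b ≤ ((S c').card : ℝ) ∧ ∀ i, i ≠ c' →
          Γ * Real.exp (chainSum (fun i j => -Real.log (q i j)) c l) / 4 ^ l.length * m ≤
            ((S i).card : ℝ) := by
  induction l with
  | nil =>
    intro c D B Γ _ hcov hdis hΓ _ hB hcomp hcop hsize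
    have hΓ0 : 0 < Γ := lt_of_lt_of_le (by positivity) hΓ
    have hD : ∀ i, i ≠ c → i ∈ D := fun i hi => (hcov i).resolve_right (by simpa using hi)
    have hcD : c ∉ D := hdis c (by simp)
    have hbc : Real.exp b ≤ ((B c).card : ℝ) := by simpa using hsize c hcD
    refine ⟨B, fun _ => subset_rfl, fun i j hij x hx y hy => ?_, c, hbc, fun i hi => ?_⟩
    · by_cases hi : i = c
      · subst hi
        exact hE _ _ _ _ (hcomp j (hD j hij.symm) i (Finset.mem_insert_self _ _) hij.symm y hy x hx)
      · refine hcomp i (hD i hi) j ?_ hij x hx y hy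
        by_cases hj : j = c
        · simp [hj]
        · exact Finset.mem_insert_of_mem (hD j hj)
    · have hne : ∀ i, i ∉ D → (B i).Nonempty := by
        intro i hi
        have := lt_of_lt_of_le (Real.exp_pos _) (hsize i hi)
        exact Finset.card_pos.1 (by exact_mod_cast this)
      -- The number of copies is at most the volume. Replacing all other sizes by their upper bounds
      -- leaves `|B i| / m` as an upper bound for `Γ`.
      have h1 := hcop.trans (card_copies_le_vol E B)
      rw [prod_sizeBound hi, vol_eq_mul_mul B hi] at h1
      set Z := ∏ i ∈ (Finset.univ.erase c).erase i, sizeBound D m B i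
      have hZ : 0 < Z := Finset.prod_pos fun i _ => sizeBound_pos hm hne i
      have hle : ∏ i ∈ (Finset.univ.erase c).erase i, ((B i).card : ℝ) ≤ Z :=
        Finset.prod_le_prod (fun _ _ => Nat.cast_nonneg _) fun i _ => card_le_sizeBound hB i
      have e1 : sizeBound D m B i = m := by simp [sizeBound, hD i hi]
      have e2 : sizeBound D m B c = (B c).card := by simp [sizeBound, hcD]
      rw [e1, e2] at h1
      have hBc : (0 : ℝ) < (B c).card := lt_of_lt_of_le (Real.exp_pos _) hbc
      have h2 : Γ * m * ((B c).card * Z) ≤ (B i).card * ((B c).card * Z) := by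
        calc Γ * m * ((B c).card * Z) = Γ * (m * (B c).card * Z) := by ring
          _ ≤ _ := h1
          _ ≤ (B i).card * (B c).card * Z := by gcongr
          _ = _ := by ring
      have := le_of_mul_le_mul_right h2 (by positivity)
      simpa [chainSum] using this
  | cons n l ih =>
    intro c D B Γ hnd hcov hdis hΓ hreg hB hcomp hcop hsize
    have hlen : ((n :: l).length : ℝ) = l.length + 1 := by simp
    have hcD : c ∉ D := hdis c (by simp)
    have hnD : n ∉ D := hdis n (by simp)
    have hcn : c ≠ n := by
      intro h; subst h; simp at hnd
    have hpow : (1 : ℝ) ≤ 4 ^ (n :: l).length := one_le_pow₀ (by norm_num)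
    have hgΓ : g ≤ Γ := le_trans (le_mul_of_one_le_right hg.le hpow) hΓ
    have hΓ0 : 0 < Γ := lt_of_lt_of_le hg hgΓ
    have hbig : ∀ i, i ∉ D → Real.exp b ≤ ((B i).card : ℝ) := fun i hi =>
      (Real.exp_le_exp.2 (le_add_of_nonneg_right (by positivity))).trans (hsize i hi)
    have hne : ∀ i, i ∉ D → (B i).Nonempty := by
      intro i hi
      have := lt_of_lt_of_le (Real.exp_pos _) (hsize i hi)
      exact Finset.card_pos.1 (by exact_mod_cast this)
    obtain ⟨B', hsub, hm', hcomp', hsame, hcop', hsz⟩ := path_step hE hcD hnD hcn hm hΓ0 (hq0 c n)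
      (hq1 c n) hB hcomp hcop hne
      (hreg c n hcn _ subset_rfl _ subset_rfl (hbig c hcD) (hbig n hnD))
      (hfloor.trans (by have := hbig c hcD; gcongr))
    have hΓ4 : Γ / 4 ≤ Γ / (4 * q c n) := by
      have := hq0 c n
      have := hq1 c n
      rw [div_le_div_iff_of_pos_left hΓ0 (by norm_num) (by positivity)]
      linarith
    obtain ⟨S, hSB, hS, c', hc', hSi⟩ := ih n (insert c D) B' (Γ / (4 * q c n)) (List.nodup_cons.1 hnd).2
      (fun i => by
        rcases hcov i with h | h
        · exact Or.inl (Finset.mem_insert_of_mem h)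
        · rcases List.mem_cons.1 h with h | h
          · exact Or.inl (by simp [h])
          · exact Or.inr h)
      (fun i hi h => by
        rcases Finset.mem_insert.1 h with h | h
        · subst h; exact (List.nodup_cons.1 hnd).1 hi
        · exact hdis i (List.mem_cons_of_mem _ hi) h)
      (le_trans (by
        rw [List.length_cons, pow_succ] at hΓ
        linarith) hΓ4)
      (hreg.mono hsub) hm' hcomp' hcop'
      (fun i hi => by
        rw [Finset.mem_insert, not_or] at hi
        by_cases hin : i = n
        · subst hin
          refine le_trans ?_ hsz
          have h1 := hsize i hnD
          rw [hlen] at h1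
          have e : b + (l.length : ℝ) * κ = -κ + (b + (l.length + 1) * κ) := by ring
          rw [e, Real.exp_add]
          refine mul_le_mul (hκ.trans ?_) h1 (Real.exp_pos _).le (by positivity)
          gcongr
        · rw [hsame i (by simp [hi.1, hi.2]) hin]
          refine le_trans (Real.exp_le_exp.2 ?_) (hsize i hi.2)
          rw [hlen]
          linarith)
    refine ⟨S, fun i => (hSB i).trans (hsub i), hS, c', hc', fun i hi => le_trans (le_of_eq ?_) (hSi i hi)⟩
    have hq := hq0 c n
    rw [chainSum, Real.exp_add, Real.exp_neg, Real.exp_log hq, List.length_cons, pow_succ]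
    field_simp

/-- Start with `D = ∅` on a path of at least average weight; on it the product of the bounds `q` is
at most `exp (-Λ)`. -/
theorem exists_complete_of_path {E : W → W → V → V → Prop}
    (hE : ∀ i j x y, E i j x y → E j i y x) {q : W → W → ℝ} (hq0 : ∀ i j, 0 < q i j)
    (hq1 : ∀ i j, q i j ≤ 1) {m : ℕ} (hm : 0 < m) {g b κ : ℝ} (hg : 0 < g) (hκ0 : 0 ≤ κ)
    (hfloor : (m : ℝ) ≤ g / 8 * Real.exp b)
    (hκ : Real.exp (-κ) ≤ (g / 8) ^ (m + 2) / 2 ^ (m * Fintype.card W)) {n : ℕ}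
    (hn : Fintype.card W = n + 1) (hn0 : 0 < n) {B : W → Finset V} {Γ Λ : ℝ}
    (hΓ : g * 4 ^ n ≤ Γ) (hreg : UpperRegular E B q (Real.exp b))
    (hcop : Γ * vol B ≤ ((copies E B).card : ℝ))
    (hsize : ∀ i, Real.exp (b + n * κ) ≤ ((B i).card : ℝ))
    (hΛ : (n + 1) * Λ ≤ ∑ i, ∑ j ∈ Finset.univ.erase i, -Real.log (q i j)) {t : ℝ}
    (htb : t ≤ Real.exp b) (htm : t ≤ Γ * Real.exp Λ / 4 ^ n * m) : HasBlowup E B t := by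
  obtain ⟨c, l, hnd, hcov, hl, hsum⟩ :=
    exists_chainSum_ge (fun i j => -Real.log (q i j)) hn hn0
  have hsz : ∏ i, sizeBound ∅ m B i = vol B := by simp [sizeBound, vol]
  obtain ⟨S, hSB, hS, c', hc', hSi⟩ := exists_complete_of_path_aux hE hq0 hq1 hm hg hκ0 hfloor hκ l c ∅ B Γ
    hnd (fun i => Or.inr (hcov i)) (by simp) (by rwa [hl]) hreg (by simp) (by simp)
    (by rwa [hsz]) (fun i _ => by rw [hl]; exact hsize i)
  have hΓ0 : 0 < Γ := lt_of_lt_of_le (by positivity) hΓ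
  refine ⟨S, hSB, fun i => ?_, hS⟩
  by_cases hi : i = c'
  · subst hi; exact htb.trans hc'
  · refine (htm.trans ?_).trans (hSi i hi)
    rw [hl]
    have : Λ ≤ chainSum (fun i j => -Real.log (q i j)) c l := by
      refine le_trans ?_ hsum
      rw [le_div_iff₀ (by positivity)]
      linarith
    gcongr

end Path

/-! ### The star process -/

section Star

variable {W V : Type*} [Fintype W] [DecidableEq W] [DecidableEq V]

/-- The density of the copies in the box `A`. -/
noncomputable def dens (E : W → W → V → V → Prop) (A : W → Finset V) : ℝ :=
  ((copies E A).card : ℝ) / vol A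

theorem dens_le_one (E : W → W → V → V → Prop) (A : W → Finset V) : dens E A ≤ 1 :=
  div_le_one_of_le₀ (card_copies_le_vol E A) (vol_nonneg A)

theorem nonempty_of_dens_pos {E : W → W → V → V → Prop} {A : W → Finset V} (h : 0 < dens E A)
    (i : W) : (A i).Nonempty := by
  rw [Finset.nonempty_iff_ne_empty]
  intro hi
  have : vol A = 0 := Finset.prod_eq_zero (Finset.mem_univ i) (by simp [hi])
  simp [dens, this] at h

theorem card_copies_eq {E : W → W → V → V → Prop} {A : W → Finset V} (hA : ∀ i, (A i).Nonempty) :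
    ((copies E A).card : ℝ) = dens E A * vol A := by
  rw [dens, div_mul_cancel₀ _ (vol_pos hA).ne']

theorem vol_mono {A B : W → Finset V} (h : ∀ i, A i ⊆ B i) : vol A ≤ vol B :=
  Finset.prod_le_prod (fun _ _ => Nat.cast_nonneg _) fun i _ =>
    Nat.cast_le.2 (Finset.card_le_card (h i))

/-- The box `A`, with the coordinates in `P` restricted to `N`. -/
def restrictBox (A N : W → Finset V) (P : Finset W) (i : W) : Finset V :=
  if i ∈ P then N i else A i

/-- The relative size of `N i` in `A i`. -/
noncomputable def relSize (A N : W → Finset V) (i : W) : ℝ := ((N i).card : ℝ) / (A i).card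

theorem relSize_nonneg (A N : W → Finset V) (i : W) : 0 ≤ relSize A N i := by
  unfold relSize; positivity

theorem relSize_le_one {A N : W → Finset V} {i : W} (h : N i ⊆ A i) : relSize A N i ≤ 1 :=
  div_le_one_of_le₀ (Nat.cast_le.2 (Finset.card_le_card h)) (Nat.cast_nonneg _)

theorem vol_restrictBox {A N : W → Finset V} (hA : ∀ i, (A i).Nonempty) (P : Finset W) :
    vol (restrictBox A N P) = vol A * ∏ i ∈ P, relSize A N i := by
  unfold vol
  have h : ∏ i ∈ P, relSize A N i = ∏ i, if i ∈ P then relSize A N i else 1 := by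
    rw [Finset.prod_ite_mem, Finset.univ_inter]
  rw [h, ← Finset.prod_mul_distrib]
  refine Finset.prod_congr rfl fun i _ => ?_
  have : ((A i).card : ℝ) ≠ 0 := by exact_mod_cast (hA i).card_pos.ne'
  unfold restrictBox relSize
  split_ifs
  · field_simp
  · simp

theorem card_copies_split (E : W → W → V → V → Prop) {A : W → Finset V} {j : W} {N : Finset V}
    (hN : N ⊆ A j) :
    ((copies E A).card : ℝ) = (copies E (Function.update A j N)).card +
      (copies E (Function.update A j (A j \ N))).card := by
  rw [copies_update E hN, copies_update E Finset.sdiff_subset,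
    ← Finset.card_filter_add_card_filter_not (s := copies E A) (fun f => f j ∈ N)]
  push_cast
  congr 3
  ext f
  simp only [Finset.mem_filter, Finset.mem_sdiff]
  constructor
  · rintro ⟨h1, h2⟩; exact ⟨h1, (mem_copies.1 h1).1 j, h2⟩
  · rintro ⟨h1, -, h2⟩; exact ⟨h1, h2⟩

/-- Bernoulli's inequality for the exponent `1 - lam`. Together with the next lemma it shows that
the exponent `1 - lam` in the maximality condition differs from `1` only by an error of order `lam`.
-/
theorem one_sub_rpow_le {β lam : ℝ} (h1 : β ≤ 1) (hl0 : 0 ≤ lam) (hl1 : lam ≤ 1) :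
    (1 - β) ^ (1 - lam) ≤ 1 - β + lam * β := by
  have := rpow_one_add_le_one_add_mul_self (s := -β) (by linarith) (p := 1 - lam)
    (by linarith) (by linarith)
  have e : (1 : ℝ) + -β = 1 - β := by ring
  rw [e] at this
  linarith

theorem rpow_le_of_exp_le {u lam L : ℝ} (hu : Real.exp (-L) ≤ u) (hl0 : 0 ≤ lam) (hL : 0 ≤ L)
    (hlL : lam * L ≤ 1) : u ^ (1 - lam) ≤ u * (1 + 2 * (lam * L)) := by
  have hu0 : 0 < u := lt_of_lt_of_le (Real.exp_pos _) hu
  rw [sub_eq_add_neg, Real.rpow_add hu0, Real.rpow_one]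
  refine mul_le_mul_of_nonneg_left ?_ hu0.le
  have h1 : u ^ (-lam) ≤ Real.exp (lam * L) := by
    rw [Real.rpow_def_of_pos hu0]
    have : -L ≤ Real.log u := (Real.le_log_iff_exp_le hu0).2 hu
    exact Real.exp_le_exp.2 (by nlinarith)
  have h2 := Real.abs_exp_sub_one_le (x := lam * L)
    (by rw [abs_of_nonneg (by positivity)]; exact hlL)
  rw [abs_of_nonneg (by positivity : 0 ≤ lam * L)] at h2
  have := (abs_le.1 h2).2
  linarith

/-- If the copies in every subbox `B` of `A` are at most as dense as the power `-lam` of the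
relative size of `B` allows, then restricting to `N` loses little density. -/
theorem card_copies_restrictBox_ge {E : W → W → V → V → Prop} {A N : W → Finset V} {o j₀ : W}
    (hj₀ : j₀ ≠ o) (hA : ∀ i, (A i).Nonempty) (hN : ∀ i, N i ⊆ A i) {lam L ρ : ℝ} (hl0 : 0 ≤ lam)
    (hl1 : lam < 1) (hL : 0 ≤ L) (hlL : lam * L ≤ 1) (hρ : 0 < ρ)
    (hmax : ∀ B : W → Finset V, (∀ i, B i ⊆ A i) → B o = A o →
      ((copies E B).card : ℝ) ≤ (copies E A).card * (vol B / vol A) ^ (1 - lam))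
    (hprod : ρ ≤ ∏ i ∈ (Finset.univ.erase o).erase j₀, relSize A N i)
    (hprodL : Real.exp (-L) ≤ ∏ i ∈ Finset.univ.erase o, relSize A N i) :
    (copies E A).card * ((∏ i ∈ Finset.univ.erase o, relSize A N i) *
      (1 - Fintype.card W * (lam * (1 + 2 * L) / ρ))) ≤
      ((copies E (restrictBox A N (Finset.univ.erase o))).card : ℝ) := by
  set β := relSize A N with hβ
  have hβ0 : ∀ i, 0 ≤ β i := relSize_nonneg A N
  have hβ1 : ∀ i, β i ≤ 1 := fun i => relSize_le_one (hN i)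
  set Bt := ∏ i ∈ Finset.univ.erase o, β i with hBt
  have hBt0 : 0 < Bt := lt_of_lt_of_le (Real.exp_pos _) hprodL
  set c : ℝ := ((copies E A).card : ℝ) with hc
  have hc0 : 0 ≤ c := Nat.cast_nonneg _
  have hvol : 0 < vol A := vol_pos hA
  -- The error of restricting one coordinate, relative to `c`. If `u` is the relative size before
  -- the restriction, the error is at most `lam * (1 + 2 * L) * u`, and `u ≤ Bt / ρ` once `j₀` is
  -- among the restricted coordinates.
  set err := lam * (1 + 2 * L) * (Bt / ρ) with herr
  have herr0 : 0 ≤ err := by positivity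
  -- the box in which `j` is restricted to the complement of `N j`
  have hcompl : ∀ P : Finset W, o ∉ P → ∀ j, j ∉ P → j ≠ o →
      ((copies E (Function.update (restrictBox A N P) j (A j \ N j))).card : ℝ) ≤
        c * ((∏ i ∈ P, β i) * (1 - β j)) ^ (1 - lam) := by
    intro P hoP j hj hjo
    refine (hmax _ (fun i => ?_) ?_).trans (le_of_eq ?_)
    · by_cases hi : i = j
      · subst hi; simp [Finset.sdiff_subset]
      · rw [Function.update_of_ne hi]
        unfold restrictBox
        split_ifs
        · exact hN i
        · exact subset_rfl
    · rw [Function.update_of_ne hjo.symm]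
      simp [restrictBox, hoP]
    · congr 2
      have hAj : ((A j).card : ℝ) ≠ 0 := by exact_mod_cast (hA j).card_pos.ne'
      have h1 : vol (restrictBox A N P) = vol A * ∏ i ∈ P, β i := vol_restrictBox hA P
      rw [vol_eq_mul _ j] at h1
      have h2 : restrictBox A N P j = A j := by simp [restrictBox, hj]
      rw [h2] at h1
      rw [vol_update, Finset.cast_card_sdiff (hN j), div_eq_iff hvol.ne']
      have h3 : ((A j).card : ℝ) - (N j).card = (A j).card * (1 - β j) := by
        rw [hβ, relSize]; field_simp
      rw [h3]
      linear_combination (1 - β j) * h1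
  have hstep : ∀ P : Finset W, ∀ j, j ∉ P → restrictBox A N (insert j P) =
      Function.update (restrictBox A N P) j (N j) := by
    intro P j hj
    ext1 i
    by_cases hi : i = j
    · subst hi; simp [restrictBox]
    · rw [Function.update_of_ne hi]; simp [restrictBox, hi]
  have hsplit : ∀ P : Finset W, ∀ j, j ∉ P → ((copies E (restrictBox A N P)).card : ℝ) =
      (copies E (restrictBox A N (insert j P))).card +
        (copies E (Function.update (restrictBox A N P) j (A j \ N j))).card := by
    intro P j hj
    have h2 : restrictBox A N P j = A j := by simp [restrictBox, hj]
    have := card_copies_split E (A := restrictBox A N P) (j := j) (N := N j) (by rw [h2]; exact hN j)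
    rw [hstep P j hj, this, h2]
  have hpe : β j₀ * ∏ i ∈ (Finset.univ.erase o).erase j₀, β i = Bt :=
    Finset.mul_prod_erase _ _ (Finset.mem_erase.2 ⟨hj₀, Finset.mem_univ _⟩)
  -- The coordinates are restricted one at a time, and the copies lost lie in the complementary box,
  -- where maximality bounds them. Taking `j₀` first is what keeps its relative size out of `ρ`:
  -- this first step starts from `u = 1`, but its error is only `lam * β j₀`.
  have key : ∀ Q ⊆ (Finset.univ.erase o).erase j₀,
      c * ((∏ i ∈ insert j₀ Q, β i) - (Q.card + 1) * err) ≤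
        ((copies E (restrictBox A N (insert j₀ Q))).card : ℝ) := by
    intro Q
    induction Q using Finset.induction_on with
    | empty =>
      intro _
      have h1 := hsplit ∅ j₀ (by simp)
      have h2 := hcompl ∅ (by simp) j₀ (by simp) hj₀
      have e : restrictBox A N ∅ = A := by ext1 i; simp [restrictBox]
      rw [e] at h1 h2
      rw [Finset.prod_empty, one_mul] at h2
      have h3 := one_sub_rpow_le (hβ1 j₀) hl0 hl1.le
      have h4 : β j₀ ≤ Bt / ρ := by
        rw [le_div_iff₀ hρ, ← hpe]
        exact mul_le_mul_of_nonneg_left hprod (hβ0 j₀)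
      have h5 : lam * β j₀ ≤ err := by
        rw [herr]
        refine mul_le_mul (le_mul_of_one_le_right hl0 (by linarith)) h4 (hβ0 j₀) (by positivity)
      have h6 : c * (1 - β j₀) ^ (1 - lam) ≤ c * (1 - β j₀ + err) :=
        mul_le_mul_of_nonneg_left (by linarith) hc0
      rw [Finset.prod_insert (by simp)]
      simp only [Finset.prod_empty, mul_one, Finset.card_empty, Nat.cast_zero, zero_add, one_mul]
      have h7 : c = _ + _ := h1
      linarith
    | insert j Q hj ih =>
      intro hQ
      have hjm : j ∈ (Finset.univ.erase o).erase j₀ := hQ (Finset.mem_insert_self _ _)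
      have hQ' : Q ⊆ (Finset.univ.erase o).erase j₀ :=
        (Finset.subset_insert _ _).trans hQ
      simp only [Finset.mem_erase, Finset.mem_univ, and_true] at hjm
      have hjP : j ∉ insert j₀ Q := by simp [hjm.1, hj]
      have hoP : o ∉ insert j₀ Q := by
        rw [Finset.mem_insert, not_or]
        refine ⟨hj₀.symm, fun h => ?_⟩
        have := hQ' h
        simp at this
      have ih' := ih hQ'
      have h1 := hsplit (insert j₀ Q) j hjP
      have h2 := hcompl (insert j₀ Q) hoP j hjP hjm.2
      rw [Finset.insert_comm]
      set u := ∏ i ∈ insert j₀ Q, β i with hu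
      have hj₀Q : j₀ ∉ Q := fun h => by have := hQ' h; simp at this
      have hu0 : 0 ≤ u := Finset.prod_nonneg fun i _ => hβ0 i
      have hPsub : insert j₀ Q ⊆ Finset.univ.erase o := by
        intro i hi
        rw [Finset.mem_erase]
        exact ⟨fun h => hoP (h ▸ hi), Finset.mem_univ _⟩
      have huL : Real.exp (-L) ≤ u := by
        refine hprodL.trans ?_
        rw [hBt, ← Finset.prod_sdiff hPsub]
        exact mul_le_of_le_one_left hu0 (Finset.prod_le_one (fun i _ => hβ0 i) fun i _ => hβ1 i)
      have huB : u ≤ Bt / ρ := by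
        rw [le_div_iff₀ hρ, hBt, ← Finset.prod_sdiff hPsub, mul_comm]
        refine mul_le_mul_of_nonneg_right (hprod.trans ?_) hu0
        have hsub : Finset.univ.erase o \ insert j₀ Q ⊆ (Finset.univ.erase o).erase j₀ := by
          intro i hi
          simp only [Finset.mem_sdiff, Finset.mem_insert, not_or] at hi
          exact Finset.mem_erase.2 ⟨hi.2.1, hi.1⟩
        rw [← Finset.prod_sdiff hsub]
        exact mul_le_of_le_one_left (Finset.prod_nonneg fun i _ => hβ0 i)
          (Finset.prod_le_one (fun i _ => hβ0 i) fun i _ => hβ1 i)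
      have h3 : (u * (1 - β j)) ^ (1 - lam) ≤ u * (1 - β j) + err := by
        rw [Real.mul_rpow hu0 (by linarith [hβ1 j])]
        have h4 := rpow_le_of_exp_le huL hl0 hL hlL
        have h5 := one_sub_rpow_le (hβ1 j) hl0 hl1.le
        have h6 : 0 ≤ (1 - β j) ^ (1 - lam) := Real.rpow_nonneg (by linarith [hβ1 j]) _
        have hlLn : 0 ≤ lam * L := by positivity
        calc u ^ (1 - lam) * (1 - β j) ^ (1 - lam)
            ≤ (u * (1 + 2 * (lam * L))) * (1 - β j + lam * β j) :=
              mul_le_mul h4 h5 h6 (by positivity)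
          _ = u * (1 - β j) + u * (lam * β j + 2 * (lam * L) * (1 - β j + lam * β j)) := by ring
          _ ≤ u * (1 - β j) + u * (lam * (1 + 2 * L)) := by
              gcongr
              have h7 : lam * β j ≤ lam * 1 := mul_le_mul_of_nonneg_left (hβ1 j) hl0
              have h8 : 1 - β j + lam * β j ≤ 1 := by
                have := mul_le_mul_of_nonneg_right hl1.le (hβ0 j)
                linarith
              have h9 : 2 * (lam * L) * (1 - β j + lam * β j) ≤ 2 * (lam * L) * 1 :=
                mul_le_mul_of_nonneg_left h8 (by positivity)
              linarith
          _ ≤ u * (1 - β j) + err := by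
              rw [herr, mul_comm u (lam * _)]
              gcongr
      have h10 : c * (u * (1 - β j)) ^ (1 - lam) ≤ c * (u * (1 - β j) + err) :=
        mul_le_mul_of_nonneg_left h3 hc0
      rw [Finset.prod_insert hjP, ← hu, Finset.card_insert_of_notMem hj]
      push_cast
      linarith
  have hfin := key _ subset_rfl
  have e1 : insert j₀ ((Finset.univ.erase o).erase j₀) = Finset.univ.erase o :=
    Finset.insert_erase (Finset.mem_erase.2 ⟨hj₀, Finset.mem_univ _⟩)
  rw [e1] at hfin
  refine le_trans (mul_le_mul_of_nonneg_left ?_ hc0) hfin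
  have h11 : ((((Finset.univ.erase o).erase j₀).card : ℕ) : ℝ) + 1 ≤ Fintype.card W := by
    have : ((Finset.univ.erase o).erase j₀).card + 1 ≤ Fintype.card W := by
      rw [Finset.card_erase_add_one (Finset.mem_erase.2 ⟨hj₀, Finset.mem_univ _⟩)]
      exact Finset.card_le_univ _
    exact_mod_cast this
  have h12 := mul_le_mul_of_nonneg_right h11 herr0
  have h13 : Bt * (1 - Fintype.card W * (lam * (1 + 2 * L) / ρ)) = Bt - Fintype.card W * err := by
    rw [herr]; field_simp
  rw [h13]
  linarith

/-- A subbox that maximizes the density, weighted with a small power of the size. -/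
theorem exists_maximal_box (E : W → W → V → V → Prop) {A : W → Finset V} (o : W)
    (hA : 0 < dens E A) {lam : ℝ} (hl0 : 0 ≤ lam) :
    ∃ A' : W → Finset V, (∀ i, A' i ⊆ A i) ∧ A' o = A o ∧ dens E A ≤ dens E A' ∧
      dens E A * vol A ^ lam ≤ dens E A' * vol A' ^ lam ∧
      ∀ B : W → Finset V, (∀ i, B i ⊆ A' i) → B o = A' o →
        ((copies E B).card : ℝ) ≤ (copies E A').card * (vol B / vol A') ^ (1 - lam) := by
  set F := (Fintype.piFinset fun i => (A i).powerset).filter fun B => B o = A o with hF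
  have hmem : ∀ B, B ∈ F ↔ (∀ i, B i ⊆ A i) ∧ B o = A o := by
    intro B; simp [hF, Fintype.mem_piFinset]
  obtain ⟨A', hA'F, hA'⟩ := Finset.exists_max_image F (fun B => dens E B * vol B ^ lam)
    ⟨A, (hmem A).2 ⟨fun _ => subset_rfl, rfl⟩⟩
  obtain ⟨hsub, ho⟩ := (hmem A').1 hA'F
  have hAne := nonempty_of_dens_pos hA
  have hvA := vol_pos hAne
  have hscore := hA' A ((hmem A).2 ⟨fun _ => subset_rfl, rfl⟩)
  have hpos : 0 < dens E A' := by
    have h1 : 0 < dens E A' * vol A' ^ lam := lt_of_lt_of_le (by positivity) hscore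
    exact pos_of_mul_pos_left h1 (Real.rpow_nonneg (vol_nonneg _) _)
  have hA'ne := nonempty_of_dens_pos hpos
  have hvA' := vol_pos hA'ne
  refine ⟨A', hsub, ho, ?_, hscore, ?_⟩
  · have h1 : vol A' ^ lam ≤ vol A ^ lam := Real.rpow_le_rpow hvA'.le (vol_mono hsub) hl0
    have h2 : dens E A * vol A ^ lam ≤ dens E A' * vol A ^ lam :=
      hscore.trans (mul_le_mul_of_nonneg_left h1 hpos.le)
    exact le_of_mul_le_mul_right h2 (by positivity)
  · intro B hB hBo
    have hBF := hA' B ((hmem B).2 ⟨fun i => (hB i).trans (hsub i), hBo.trans ho⟩)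
    by_cases hBe : ∀ i, (B i).Nonempty
    · have hvB := vol_pos hBe
      rw [card_copies_eq hBe, card_copies_eq hA'ne, Real.div_rpow hvB.le hvA'.le,
        Real.rpow_sub hvB, Real.rpow_sub hvA', Real.rpow_one, Real.rpow_one]
      have h3 : 0 < vol B ^ lam := by positivity
      have h4 : 0 < vol A' ^ lam := by positivity
      have e : dens E A' * vol A' * (vol B / vol B ^ lam / (vol A' / vol A' ^ lam)) =
          (dens E A' * vol A' ^ lam) * (vol B / vol B ^ lam) := by
        field_simp
      rw [e]
      have e2 : dens E B * vol B = (dens E B * vol B ^ lam) * (vol B / vol B ^ lam) := by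
        field_simp
      rw [e2]
      exact mul_le_mul_of_nonneg_right hBF (by positivity)
    · push Not at hBe
      obtain ⟨i, hi⟩ := hBe
      have : copies E B = ∅ := by
        rw [Finset.eq_empty_iff_forall_notMem]
        intro f hf
        have := (mem_copies.1 hf).1 i
        simp [hi] at this
      rw [this]
      have := div_nonneg (vol_nonneg B) hvA'.le
      simp only [Finset.card_empty, Nat.cast_zero]
      positivity

/-- The state after `n` successful steps of the star process. -/
structure StarState (E : W → W → V → V → Prop) (A : W → Finset V) (o : W) (lam κ L : ℝ) (n : ℕ)
    (S : Finset V) (A' : W → Finset V) : Prop where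
  card_eq : S.card = n
  subset_at : S ⊆ A o
  subset : ∀ i, A' i ⊆ A i
  eq_at : A' o = A o
  complete : ∀ v ∈ S, ∀ j, j ≠ o → ∀ y ∈ A' j, E o j v y
  dens_ge : dens E A * (1 - κ) ^ n ≤ dens E A'
  score_ge : dens E A * vol A ^ lam * ((1 - κ) * Real.exp (-(lam * L))) ^ n ≤
    dens E A' * vol A' ^ lam
  maximal : ∀ B : W → Finset V, (∀ i, B i ⊆ A' i) → B o = A' o →
    ((copies E B).card : ℝ) ≤ (copies E A').card * (vol B / vol A') ^ (1 - lam)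

/-- The points of `A j` that are related to the point `v` of the part `o`. -/
noncomputable def nbhd (E : W → W → V → V → Prop) (A : W → Finset V) (o : W) (v : V) (j : W) :
    Finset V :=
  (A j).filter fun y => E o j v y

/-- Restrict all parts other than `o` to the neighbourhoods of `v` and pass to a maximal box again.
The restriction costs a factor `1 - κ` of density, and the score a further `exp (-(lam * L))` since
the volume shrinks at most by `exp (-L)`. The part `o` is kept whole, so copies need not use the
chosen points. -/
theorem StarState.succ {E : W → W → V → V → Prop} {A : W → Finset V} {o j₀ : W} (hj₀ : j₀ ≠ o)
    {lam κ L ρ : ℝ} {n : ℕ} {S : Finset V} {A' : W → Finset V}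
    (h : StarState E A o lam κ L n S A') (hA : 0 < dens E A) (hl0 : 0 ≤ lam) (hl1 : lam < 1)
    (hL : 0 ≤ L) (hlL : lam * L ≤ 1) (hρ : 0 < ρ)
    (hκ : Fintype.card W * (lam * (1 + 2 * L) / ρ) ≤ κ) (hκ1 : κ < 1) {r : W → ℝ}
    (hr0 : ∀ j, 0 ≤ r j) (hprod : ρ ≤ ∏ i ∈ (Finset.univ.erase o).erase j₀, r i)
    (hprodL : Real.exp (-L) ≤ ∏ i ∈ Finset.univ.erase o, r i) {v : V} (hvA : v ∈ A o)
    (hvS : v ∉ S) (hv : ∀ j, j ≠ o → r j * (A' j).card ≤ ((nbhd E A' o v j).card : ℝ)) :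
    ∃ A'' : W → Finset V, StarState E A o lam κ L (n + 1) (insert v S) A'' := by
  have hκ' : 0 < 1 - κ := by linarith
  have hd' : 0 < dens E A' := lt_of_lt_of_le (by positivity) h.dens_ge
  have hne := nonempty_of_dens_pos hd'
  have hvol := vol_pos hne
  have hN : ∀ i, nbhd E A' o v i ⊆ A' i := fun i => Finset.filter_subset _ _
  have hrel : ∀ j, j ≠ o → r j ≤ relSize A' (nbhd E A' o v) j := by
    intro j hj
    rw [relSize, le_div_iff₀ (by exact_mod_cast (hne j).card_pos)]
    exact hv j hj
  have h1 : ρ ≤ ∏ i ∈ (Finset.univ.erase o).erase j₀, relSize A' (nbhd E A' o v) i :=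
    hprod.trans (Finset.prod_le_prod (fun i _ => hr0 i) fun i hi =>
      hrel i (Finset.ne_of_mem_erase (Finset.mem_of_mem_erase hi)))
  have h2 : Real.exp (-L) ≤ ∏ i ∈ Finset.univ.erase o, relSize A' (nbhd E A' o v) i :=
    hprodL.trans (Finset.prod_le_prod (fun i _ => hr0 i) fun i hi =>
      hrel i (Finset.ne_of_mem_erase hi))
  have h3 := card_copies_restrictBox_ge hj₀ hne hN hl0 hl1 hL hlL hρ h.maximal h1 h2
  set B := restrictBox A' (nbhd E A' o v) (Finset.univ.erase o) with hB
  set Bt := ∏ i ∈ Finset.univ.erase o, relSize A' (nbhd E A' o v) i with hBt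
  have hBt0 : 0 < Bt := lt_of_lt_of_le (Real.exp_pos _) h2
  have hvolB : vol B = vol A' * Bt := vol_restrictBox hne _
  have hvolB0 : 0 < vol B := by rw [hvolB]; positivity
  have hdB : dens E A' * (1 - κ) ≤ dens E B := by
    rw [dens, dens, le_div_iff₀ hvolB0, hvolB]
    refine le_trans (le_of_eq ?_) ((mul_le_mul_of_nonneg_left (mul_le_mul_of_nonneg_left
      (sub_le_sub_left hκ 1) hBt0.le) (Nat.cast_nonneg _)).trans h3)
    field_simp
  have hdB0 : 0 < dens E B := lt_of_lt_of_le (by positivity) hdB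
  have hBo : B o = A' o := by simp [hB, restrictBox]
  have hBj : ∀ j, j ≠ o → B j = nbhd E A' o v j := by
    intro j hj; simp [hB, restrictBox, hj]
  have hBsub : ∀ i, B i ⊆ A' i := by
    intro i
    by_cases hi : i = o
    · subst hi; rw [hBo]
    · rw [hBj i hi]; exact hN i
  obtain ⟨A'', hsub, ho, hd, hs, hmax⟩ := exists_maximal_box E o hdB0 hl0
  refine ⟨A'', ⟨by rw [Finset.card_insert_of_notMem hvS, h.card_eq],
    Finset.insert_subset hvA h.subset_at,
    fun i => (hsub i).trans ((hBsub i).trans (h.subset i)), ho.trans (hBo.trans h.eq_at),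
    ?_, ?_, ?_, hmax⟩⟩
  · intro w hw j hj y hy
    have hyB := hsub j hy
    rcases Finset.mem_insert.1 hw with rfl | hw
    · rw [hBj j hj] at hyB
      exact (Finset.mem_filter.1 hyB).2
    · exact h.complete w hw j hj y (hBsub j hyB)
  · rw [pow_succ, ← mul_assoc]
    exact ((mul_le_mul_of_nonneg_right h.dens_ge hκ'.le).trans hdB).trans hd
  · refine le_trans ?_ hs
    rw [pow_succ, ← mul_assoc]
    refine (mul_le_mul_of_nonneg_right h.score_ge (by positivity)).trans ?_
    rw [hvolB, Real.mul_rpow hvol.le hBt0.le]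
    have h4 : Real.exp (-(lam * L)) ≤ Bt ^ lam := by
      rw [Real.rpow_def_of_pos hBt0]
      refine Real.exp_le_exp.2 ?_
      have : -L ≤ Real.log Bt := (Real.le_log_iff_exp_le hBt0).2 h2
      nlinarith
    have h5 : 0 ≤ vol A' ^ lam := by positivity
    calc dens E A' * vol A' ^ lam * ((1 - κ) * Real.exp (-(lam * L)))
        = (dens E A' * (1 - κ)) * (vol A' ^ lam * Real.exp (-(lam * L))) := by ring
      _ ≤ dens E B * (vol A' ^ lam * Bt ^ lam) := by
          refine mul_le_mul hdB (mul_le_mul_of_nonneg_left h4 h5) (by positivity) hdB0.le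

/-- The star process at `o`: it finds `t` points of `A o` that are completely joined to large
subsets of the other parts, or stops when few points have large degrees. -/
theorem exists_star {E : W → W → V → V → Prop} {A : W → Finset V} {o j₀ : W} (hj₀ : j₀ ≠ o)
    {lam κ L ρ : ℝ} (hA : 0 < dens E A) (hl0 : 0 < lam) (hl1 : lam < 1)
    (hL : 0 ≤ L) (hlL : lam * L ≤ 1) (hρ : 0 < ρ)
    (hκ : Fintype.card W * (lam * (1 + 2 * L) / ρ) ≤ κ) (hκ1 : κ < 1) {r : W → ℝ}
    (hr0 : ∀ j, 0 ≤ r j) (hprod : ρ ≤ ∏ i ∈ (Finset.univ.erase o).erase j₀, r i)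
    (hprodL : Real.exp (-L) ≤ ∏ i ∈ Finset.univ.erase o, r i) {t : ℕ} (ht : t * κ ≤ 1 / 2) :
    ∃ (S : Finset V) (A' : W → Finset V), S.card ≤ t ∧ S ⊆ A o ∧ (∀ i, A' i ⊆ A i) ∧ A' o = A o ∧
      (∀ v ∈ S, ∀ j, j ≠ o → ∀ y ∈ A' j, E o j v y) ∧ dens E A / 2 ≤ dens E A' ∧
      (∀ i, ((A i).card : ℝ) * Real.exp (-(Real.log (2 / dens E A) / lam + L * t)) ≤
        ((A' i).card : ℝ)) ∧
      (S.card = t ∨ ∀ v ∈ A o, v ∉ S → ∃ j, j ≠ o ∧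
        ((nbhd E A' o v j).card : ℝ) < r j * (A' j).card) := by
  have hκ0 : 0 ≤ κ := le_trans (by positivity) hκ
  have key : ∀ n ≤ t, ∃ k ≤ t, ∃ S A', StarState E A o lam κ L k S A' ∧
      (k = n ∨ ∀ v ∈ A o, v ∉ S → ∃ j, j ≠ o ∧
        ((nbhd E A' o v j).card : ℝ) < r j * (A' j).card) := by
    intro n
    induction n with
    | zero =>
      intro _
      obtain ⟨A', hsub, ho, hd, hs, hmax⟩ := exists_maximal_box E o hA hl0.le
      exact ⟨0, Nat.zero_le _, ∅, A', ⟨rfl, by simp, hsub, ho, by simp, by simpa using hd, by simpa using hs,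
        hmax⟩, Or.inl rfl⟩
    | succ n ih =>
      intro hn
      obtain ⟨k, hk, S, A', hst, h | h⟩ := ih (by omega)
      · subst h
        by_cases hex : ∃ v ∈ A o, v ∉ S ∧
            ∀ j, j ≠ o → r j * (A' j).card ≤ ((nbhd E A' o v j).card : ℝ)
        · obtain ⟨v, hvA, hvS, hv⟩ := hex
          obtain ⟨A'', hA''⟩ := hst.succ hj₀ hA hl0.le hl1 hL hlL hρ hκ hκ1 hr0 hprod hprodL hvA hvS hv
          exact ⟨k + 1, hn, insert v S, A'', hA'', Or.inl rfl⟩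
        · push Not at hex
          exact ⟨k, hk, S, A', hst, Or.inr fun v hv hvS => hex v hv hvS⟩
      · exact ⟨k, hk, S, A', hst, Or.inr h⟩
  obtain ⟨k, hk, S, A', hst, hor⟩ := key t le_rfl
  have hhalf : 1 / 2 ≤ (1 - κ) ^ k := by
    have h1 := one_add_mul_le_pow (a := -κ) (by linarith) k
    have h2 : (k : ℝ) * κ ≤ t * κ := mul_le_mul_of_nonneg_right (Nat.cast_le.2 hk) hκ0
    have e : 1 + -κ = 1 - κ := by ring
    rw [e] at h1
    linarith
  have hdens : dens E A / 2 ≤ dens E A' := by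
    refine le_trans ?_ hst.dens_ge
    have := mul_le_mul_of_nonneg_left hhalf hA.le
    linarith
  have hd' : 0 < dens E A' := lt_of_lt_of_le (by positivity) hdens
  have hne := nonempty_of_dens_pos hd'
  have hneA := nonempty_of_dens_pos hA
  have hv := vol_pos hne
  have hvA := vol_pos hneA
  -- The density is at most `1`, so a lower bound on the score is a lower bound on `vol A' ^ lam`.
  -- Passing to maximal boxes never lowers the score and hence is harmless for the volume.
  have hvol : vol A * Real.exp (-(Real.log (2 / dens E A) / lam + L * t)) ≤ vol A' := by
    have h1 : dens E A * vol A ^ lam * ((1 / 2) * Real.exp (-(lam * L)) ^ t) ≤ vol A' ^ lam := by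
      have h2 : Real.exp (-(lam * L)) ^ t ≤ Real.exp (-(lam * L)) ^ k :=
        pow_le_pow_of_le_one (Real.exp_pos _).le
          (Real.exp_le_one_iff.2 (by have : 0 ≤ lam * L := by positivity
                                     linarith)) hk
      have h3 := hst.score_ge
      rw [mul_pow] at h3
      calc dens E A * vol A ^ lam * ((1 / 2) * Real.exp (-(lam * L)) ^ t)
          ≤ dens E A * vol A ^ lam * ((1 - κ) ^ k * Real.exp (-(lam * L)) ^ k) := by gcongr
        _ ≤ dens E A' * vol A' ^ lam := h3
        _ ≤ 1 * vol A' ^ lam := by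
            gcongr
            exact dens_le_one E A'
        _ = vol A' ^ lam := one_mul _
    have h4 := Real.log_le_log (by positivity) h1
    rw [Real.log_mul (by positivity) (by positivity), Real.log_mul (by positivity) (by positivity),
      Real.log_mul (by positivity) (by positivity), Real.log_rpow hvA, Real.log_rpow hv,
      Real.log_pow, Real.log_exp, Real.log_div one_ne_zero two_ne_zero, Real.log_one] at h4
    rw [← Real.log_le_log_iff (by positivity) hv, Real.log_mul hvA.ne' (Real.exp_pos _).ne',
      Real.log_exp, Real.log_div two_ne_zero hA.ne']
    have h5 : lam * (Real.log (vol A) + -((Real.log 2 - Real.log (dens E A)) / lam + L * t)) ≤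
        lam * Real.log (vol A') := by
      have e : lam * (Real.log (vol A) + -((Real.log 2 - Real.log (dens E A)) / lam + L * t)) =
          lam * Real.log (vol A) - (Real.log 2 - Real.log (dens E A)) - lam * L * t := by
        field_simp
        ring
      rw [e]
      linarith
    exact le_of_mul_le_mul_left h5 hl0
  refine ⟨S, A', hst.card_eq ▸ hk, hst.subset_at, hst.subset, hst.eq_at, hst.complete, hdens, fun i => ?_, ?_⟩
  -- No part grows, so a single part cannot lose a larger factor than the volume.
  · rw [vol_eq_mul A i, vol_eq_mul A' i] at hvol
    have hP : 0 < ∏ j ∈ Finset.univ.erase i, ((A j).card : ℝ) :=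
      Finset.prod_pos fun j _ => by exact_mod_cast (hneA j).card_pos
    have hPP : ∏ j ∈ Finset.univ.erase i, ((A' j).card : ℝ) ≤
        ∏ j ∈ Finset.univ.erase i, ((A j).card : ℝ) :=
      Finset.prod_le_prod (fun _ _ => Nat.cast_nonneg _) fun j _ =>
        Nat.cast_le.2 (Finset.card_le_card (hst.subset j))
    have h6 := hvol.trans (mul_le_mul_of_nonneg_left hPP (Nat.cast_nonneg _))
    rw [mul_right_comm] at h6
    exact le_of_mul_le_mul_right h6 hP
  · rcases hor with h | h
    · exact Or.inl (hst.card_eq.trans h)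
    · exact Or.inr h

end Star

/-! ### Making a sparse pair hereditarily sparse -/

section Regularization

variable {W V : Type*} [Fintype W] [DecidableEq W] [DecidableEq V]

theorem edgeCount_mono {R R' : V → V → Prop} (h : ∀ x y, R x y → R' x y) (X Y : Finset V) :
    edgeCount R X Y ≤ edgeCount R' X Y := by
  unfold edgeCount
  refine Nat.cast_le.2 (Finset.card_le_card fun p hp => ?_)
  rw [Finset.mem_filter] at hp ⊢
  exact ⟨hp.1, h _ _ hp.2⟩

theorem vol_update_pair (A : W → Finset V) {i j : W} (hij : i ≠ j) (X Y : Finset V) :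
    vol (Function.update (Function.update A i X) j Y) = X.card * Y.card *
      ∏ k ∈ (Finset.univ.erase j).erase i, ((A k).card : ℝ) := by
  rw [vol_eq_mul_mul _ hij]
  congr 1
  · simp [Function.update_of_ne hij]
  · refine Finset.prod_congr rfl fun k hk => ?_
    simp only [Finset.mem_erase, Finset.mem_univ, and_true] at hk
    rw [Function.update_of_ne hk.2, Function.update_of_ne hk.1]

theorem card_copies_update_pair (E : W → W → V → V → Prop) {A : W → Finset V} {i j : W}
    (hij : i ≠ j) {X Y : Finset V} (hX : X ⊆ A i) (hY : Y ⊆ A j) :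
    ((copies E (Function.update (Function.update A i X) j Y)).card : ℝ) =
      ∑ p ∈ X ×ˢ Y, copiesAtPair E A i j p.1 p.2 := by
  rw [sum_copiesAtPair, copies_update E (by rwa [Function.update_of_ne hij.symm]),
    copies_update E hX, Finset.filter_filter]
  congr 2
  ext f
  simp

/-- A set of pairs can be made regular by removing dense rectangles. The weight that is lost is
proportional to the number of removed pairs if no rectangle has much weight. -/
theorem exists_regular_subset {w : V × V → ℝ} (hw : ∀ p, 0 ≤ w p) {A B : Finset V} {δ M β : ℝ}
    (hδ : 0 < δ) (hM : 0 ≤ M)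
    (h : ∀ X ⊆ A, ∀ Y ⊆ B, β ≤ (X.card : ℝ) → β ≤ (Y.card : ℝ) →
      ∑ p ∈ X ×ˢ Y, w p ≤ M * (X.card * Y.card)) (F : Finset (V × V)) :
    ∃ F' ⊆ F, (∀ X ⊆ A, ∀ Y ⊆ B, β ≤ (X.card : ℝ) → β ≤ (Y.card : ℝ) →
        (((X ×ˢ Y).filter (· ∈ F')).card : ℝ) ≤ δ * (X.card * Y.card)) ∧
      ∑ p ∈ F \ F', w p ≤ M / δ * (F \ F').card := by
  induction F using Finset.strongInduction with
  | H F ih =>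
    by_cases hreg : ∀ X ⊆ A, ∀ Y ⊆ B, β ≤ (X.card : ℝ) → β ≤ (Y.card : ℝ) →
        (((X ×ˢ Y).filter (· ∈ F)).card : ℝ) ≤ δ * (X.card * Y.card)
    · exact ⟨F, subset_rfl, hreg, by simp⟩
    · push Not at hreg
      obtain ⟨X, hX, Y, hY, hXβ, hYβ, hlt⟩ := hreg
      -- A violating rectangle contains more than `δ * |X| * |Y|` pairs of `F`, of total weight at
      -- most `M * |X| * |Y|`: removing them costs at most `M / δ` per pair.
      set R := (X ×ˢ Y).filter (· ∈ F) with hR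
      have hRF : R ⊆ F := fun p hp => (Finset.mem_filter.1 hp).2
      have hR0 : (0 : ℝ) < R.card := lt_of_le_of_lt (by positivity) hlt
      have hRne : R.Nonempty := Finset.card_pos.1 (by exact_mod_cast hR0)
      obtain ⟨F', hF', hreg', hsum'⟩ := ih (F \ R) (Finset.sdiff_ssubset hRF hRne)
      refine ⟨F', hF'.trans Finset.sdiff_subset, hreg', ?_⟩
      have hRF' : R ⊆ F \ F' := fun p hp => Finset.mem_sdiff.2
        ⟨hRF hp, fun h => (Finset.mem_sdiff.1 (hF' h)).2 hp⟩
      have e : (F \ R) \ F' = (F \ F') \ R := by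
        ext p; simp only [Finset.mem_sdiff]; tauto
      rw [e] at hsum'
      have h1 : ∑ p ∈ R, w p ≤ M / δ * R.card := by
        calc ∑ p ∈ R, w p ≤ ∑ p ∈ X ×ˢ Y, w p :=
              Finset.sum_le_sum_of_subset_of_nonneg (Finset.filter_subset _ _) fun p _ _ => hw p
          _ ≤ M * (X.card * Y.card) := h X hX Y hY hXβ hYβ
          _ = M / δ * (δ * (X.card * Y.card)) := by field_simp
          _ ≤ M / δ * R.card := by gcongr
      rw [← Finset.sum_sdiff hRF', ← Finset.card_sdiff_add_card_eq_card hRF']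
      push_cast
      linarith

/-- If the pair `i, j` is sparse, then either the copies are denser in a large subbox, or the pair
is made regular with a small density by deleting edges that lie in few copies. -/
theorem exists_dense_box_or_regular {E : W → W → V → V → Prop}
    (hE : ∀ i j x y, E i j x y → E j i y x) {A : W → Finset V} {i j : W} (hij : i ≠ j)
    {q K γ β : ℝ} (hq : 0 < q) (hK : 0 < K) (hγ : 0 < γ)
    (hedge : edgeCount (E i j) (A i) (A j) ≤ q / K ^ 2 * ((A i).card * (A j).card))
    (hcop : γ * vol A ≤ ((copies E A).card : ℝ)) :
    (∃ X ⊆ A i, ∃ Y ⊆ A j, β ≤ (X.card : ℝ) ∧ β ≤ (Y.card : ℝ) ∧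
      γ * K / 2 * vol (Function.update (Function.update A i X) j Y) <
        ((copies E (Function.update (Function.update A i X) j Y)).card : ℝ)) ∨
    ∃ E' : W → W → V → V → Prop, (∀ k l x y, E' k l x y → E k l x y) ∧
      (∀ k l x y, E' k l x y → E' l k y x) ∧ γ / 2 * vol A ≤ ((copies E' A).card : ℝ) ∧
      ∀ X ⊆ A i, ∀ Y ⊆ A j, β ≤ (X.card : ℝ) → β ≤ (Y.card : ℝ) →
        edgeCount (E' i j) X Y ≤ q / K * (X.card * Y.card) := by
  rw [or_iff_not_imp_left]
  intro hno
  push Not at hno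
  set P := ∏ k ∈ (Finset.univ.erase j).erase i, ((A k).card : ℝ) with hP
  have hP0 : 0 ≤ P := Finset.prod_nonneg fun _ _ => Nat.cast_nonneg _
  set w : V × V → ℝ := fun p => copiesAtPair E A i j p.1 p.2 with hw
  set F := ((A i) ×ˢ (A j)).filter fun p => E i j p.1 p.2 with hF
  have hδ : 0 < q / K := div_pos hq hK
  have hM : 0 ≤ γ * K / 2 * P := mul_nonneg (by positivity) hP0
  have hw0 : ∀ p, 0 ≤ w p := fun p => Nat.cast_nonneg _
  obtain ⟨F', hF', hreg, hsum⟩ := exists_regular_subset hw0 (A := A i) (B := A j) (β := β) hδ hM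
    (fun X hX Y hY h1 h2 => by
      have := hno X hX Y hY h1 h2
      rw [vol_update_pair A hij, card_copies_update_pair E hij hX hY] at this
      linarith) F
  -- The deletion is made in both orientations to keep the system symmetric.
  set E' : W → W → V → V → Prop := fun k l x y =>
    E k l x y ∧ (k = i → l = j → (x, y) ∈ F') ∧ (k = j → l = i → (y, x) ∈ F') with hE'
  refine ⟨E', fun k l x y h => h.1, fun k l x y h => ⟨hE _ _ _ _ h.1, fun h1 h2 => h.2.2 h2 h1,
    fun h1 h2 => h.2.1 h2 h1⟩, ?_, ?_⟩
  · have e1 : ((copies E A).card : ℝ) = ∑ p ∈ F, w p := by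
      rw [hw, sum_copiesAtPair E, Finset.filter_true_of_mem]
      intro f hf
      rw [mem_copies] at hf
      exact Finset.mem_filter.2 ⟨Finset.mem_product.2 ⟨hf.1 i, hf.1 j⟩, hf.2 i j hij⟩
    have e2 : ((copies E' A).card : ℝ) = ∑ p ∈ F', w p := by
      rw [hw, sum_copiesAtPair E]
      congr 2
      ext f
      simp only [Finset.mem_filter, mem_copies]
      constructor
      · rintro ⟨h1, h2⟩
        exact ⟨⟨h1, fun k l hkl => (h2 k l hkl).1⟩, (h2 i j hij).2.1 rfl rfl⟩
      · rintro ⟨⟨h1, h2⟩, h3⟩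
        refine ⟨h1, fun k l hkl => ⟨h2 k l hkl, ?_, ?_⟩⟩
        · rintro rfl rfl; exact h3
        · rintro rfl rfl; exact h3
    have h3 : ((F \ F').card : ℝ) ≤ q / K ^ 2 * ((A i).card * (A j).card) := by
      refine le_trans (Nat.cast_le.2 (Finset.card_le_card Finset.sdiff_subset)) hedge
    -- At most `q / K ^ 2` of all pairs are removed, each at a cost of at most `(γ * K / 2) / (q /
    -- K)` times `P`. One factor `K` pays for the denser rectangles allowed, the other for the bound
    -- `q / K` instead of `q`.
    have h4 : γ * K / 2 * P / (q / K) * ((F \ F').card : ℝ) ≤ γ / 2 * vol A := by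
      refine (mul_le_mul_of_nonneg_left h3 (div_nonneg hM hδ.le)).trans (le_of_eq ?_)
      rw [vol_eq_mul_mul A hij, ← hP]
      generalize ((A i).card : ℝ) = a
      generalize ((A j).card : ℝ) = b
      field_simp
    rw [e2]
    rw [e1, ← Finset.sum_sdiff hF'] at hcop
    linarith
  · intro X hX Y hY h1 h2
    refine le_trans ?_ (hreg X hX Y hY h1 h2)
    unfold edgeCount
    refine Nat.cast_le.2 (Finset.card_le_card fun p hp => ?_)
    have hp' := @Finset.mem_filter _ (fun p : V × V => E' i j p.1 p.2) (fun _ => Classical.propDecidable _) _ _ |>.1 hp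
    exact Finset.mem_filter.2 ⟨hp'.1, hp'.2.2.1 rfl rfl⟩

end Regularization

/-! ### Passing to one index less -/

section Reduction

variable {W V : Type*} [Fintype W] [DecidableEq W] [DecidableEq V]

/-- Forgetting the index `o` does not decrease the density. -/
theorem dens_le_dens_subtype {E : W → W → V → V → Prop} {A : W → Finset V} (o : W)
    (hA : ∀ i, (A i).Nonempty) :
    dens E A ≤ dens (W := {k // k ≠ o}) (fun k l => E k l) (fun k => A k) := by
  have hvol : vol A = (A o).card * vol (W := {k // k ≠ o}) (fun k => A k) := by
    rw [vol_eq_mul A o]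
    congr 1
    exact Finset.prod_subtype (p := fun k => k ≠ o) _ (by simp) fun k => ((A k).card : ℝ)
  have hcard : (copies E A).card ≤
      (A o).card * (copies (W := {k // k ≠ o}) (fun k l => E k l) (fun k => A k)).card := by
    rw [← Finset.card_product]
    refine Finset.card_le_card_of_injOn (fun f => (f o, fun k => f k)) ?_ ?_
    · intro f hf
      have hf' := mem_copies.1 (Finset.mem_coe.1 hf)
      simp only [Finset.coe_product, Set.mem_prod, Finset.mem_coe]
      exact ⟨hf'.1 o, mem_copies.2 ⟨fun k => hf'.1 k, fun k l hkl =>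
        hf'.2 k l fun h => hkl (Subtype.ext h)⟩⟩
    · intro f _ g _ h
      simp only [Prod.mk.injEq] at h
      ext k
      by_cases hk : k = o
      · rw [hk]; exact h.1
      · exact congrFun h.2 ⟨k, hk⟩
  have h0 : (0 : ℝ) < (A o).card := by exact_mod_cast (hA o).card_pos
  have h1 : 0 < vol (W := {k // k ≠ o}) (fun k => A k) := vol_pos fun k => hA k
  rw [dens, dens, div_le_div_iff₀ (vol_pos hA) h1, hvol]
  have h2 : ((copies E A).card : ℝ) ≤ (A o).card *
      (copies (W := {k // k ≠ o}) (fun k l => E k l) (fun k => A k)).card := by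
    exact_mod_cast hcard
  nlinarith

/-- A blowup for the indices other than `o`, within the common neighbourhood of a set of points for
the index `o`, extends to a blowup for all indices. -/
theorem HasBlowup.extend {E : W → W → V → V → Prop} (hE : ∀ i j x y, E i j x y → E j i y x)
    {A : W → Finset V} {o : W} {S : Finset V} {t : ℝ} (hS : S ⊆ A o) (ht : t ≤ (S.card : ℝ))
    (hcomp : ∀ v ∈ S, ∀ j, j ≠ o → ∀ y ∈ A j, E o j v y)
    (h : HasBlowup (W := {k // k ≠ o}) (fun k l => E k l) (fun k => A k) t) :
    HasBlowup E A t := by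
  obtain ⟨T, hTA, hTt, hT⟩ := h
  refine ⟨fun k => if hk : k = o then S else T ⟨k, hk⟩, fun k => ?_, fun k => ?_, ?_⟩
  · by_cases hk : k = o
    · subst hk; simpa using hS
    · simpa [hk] using hTA ⟨k, hk⟩
  · by_cases hk : k = o
    · simpa [hk] using ht
    · simpa [hk] using hTt ⟨k, hk⟩
  · intro i j hij x hx y hy
    by_cases hi : i = o
    · have hj : j ≠ o := fun h => hij (hi.trans h.symm)
      simp only [hi, dif_pos] at hx
      simp only [hj, dif_neg, not_false_eq_true] at hy
      rw [hi]
      exact hcomp x hx j hj y (hTA ⟨j, hj⟩ hy)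
    · simp only [hi, dif_neg, not_false_eq_true] at hx
      by_cases hj : j = o
      · simp only [hj, dif_pos] at hy
        rw [hj]
        exact hE _ _ _ _ (hcomp y hy i hi x (hTA ⟨i, hi⟩ hx))
      · simp only [hj, dif_neg, not_false_eq_true] at hy
        exact hT ⟨i, hi⟩ ⟨j, hj⟩ (fun h => hij (congrArg Subtype.val h)) x hx y hy

end Reduction

/-! ### What happens when the star process stops -/

section Alternative

variable {W V : Type*} [Fintype W] [DecidableEq W] [DecidableEq V]

theorem dens_ge_of_card {E : W → W → V → V → Prop} {A : W → Finset V} {d : ℝ}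
    (hA : ∀ i, (A i).Nonempty) (h : d * vol A ≤ ((copies E A).card : ℝ)) : d ≤ dens E A := by
  rw [dens, le_div_iff₀ (vol_pos hA)]
  exact h

/-- Every copy contains a related pair of the parts `i` and `j`. This keeps the bounds `q` from
becoming much smaller than the density and so ends the sparsification. -/
theorem dens_le_of_upperRegular {E : W → W → V → V → Prop} {A : W → Finset V} {q : W → W → ℝ}
    {β : ℝ} (h : UpperRegular E A q β) (hA : ∀ i, (A i).Nonempty)
    (hβ : ∀ i, β ≤ ((A i).card : ℝ)) {i j : W} (hij : i ≠ j) : dens E A ≤ q i j := by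
  rw [dens, div_le_iff₀ (vol_pos hA), vol_eq_mul_mul A hij, ← mul_assoc]
  refine (card_copies_le_edgeCount E A hij).trans ?_
  exact mul_le_mul_of_nonneg_right (h i j hij _ subset_rfl _ subset_rfl (hβ i) (hβ j))
    (Finset.prod_nonneg fun _ _ => Nat.cast_nonneg _)

/-- If all but few points of the part `o` have a small degree to some other part, then a pair
`o, j` is sparse in a subbox that retains much of the density. -/
theorem exists_sparse_pair {E : W → W → V → V → Prop} {A : W → Finset V} {o : W} {S : Finset V}
    (hd : 0 < dens E A) (hS : (S.card : ℝ) ≤ dens E A / 2 * (A o).card) {r : W → ℝ}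
    (h : ∀ v ∈ A o, v ∉ S → ∃ j, j ≠ o ∧ ((nbhd E A o v j).card : ℝ) < r j * (A j).card) :
    ∃ j, j ≠ o ∧ ∃ U ⊆ A o,
      dens E A / (2 * Fintype.card W) * vol A ≤ ((copies E (Function.update A o U)).card : ℝ) ∧
      edgeCount (E o j) U (A j) ≤ r j * (U.card * (A j).card) := by
  have hne := nonempty_of_dens_pos hd
  set U : W → Finset V := fun j =>
    (A o).filter fun v => ((nbhd E A o v j).card : ℝ) < r j * (A j).card with hU
  have hUsub : ∀ j, U j ⊆ A o := fun j => Finset.filter_subset _ _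
  have hW : (0 : ℝ) < Fintype.card W := by exact_mod_cast Fintype.card_pos_iff.2 ⟨o⟩
  have hAo : (0 : ℝ) < (A o).card := by exact_mod_cast (hne o).card_pos
  -- The copies with `f o ∈ S` are at most half of all. The others are distributed over the indices
  -- `j` at which `f o` has a small degree, and some `j` receives its share.
  have hcover : ((copies E A).card : ℝ) ≤ (copies E (Function.update A o (S ∩ A o))).card +
      ∑ j ∈ Finset.univ.erase o, ((copies E (Function.update A o (U j))).card : ℝ) := by
    have h1 : copies E A ⊆ copies E (Function.update A o (S ∩ A o)) ∪
        (Finset.univ.erase o).biUnion fun j => copies E (Function.update A o (U j)) := by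
      intro f hf
      have hfo := (mem_copies.1 hf).1 o
      rw [Finset.mem_union, Finset.mem_biUnion]
      by_cases hfS : f o ∈ S
      · left
        rw [copies_update E Finset.inter_subset_right, Finset.mem_filter]
        exact ⟨hf, Finset.mem_inter.2 ⟨hfS, hfo⟩⟩
      · right
        obtain ⟨j, hj, hlt⟩ := h (f o) hfo hfS
        refine ⟨j, Finset.mem_erase.2 ⟨hj, Finset.mem_univ _⟩, ?_⟩
        rw [copies_update E (hUsub j), Finset.mem_filter]
        exact ⟨hf, Finset.mem_filter.2 ⟨hfo, hlt⟩⟩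
    have h2 := (Finset.card_le_card h1).trans ((Finset.card_union_le _ _).trans
      (Nat.add_le_add_left Finset.card_biUnion_le _))
    exact_mod_cast h2
  have hSc : ((copies E (Function.update A o (S ∩ A o))).card : ℝ) ≤ dens E A / 2 * vol A := by
    refine (card_copies_le_vol _ _).trans ?_
    rw [vol_update, vol_eq_mul A o, ← mul_assoc]
    refine mul_le_mul_of_nonneg_right (le_trans ?_ hS)
      (Finset.prod_nonneg fun _ _ => Nat.cast_nonneg _)
    exact Nat.cast_le.2 (Finset.card_le_card Finset.inter_subset_left)
  rw [card_copies_eq hne] at hcover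
  have hpos : 0 < dens E A / 2 * vol A := mul_pos (by linarith) (vol_pos hne)
  have hcov2 : dens E A / 2 * vol A ≤
      ∑ j ∈ Finset.univ.erase o, ((copies E (Function.update A o (U j))).card : ℝ) := by
    linarith
  have hne' : (Finset.univ.erase o : Finset W).Nonempty := by
    rw [Finset.nonempty_iff_ne_empty]
    intro h0
    rw [h0, Finset.sum_empty] at hcov2
    linarith
  obtain ⟨j, hj, hjc⟩ : ∃ j ∈ Finset.univ.erase o, dens E A / (2 * Fintype.card W) * vol A ≤
      ((copies E (Function.update A o (U j))).card : ℝ) := by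
    refine Finset.exists_le_of_sum_le hne' (le_trans ?_ hcov2)
    rw [Finset.sum_const, nsmul_eq_mul]
    have h3 : (((Finset.univ.erase o : Finset W).card : ℕ) : ℝ) ≤ Fintype.card W :=
      Nat.cast_le.2 (Finset.card_le_univ _)
    calc (((Finset.univ.erase o : Finset W).card : ℕ) : ℝ) *
          (dens E A / (2 * Fintype.card W) * vol A)
        ≤ Fintype.card W * (dens E A / (2 * Fintype.card W) * vol A) :=
          mul_le_mul_of_nonneg_right h3 (mul_nonneg (by positivity) (vol_nonneg _))
      _ = dens E A / 2 * vol A := by field_simp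
  refine ⟨j, Finset.ne_of_mem_erase hj, U j, hUsub j, hjc, ?_⟩
  have h4 : edgeCount (E o j) (U j) (A j) = ∑ v ∈ U j, ((nbhd E A o v j).card : ℝ) := by
    unfold edgeCount nbhd
    rw [Finset.card_filter, Finset.sum_product]
    push_cast
    refine Finset.sum_congr rfl fun v _ => ?_
    rw [Finset.card_filter]
    push_cast
    rfl
  rw [h4]
  refine (Finset.sum_le_card_nsmul _ _ (r j * (A j).card) fun v hv => ?_).trans (le_of_eq ?_)
  · exact (Finset.mem_filter.1 hv).2.le
  · rw [nsmul_eq_mul]; ring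

/-- Case distinction at a vertex `o`: either there are `t` points in the part `o` that are joined to
large subsets of all other parts, or the copies are much denser in a subbox, or some pair `o, j`
can be made `K` times sparser than its regularity bound. -/
theorem star_alternative {E : W → W → V → V → Prop} (hE : ∀ i j x y, E i j x y → E j i y x)
    {A : W → Finset V} {o j₀ : W} (hj₀ : j₀ ≠ o) {lam κ L ρ : ℝ} (hA : 0 < dens E A)
    (hl0 : 0 < lam) (hl1 : lam < 1) (hL : 0 ≤ L) (hlL : lam * L ≤ 1) (hρ : 0 < ρ)
    (hκ : Fintype.card W * (lam * (1 + 2 * L) / ρ) ≤ κ) (hκ1 : κ < 1) {K : ℝ} (hK : 0 < K)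
    {q : W → W → ℝ} (hq0 : ∀ i j, 0 < q i j)
    (hprod : ρ ≤ ∏ i ∈ (Finset.univ.erase o).erase j₀, q o i / K ^ 2)
    (hprodL : Real.exp (-L) ≤ ∏ i ∈ Finset.univ.erase o, q o i / K ^ 2) {t : ℕ}
    (ht : t * κ ≤ 1 / 2) {β b Δ : ℝ} (hreg : UpperRegular E A q β)
    (hΔ : Real.log (2 / dens E A) / lam + L * t ≤ Δ)
    (htA : (t : ℝ) ≤ dens E A / 4 * (A o).card)
    (hsize : ∀ i, Real.exp b ≤ ((A i).card : ℝ)) :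
    (∃ (S : Finset V) (A' : W → Finset V), S.card = t ∧ S ⊆ A o ∧ (∀ i, A' i ⊆ A i) ∧
      A' o = A o ∧ (∀ v ∈ S, ∀ j, j ≠ o → ∀ y ∈ A' j, E o j v y) ∧ dens E A / 2 ≤ dens E A' ∧
      ∀ i, Real.exp (b - Δ) ≤ ((A' i).card : ℝ)) ∨
    (∃ A' : W → Finset V, (∀ i, A' i ⊆ A i) ∧ dens E A * K / (8 * Fintype.card W) ≤ dens E A' ∧
      ∀ i, min β (Real.exp (b - Δ) * (dens E A / (4 * Fintype.card W))) ≤ ((A' i).card : ℝ)) ∨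
    ∃ (j : W) (E' : W → W → V → V → Prop) (A' : W → Finset V), j ≠ o ∧
      (∀ k l x y, E' k l x y → E k l x y) ∧ (∀ k l x y, E' k l x y → E' l k y x) ∧
      (∀ i, A' i ⊆ A i) ∧ dens E A / (8 * Fintype.card W) ≤ dens E' A' ∧
      (∀ i, Real.exp (b - Δ) * (dens E A / (4 * Fintype.card W)) ≤ ((A' i).card : ℝ)) ∧
      UpperRegular E' A' (fun k l => if k = o ∧ l = j then q k l / K else q k l) β := by
  have hW : (0 : ℝ) < Fintype.card W := by exact_mod_cast Fintype.card_pos_iff.2 ⟨o⟩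
  have hW1 : (1 : ℝ) ≤ Fintype.card W := by exact_mod_cast Fintype.card_pos_iff.2 ⟨o⟩
  obtain ⟨S, A', hSt, hSA, hsub, ho, hcomp, hdens, hsz, hor⟩ := exists_star hj₀ hA hl0 hl1 hL hlL hρ
    hκ hκ1 (r := fun i => q o i / K ^ 2) (fun i => (div_pos (hq0 o i) (by positivity)).le) hprod
    hprodL ht
  have hsz' : ∀ i, Real.exp (b - Δ) ≤ ((A' i).card : ℝ) := by
    intro i
    refine le_trans ?_ (hsz i)
    rw [sub_eq_add_neg, Real.exp_add]
    exact mul_le_mul (hsize i) (Real.exp_le_exp.2 (neg_le_neg hΔ)) (Real.exp_pos _).le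
      (Nat.cast_nonneg _)
  have hd' : 0 < dens E A' := lt_of_lt_of_le (by positivity) hdens
  have hne' := nonempty_of_dens_pos hd'
  rcases hor with hSt' | hstuck
  · exact Or.inl ⟨S, A', hSt', hSA, hsub, ho, hcomp, hdens, hsz'⟩
  right
  have hS2 : (S.card : ℝ) ≤ dens E A' / 2 * (A' o).card := by
    have h1 : (S.card : ℝ) ≤ t := Nat.cast_le.2 hSt
    rw [ho]
    refine (h1.trans htA).trans (mul_le_mul_of_nonneg_right (by linarith) (Nat.cast_nonneg _))
  obtain ⟨j, hj, U, hUA, hUc, hUe⟩ := exists_sparse_pair hd' hS2 (by rw [ho]; exact hstuck)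
  set B := Function.update A' o U with hB
  have hBsub' : ∀ i, B i ⊆ A' i := by
    intro i
    by_cases hi : i = o
    · subst hi; simpa [hB] using hUA
    · rw [hB, Function.update_of_ne hi]
  have hBsub : ∀ i, B i ⊆ A i := fun i => (hBsub' i).trans (hsub i)
  have hdW : dens E A / (4 * Fintype.card W) ≤ dens E A' / (2 * Fintype.card W) := by
    rw [div_le_div_iff₀ (by positivity) (by positivity)]
    nlinarith
  have hcop : dens E A / (4 * Fintype.card W) * vol A' ≤ ((copies E B).card : ℝ) :=
    (mul_le_mul_of_nonneg_right hdW (vol_nonneg _)).trans hUc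
  have hUsz : dens E A / (4 * Fintype.card W) * (A' o).card ≤ (U.card : ℝ) := by
    have h1 := hcop.trans (card_copies_le_vol _ _)
    rw [hB, vol_update, vol_eq_mul A' o, ← mul_assoc] at h1
    exact le_of_mul_le_mul_right h1
      (Finset.prod_pos fun i _ => by exact_mod_cast (hne' i).card_pos)
  have hd1 : dens E A / (4 * Fintype.card W) ≤ 1 := by
    rw [div_le_one (by positivity)]
    have := dens_le_one E A
    linarith
  have hd0 : 0 < dens E A / (4 * Fintype.card W) := by positivity
  have hBsz : ∀ i, Real.exp (b - Δ) * (dens E A / (4 * Fintype.card W)) ≤ ((B i).card : ℝ) := by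
    intro i
    by_cases hi : i = o
    · subst hi
      simp only [hB, Function.update_self]
      refine le_trans ?_ hUsz
      rw [mul_comm]
      exact mul_le_mul_of_nonneg_left (hsz' _) hd0.le
    · rw [hB, Function.update_of_ne hi]
      exact (mul_le_of_le_one_right (Real.exp_pos _).le hd1).trans (hsz' i)
  have hBne : ∀ i, (B i).Nonempty := fun i => by
    have : (0 : ℝ) < (B i).card := lt_of_lt_of_le (by positivity) (hBsz i)
    exact Finset.card_pos.1 (by exact_mod_cast this)
  have hcopB : dens E A / (4 * Fintype.card W) * vol B ≤ ((copies E B).card : ℝ) :=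
    (mul_le_mul_of_nonneg_left (vol_mono hBsub') hd0.le).trans hcop
  have hedge : edgeCount (E o j) (B o) (B j) ≤ q o j / K ^ 2 * ((B o).card * (B j).card) := by
    simpa [hB, Function.update_of_ne hj] using hUe
  rcases exists_dense_box_or_regular hE hj.symm (β := β) (hq0 o j) hK hd0 hedge hcopB with
    ⟨X, hX, Y, hY, hXβ, hYβ, hlt⟩ | ⟨E', hE'E, hE's, hE'c, hE'r⟩
  · left
    set B' := Function.update (Function.update B o X) j Y with hB'
    have hB'sub : ∀ i, B' i ⊆ B i := by
      intro i
      by_cases hi : i = j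
      · subst hi; simpa [hB'] using hY
      · rw [hB', Function.update_of_ne hi]
        by_cases hi' : i = o
        · subst hi'; simpa using hX
        · rw [Function.update_of_ne hi']
    have hB'v : 0 < vol B' := by
      by_contra hv
      have hv0 : vol B' = 0 := le_antisymm (not_lt.1 hv) (vol_nonneg _)
      have := card_copies_le_vol E B'
      rw [hv0] at this hlt
      linarith
    refine ⟨B', fun i => (hB'sub i).trans (hBsub i), ?_, fun i => ?_⟩
    · rw [dens, dens, le_div_iff₀ hB'v]
      refine le_trans (le_of_eq ?_) hlt.le
      rw [dens]
      field_simp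
      ring
    · by_cases hi : i = j
      · subst hi; simp only [hB', Function.update_self]; exact (min_le_left _ _).trans hYβ
      · rw [hB', Function.update_of_ne hi]
        by_cases hi' : i = o
        · subst hi'; simp only [Function.update_self]; exact (min_le_left _ _).trans hXβ
        · rw [Function.update_of_ne hi']
          exact (min_le_right _ _).trans (hBsz i)
  · right
    refine ⟨j, E', B, hj, hE'E, hE's, hBsub, ?_, hBsz, ?_⟩
    · refine dens_ge_of_card hBne (le_trans (le_of_eq ?_) hE'c)
      field_simp
      ring
    · intro k l hkl X hX Y hY h1 h2
      beta_reduce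
      by_cases hkj : k = o ∧ l = j
      · rw [if_pos hkj]
        obtain ⟨rfl, rfl⟩ := hkj
        exact hE'r X hX Y hY h1 h2
      · rw [if_neg hkj]
        exact (edgeCount_mono (hE'E k l) X Y).trans
          (hreg k l hkl X (hX.trans (hBsub k)) Y (hY.trans (hBsub l)) h1 h2)

end Alternative

/-! ### Parameters and the basic step -/

section Steps

variable {W V : Type*} [Fintype W] [DecidableEq W] [DecidableEq V]

/-- The numerical conditions under which the steps of the main argument work: `h` is the number of
indices, `exp (-ℓ)` the density, `exp s` the size of the parts, `exp (-(ε * s))` the allowed loss of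
size, `τ` the desired size of the blowup, and `t` and `m` are the numbers of points found by the star
process and along Hamiltonian paths. -/
structure Scale (h ℓ s ε σ τ : ℝ) (t m : ℕ) : Prop where
  two_le : 2 ≤ h
  ell_ge : 16 * h ^ 2 ≤ ℓ
  eps_pos : 0 < ε
  s_ge : 48 * ℓ ^ 2 ≤ ε * s
  one_le_m : 1 ≤ m
  tau_le_t : τ ≤ t
  tau_le_m : τ ≤ Real.exp (-(ℓ / 2)) * m
  -- The factor of `t` is the loss `κ` of the star process for `lam = 16 * ℓ / (ε * s)`, `L = 3 * ℓ`
  -- and `ρ = exp (-(ℓ / 2))`.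
  loss_le : t * (h * (16 * ℓ / (ε * s) * (1 + 2 * (3 * ℓ)) / Real.exp (-(ℓ / 2)))) ≤ 1 / 2
  loss_lt : h * (16 * ℓ / (ε * s) * (1 + 2 * (3 * ℓ)) / Real.exp (-(ℓ / 2))) < 1
  t_le : 3 * ℓ * t ≤ ε * s / 4
  t_le_exp : (t : ℝ) ≤ Real.exp (-(2 * ℓ)) / 8 * Real.exp (s / 2)
  m_le_exp : (m : ℝ) ≤ Real.exp (-(2 * ℓ)) / 8 * Real.exp (s / 2)
  path_le : (h - 1) * (3 * (m + 2) * ℓ) ≤ σ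

theorem Scale.ell_pos {h ℓ s ε σ τ : ℝ} {t m : ℕ} (hs : Scale h ℓ s ε σ τ t m) : 0 < ℓ := by
  nlinarith [hs.two_le, hs.ell_ge]

/-- Absorbs the factors `4` lost on the edges of a path into the slack `1 / (8 * h)` of the
exponent. -/
theorem Scale.four_pow_le {h ℓ s ε σ τ : ℝ} {t m : ℕ} (hs : Scale h ℓ s ε σ τ t m) {n : ℕ}
    (hn : h = n + 1) : (4 : ℝ) ^ n ≤ Real.exp (ℓ / (8 * h)) := by
  have h0 : 0 < h := by linarith [hs.two_le]
  have h4 : (4 : ℝ) ≤ Real.exp 2 := by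
    have h1 := Real.exp_one_gt_d9
    have h2 : Real.exp 2 = Real.exp 1 * Real.exp 1 := by rw [← Real.exp_add]; norm_num
    rw [h2]
    nlinarith
  calc (4 : ℝ) ^ n ≤ Real.exp 2 ^ n := pow_le_pow_left₀ (by norm_num) h4 n
    _ = Real.exp (n * 2) := (Real.exp_nat_mul 2 n).symm
    _ ≤ Real.exp (ℓ / (8 * h)) := by
      refine Real.exp_le_exp.2 ?_
      rw [le_div_iff₀ (by positivity)]
      have := hs.ell_ge
      nlinarith

/-- Each `j ≠ o` is missing for just one of the `h - 1` choices of `j₀`. -/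
theorem sum_sum_erase_erase {a : W → ℝ} {o : W} :
    ∑ j₀ ∈ Finset.univ.erase o, ∑ j ∈ (Finset.univ.erase o).erase j₀, a j =
      ((Fintype.card W : ℝ) - 2) * ∑ j ∈ Finset.univ.erase o, a j := by
  have h1 : ∀ j₀ ∈ Finset.univ.erase o, ∑ j ∈ (Finset.univ.erase o).erase j₀, a j =
      ∑ j ∈ Finset.univ.erase o, a j - a j₀ := fun j₀ hj₀ => by
    rw [← Finset.add_sum_erase _ _ hj₀]; ring
  rw [Finset.sum_congr rfl h1, Finset.sum_sub_distrib, Finset.sum_const, nsmul_eq_mul,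
    Finset.card_erase_of_mem (Finset.mem_univ o), Finset.card_univ,
    Nat.cast_sub (Fintype.card_pos_iff.2 ⟨o⟩)]
  push_cast
  ring

/-- If every star is sparse, even without its sparsest pair, then there is a blowup along some
Hamiltonian path. -/
theorem hasBlowup_of_sparse_stars {E : W → W → V → V → Prop}
    (hE : ∀ i j x y, E i j x y → E j i y x) {h ℓ s ε σ τ : ℝ} {t m : ℕ}
    (hs : Scale h ℓ s ε σ τ t m) {n : ℕ} (hW : Fintype.card W = n + 1) (hn : h = n + 1)
    {A : W → Finset V} {a : W → W → ℝ} (ha : ∀ i j, 0 ≤ a i j) {f x : ℝ} (hf : s / 2 ≤ f)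
    (hx : f + σ ≤ x) (hreg : UpperRegular E A (fun i j => Real.exp (-a i j)) (Real.exp f))
    (hsize : ∀ i, Real.exp x ≤ ((A i).card : ℝ))
    (hD : Real.exp (-((1 + 1 / (32 * h ^ 2)) * ℓ)) ≤ dens E A)
    (hsparse : ∀ o j₀, j₀ ≠ o →
      (1 / 2 - 1 / (8 * h)) * ℓ < ∑ j ∈ (Finset.univ.erase o).erase j₀, a o j) :
    HasBlowup E A τ := by
  have hℓ := hs.ell_pos
  have h2 := hs.two_le
  have h0 : 0 < h := by linarith
  have hn1 : (1 : ℝ) ≤ n := by linarith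
  have hn0 : 0 < n := by exact_mod_cast (by linarith : (0 : ℝ) < n)
  have hWh : (Fintype.card W : ℝ) = h := by rw [hW, hn]; push_cast; ring
  have hhh : 1 / (32 * h ^ 2) ≤ 1 / (8 * h) := by
    rw [div_le_div_iff₀ (by positivity) (by positivity)]
    nlinarith
  have h8 : 1 / (8 * h) ≤ 1 / 16 := by
    rw [div_le_div_iff₀ (by positivity) (by positivity)]
    linarith
  have hne : ∀ i, (A i).Nonempty := fun i => by
    have : (0 : ℝ) < (A i).card := lt_of_lt_of_le (Real.exp_pos _) (hsize i)
    exact Finset.card_pos.1 (by exact_mod_cast this)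
  have hpow := hs.four_pow_le hn
  -- Averaging over the omitted index multiplies the bound by `(h - 1) / (h - 2)`, which lifts it
  -- from below `ℓ / 2` to above it. For `h = 2` the hypothesis `hsparse` is contradictory, as its
  -- sums are empty.
  have hstar : ∀ o, (1 / 2 + 1 / (4 * h)) * ℓ ≤ ∑ j ∈ Finset.univ.erase o, a o j := by
    intro o
    have h3 : ∑ j₀ ∈ Finset.univ.erase o, (1 / 2 - 1 / (8 * h)) * ℓ ≤
        ∑ j₀ ∈ Finset.univ.erase o, ∑ j ∈ (Finset.univ.erase o).erase j₀, a o j :=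
      Finset.sum_le_sum fun j₀ hj₀ => (hsparse o j₀ (Finset.ne_of_mem_erase hj₀)).le
    rw [sum_sum_erase_erase, Finset.sum_const, nsmul_eq_mul,
      Finset.card_erase_of_mem (Finset.mem_univ o), Finset.card_univ, hW,
      Nat.add_sub_cancel] at h3
    push_cast at h3
    set Y := ∑ j ∈ Finset.univ.erase o, a o j
    have hnh : (n : ℝ) = h - 1 := by linarith
    rw [hnh] at h3
    by_contra hlt
    push Not at hlt
    have h5 : (h - 2) * Y ≤ (h - 2) * ((1 / 2 + 1 / (4 * h)) * ℓ) :=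
      mul_le_mul_of_nonneg_left hlt.le (by linarith)
    have h6 : (h - 1) * ((1 / 2 - 1 / (8 * h)) * ℓ) ≤ (h - 2) * ((1 / 2 + 1 / (4 * h)) * ℓ) := by
      have e : h - 1 + 1 - 2 = h - 2 := by ring
      rw [e] at h3
      exact h3.trans h5
    have h7 : (h - 1) * (1 / 2 - 1 / (8 * h)) ≤ (h - 2) * (1 / 2 + 1 / (4 * h)) := by
      refine le_of_mul_le_mul_right (a := ℓ) ?_ hℓ
      linarith
    have e1 : (h - 1) * (1 / 2 - 1 / (8 * h)) = h / 2 - 5 / 8 + 1 / (8 * h) := by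
      field_simp; ring
    have e2 : (h - 2) * (1 / 2 + 1 / (4 * h)) = h / 2 - 3 / 4 - 1 / (2 * h) := by
      field_simp; ring
    rw [e1, e2] at h7
    have h8 : 0 < 1 / (8 * h) := by positivity
    have h9 : 0 < 1 / (2 * h) := by positivity
    linarith
  -- `g` is a crude lower bound for all densities along the path, and `κ` is the resulting loss of
  -- size per edge: `m + 2` factors `g / 8` and the `2 ^ (m * h)` classes.
  refine exists_complete_of_path hE (q := fun i j => Real.exp (-a i j)) (fun _ _ => Real.exp_pos _)
    (fun i j => Real.exp_le_one_iff.2 (by linarith [ha i j])) (m := m) hs.one_le_m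
    (g := Real.exp (-(2 * ℓ))) (b := f) (κ := 3 * (m + 2) * ℓ) (Real.exp_pos _) (by positivity)
    ?_ ?_ hW hn0 (Γ := dens E A) (Λ := (1 / 2 + 1 / (4 * h)) * ℓ) ?_ hreg
    (card_copies_eq hne).ge (fun i => le_trans (Real.exp_le_exp.2 ?_) (hsize i)) ?_ ?_ ?_
  · refine hs.m_le_exp.trans ?_
    gcongr
  · have h8e : (8 : ℝ) ≤ Real.exp 3 := by
      have h1 := Real.exp_one_gt_d9
      have h2 : Real.exp 3 = Real.exp 1 * Real.exp 1 * Real.exp 1 := by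
        rw [← Real.exp_add, ← Real.exp_add]; norm_num
      rw [h2]
      have h3 : (2.7 : ℝ) * 2.7 ≤ Real.exp 1 * Real.exp 1 := by nlinarith
      nlinarith
    have h2e : (2 : ℝ) ≤ Real.exp 1 := by linarith [Real.exp_one_gt_d9]
    have h3 : Real.exp (-(2 * ℓ + 3)) ≤ Real.exp (-(2 * ℓ)) / 8 := by
      rw [neg_add, Real.exp_add, Real.exp_neg 3, div_eq_mul_inv]
      gcongr
    have h4 : (2 : ℝ) ^ (m * Fintype.card W) ≤ Real.exp (m * h) := by
      have := pow_le_pow_left₀ (by norm_num) h2e (m * Fintype.card W)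
      rw [← Real.exp_nat_mul, mul_one] at this
      push_cast at this
      rwa [hWh] at this
    rw [le_div_iff₀ (by positivity)]
    calc Real.exp (-(3 * (m + 2) * ℓ)) * 2 ^ (m * Fintype.card W)
        ≤ Real.exp (-(3 * (m + 2) * ℓ)) * Real.exp (m * h) := by gcongr
      _ ≤ Real.exp (-(2 * ℓ + 3)) ^ (m + 2) := by
        rw [← Real.exp_add, ← Real.exp_nat_mul]
        refine Real.exp_le_exp.2 ?_
        push_cast
        have h5 : 3 + h ≤ ℓ := by nlinarith [hs.ell_ge]
        have h6 : (0 : ℝ) ≤ m := Nat.cast_nonneg _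
        nlinarith
      _ ≤ _ := by gcongr
  · refine le_trans ?_ hD
    calc Real.exp (-(2 * ℓ)) * 4 ^ n ≤ Real.exp (-(2 * ℓ)) * Real.exp (ℓ / (8 * h)) := by gcongr
      _ ≤ _ := by
        rw [← Real.exp_add]
        refine Real.exp_le_exp.2 ?_
        have e : ℓ / (8 * h) = 1 / (8 * h) * ℓ := by ring
        rw [e]
        nlinarith
  · have := hs.path_le
    have e : h - 1 = n := by linarith
    rw [e] at this
    linarith
  · have h3 : ∑ i, ∑ j ∈ Finset.univ.erase i, -Real.log (Real.exp (-a i j)) =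
        ∑ i, ∑ j ∈ Finset.univ.erase i, a i j := by
      simp [Real.log_exp]
    rw [h3]
    have h4 := Finset.sum_le_sum fun o (_ : o ∈ Finset.univ) => hstar o
    rw [Finset.sum_const, nsmul_eq_mul, Finset.card_univ, hW] at h4
    push_cast at h4
    exact h4
  · refine hs.tau_le_m.trans ?_
    have h3 : (m : ℝ) ≤ Real.exp f := by
      refine hs.m_le_exp.trans ?_
      calc Real.exp (-(2 * ℓ)) / 8 * Real.exp (s / 2) ≤ 1 * Real.exp f := by
            gcongr
            rw [div_le_one (by norm_num)]
            exact (Real.exp_le_one_iff.2 (by linarith)).trans (by norm_num)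
        _ = _ := one_mul _
    exact (mul_le_of_le_one_left (Nat.cast_nonneg _)
      (Real.exp_le_one_iff.2 (by linarith))).trans h3
  · refine hs.tau_le_m.trans (mul_le_mul_of_nonneg_right ?_ (Nat.cast_nonneg _))
    rw [le_div_iff₀ (by positivity)]
    -- The surplus `1 / (4 * h)` of the path pays for `4 ^ n`, at most `1 / (8 * h)` in the
    -- exponent, and for the density lost so far, at most `1 / (32 * h ^ 2)`.
    calc Real.exp (-(ℓ / 2)) * 4 ^ n ≤ Real.exp (-(ℓ / 2)) * Real.exp (ℓ / (8 * h)) := by gcongr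
      _ ≤ Real.exp (-((1 + 1 / (32 * h ^ 2)) * ℓ)) * Real.exp ((1 / 2 + 1 / (4 * h)) * ℓ) := by
        rw [← Real.exp_add, ← Real.exp_add]
        refine Real.exp_le_exp.2 ?_
        have e : ℓ / (8 * h) = 1 / (8 * h) * ℓ := by ring
        have e' : 1 / (4 * h) = 2 * (1 / (8 * h)) := by field_simp; norm_num
        rw [e, e']
        nlinarith
      _ ≤ _ := by gcongr

set_option maxHeartbeats 1000000 in
/-- The basic step: a blowup, or a much denser subbox, or a system in which a pair is much
sparser. -/
theorem step_alternative {E : W → W → V → V → Prop} (hE : ∀ i j x y, E i j x y → E j i y x)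
    {h ℓ s ε σ τ : ℝ} {t m : ℕ} (hs : Scale h ℓ s ε σ τ t m) {n : ℕ}
    (hW : Fintype.card W = n + 1) (hn : h = n + 1) {d : ℝ}
    (hIH : ∀ (o : W) (E : W → W → V → V → Prop) (A : W → Finset V),
      (∀ i j x y, E i j x y → E j i y x) → (∀ i, Real.exp (s / 2) ≤ ((A i).card : ℝ)) →
      d ≤ dens (W := {k // k ≠ o}) (fun k l => E k l) (fun k => A k) →
      HasBlowup (W := {k // k ≠ o}) (fun k l => E k l) (fun k => A k) τ)
    {A : W → Finset V} {a : W → W → ℝ} (ha : ∀ i j, 0 ≤ a i j) {f x : ℝ} (hf : s / 2 ≤ f)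
    (hx : f + σ ≤ x) (hxε : f + ε * s ≤ x)
    (hreg : UpperRegular E A (fun i j => Real.exp (-a i j)) (Real.exp f))
    (hsize : ∀ i, Real.exp x ≤ ((A i).card : ℝ))
    (hD : Real.exp (-((1 + 1 / (32 * h ^ 2)) * ℓ)) ≤ dens E A) (hd : d ≤ dens E A / 2) :
    HasBlowup E A τ ∨
    (∃ A' : W → Finset V, (∀ i, A' i ⊆ A i) ∧
      dens E A * Real.exp (1 / (16 * h ^ 2) * ℓ) / (8 * h) ≤ dens E A' ∧
      ∀ i, Real.exp f ≤ ((A' i).card : ℝ)) ∨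
    ∃ (E' : W → W → V → V → Prop) (A' : W → Finset V) (a' : W → W → ℝ),
      (∀ k l x y, E' k l x y → E k l x y) ∧ (∀ k l x y, E' k l x y → E' l k y x) ∧
      (∀ i, A' i ⊆ A i) ∧ dens E A / (8 * h) ≤ dens E' A' ∧
      (∀ i, Real.exp (x - ε * s) ≤ ((A' i).card : ℝ)) ∧
      UpperRegular E' A' (fun i j => Real.exp (-a' i j)) (Real.exp f) ∧ (∀ i j, 0 ≤ a' i j) ∧
      ∑ i, ∑ j ∈ Finset.univ.erase i, a' i j =
        ∑ i, ∑ j ∈ Finset.univ.erase i, a i j + 1 / (16 * h ^ 2) * ℓ := by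
  by_cases hsparse : ∀ o j₀, j₀ ≠ o →
      (1 / 2 - 1 / (8 * h)) * ℓ < ∑ j ∈ (Finset.univ.erase o).erase j₀, a o j
  · exact Or.inl (hasBlowup_of_sparse_stars hE hs hW hn ha hf hx hreg hsize hD hsparse)
  push Not at hsparse
  obtain ⟨o, j₀, hj₀, hstar⟩ := hsparse
  have hℓ := hs.ell_pos
  have h2 := hs.two_le
  have h0 : 0 < h := by linarith
  have hε := hs.eps_pos
  have hℓ64 : 64 ≤ ℓ := by nlinarith [hs.ell_ge]
  have hεs : 0 < ε * s := by nlinarith [hs.s_ge]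
  have hWh : (Fintype.card W : ℝ) = h := by rw [hW, hn]; push_cast; ring
  have hη : 1 / (16 * h ^ 2) ≤ 1 / 64 := by
    rw [div_le_div_iff₀ (by positivity) (by positivity)]
    nlinarith
  have hη0 : 0 < 1 / (16 * h ^ 2) := by positivity
  have hD32 : Real.exp (-(3 / 2 * ℓ)) ≤ dens E A := by
    refine le_trans (Real.exp_le_exp.2 ?_) hD
    have : 1 / (32 * h ^ 2) ≤ 1 / 2 := by
      rw [div_le_div_iff₀ (by positivity) (by positivity)]
      nlinarith
    nlinarith
  have hdpos : 0 < dens E A := lt_of_lt_of_le (Real.exp_pos _) hD32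
  have hne := nonempty_of_dens_pos hdpos
  have hsf : s / 2 ≤ x := by linarith
  -- With this `K`, a factor `K ^ 2` for each of at most `h` indices costs `ℓ / (8 * h)` in the
  -- exponent, exactly the gap between the bound on the star sum and `ℓ / 2`.
  set K := Real.exp (1 / (16 * h ^ 2) * ℓ) with hK
  have hK2 : K ^ 2 = Real.exp (2 * (1 / (16 * h ^ 2)) * ℓ) := by
    rw [hK, ← Real.exp_nat_mul]; congr 1; push_cast; ring
  have hqK : ∀ i, Real.exp (-a o i) / K ^ 2 =
      Real.exp (-(a o i + 2 * (1 / (16 * h ^ 2)) * ℓ)) := by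
    intro i
    rw [hK2, ← Real.exp_sub]; congr 1; ring
  have hprod : Real.exp (-(ℓ / 2)) ≤
      ∏ i ∈ (Finset.univ.erase o).erase j₀, Real.exp (-a o i) / K ^ 2 := by
    rw [Finset.prod_congr rfl fun i _ => hqK i, ← Real.exp_sum]
    refine Real.exp_le_exp.2 ?_
    rw [Finset.sum_neg_distrib, Finset.sum_add_distrib, Finset.sum_const, nsmul_eq_mul]
    have hc : ((((Finset.univ.erase o).erase j₀).card : ℕ) : ℝ) ≤ h := by
      rw [← hWh]; exact Nat.cast_le.2 (Finset.card_le_univ _)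
    have h3 : ((((Finset.univ.erase o).erase j₀).card : ℕ) : ℝ) * (2 * (1 / (16 * h ^ 2)) * ℓ) ≤
        h * (2 * (1 / (16 * h ^ 2)) * ℓ) := mul_le_mul_of_nonneg_right hc (by positivity)
    have e : h * (2 * (1 / (16 * h ^ 2)) * ℓ) = 1 / (8 * h) * ℓ := by field_simp; norm_num
    rw [e] at h3
    linarith
  have hexpx : ∀ i, Real.exp f ≤ ((A i).card : ℝ) := fun i =>
    (Real.exp_le_exp.2 (by linarith)).trans (hsize i)
  -- The omitted pair is controlled only by the density of the copies. It enters `L`, which may be a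
  -- multiple of `ℓ`, but not `ρ`.
  have haj₀ : a o j₀ ≤ 3 / 2 * ℓ := by
    have := hD32.trans (dens_le_of_upperRegular hreg hne hexpx hj₀.symm)
    rw [Real.exp_le_exp] at this
    linarith
  have hprodL : Real.exp (-(3 * ℓ)) ≤
      ∏ i ∈ Finset.univ.erase o, Real.exp (-a o i) / K ^ 2 := by
    rw [← Finset.mul_prod_erase _ _ (Finset.mem_erase.2 ⟨hj₀, Finset.mem_univ _⟩), hqK j₀]
    refine le_trans ?_ (mul_le_mul_of_nonneg_left hprod (Real.exp_pos _).le)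
    rw [← Real.exp_add]
    refine Real.exp_le_exp.2 ?_
    nlinarith
  have hlog : Real.log (2 / dens E A) ≤ 2 * ℓ := by
    rw [Real.log_div two_ne_zero hdpos.ne']
    have h3 := Real.log_le_log (Real.exp_pos _) hD32
    rw [Real.log_exp] at h3
    have h4 : Real.log 2 ≤ 1 := by linarith [Real.log_two_lt_d9]
    linarith
  have hlam0 : 0 < 16 * ℓ / (ε * s) := by positivity
  have hlam1 : 16 * ℓ / (ε * s) < 1 := by
    rw [div_lt_one hεs]
    nlinarith [hs.s_ge]
  have hD4 : Real.exp (-(2 * ℓ)) ≤ dens E A / (4 * h) := by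
    rw [le_div_iff₀ (by positivity)]
    refine le_trans ?_ hD32
    have h3 : 4 * h ≤ Real.exp (ℓ / 2) := by
      have := Real.add_one_le_exp (ℓ / 2)
      nlinarith [hs.ell_ge]
    calc Real.exp (-(2 * ℓ)) * (4 * h) ≤ Real.exp (-(2 * ℓ)) * Real.exp (ℓ / 2) := by gcongr
      _ = Real.exp (-(3 / 2 * ℓ)) := by rw [← Real.exp_add]; congr 1; ring
  have hszeq : Real.exp (x - ε * s) ≤ Real.exp (x - ε * s / 2) * (dens E A / (4 * h)) := by
    refine le_trans ?_ (mul_le_mul_of_nonneg_left hD4 (Real.exp_pos _).le)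
    rw [← Real.exp_add]
    refine Real.exp_le_exp.2 ?_
    nlinarith [hs.s_ge]
  have htA : (t : ℝ) ≤ dens E A / 4 * (A o).card := by
    refine hs.t_le_exp.trans (mul_le_mul ?_ ((Real.exp_le_exp.2 hsf).trans (hsize o))
      (Real.exp_pos _).le (by positivity))
    have : dens E A / (4 * h) ≤ dens E A / 4 := by
      rw [div_le_div_iff_of_pos_left hdpos (by positivity) (by norm_num)]
      linarith
    have := Real.exp_pos (-(2 * ℓ))
    linarith
  rcases star_alternative hE hj₀ hdpos hlam0 hlam1 (L := 3 * ℓ) (by positivity)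
      (by
        rw [div_mul_eq_mul_div, div_le_one hεs]
        nlinarith [hs.s_ge]) (Real.exp_pos (-(ℓ / 2)))
      (κ := h * (16 * ℓ / (ε * s) * (1 + 2 * (3 * ℓ)) / Real.exp (-(ℓ / 2))))
      (by rw [hWh]) hs.loss_lt (K := K) (Real.exp_pos _)
      (q := fun i j => Real.exp (-a i j)) (fun _ _ => Real.exp_pos _) hprod hprodL hs.loss_le hreg
      (Δ := ε * s / 2) (by
        have h3 : Real.log (2 / dens E A) / (16 * ℓ / (ε * s)) ≤ 2 * ℓ / (16 * ℓ / (ε * s)) :=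
          div_le_div_of_nonneg_right hlog hlam0.le
        have e : 2 * ℓ / (16 * ℓ / (ε * s)) = ε * s / 8 := by
          field_simp; ring
        rw [e] at h3
        linarith [hs.t_le]) htA hsize with
    ⟨S, A', hSt, hSA, hsub, ho, hcomp, hdens, hsz⟩ | ⟨A', hsub, hdens, hsz⟩ |
    ⟨j, E', A', hj, hE'E, hE's, hsub, hdens, hsz, hreg'⟩
  · left
    have hd' : 0 < dens E A' := by linarith
    have hb := hIH o E A' hE (fun i => le_trans (Real.exp_le_exp.2 (by linarith)) (hsz i))
      ((hd.trans hdens).trans (dens_le_dens_subtype o (nonempty_of_dens_pos hd')))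
    exact (hb.extend hE (S := S) (by rw [ho]; exact hSA) (by rw [hSt]; exact hs.tau_le_t)
      hcomp).mono (fun _ _ _ _ h => h) hsub le_rfl
  · right; left
    rw [hWh] at hdens hsz
    refine ⟨A', hsub, hdens, fun i => le_trans (le_min le_rfl ?_) (hsz i)⟩
    exact (Real.exp_le_exp.2 (by linarith)).trans hszeq
  · right; right
    rw [hWh] at hdens hsz
    refine ⟨E', A', fun k l => if k = o ∧ l = j then a k l + 1 / (16 * h ^ 2) * ℓ else a k l,
      hE'E, hE's, hsub, hdens, fun i => hszeq.trans (hsz i), ?_, ?_, ?_⟩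
    · have e : (fun k l => Real.exp (-(if k = o ∧ l = j then a k l + 1 / (16 * h ^ 2) * ℓ
          else a k l))) = fun k l => if k = o ∧ l = j then Real.exp (-a k l) / K
          else Real.exp (-a k l) := by
        funext k l
        by_cases hkl : k = o ∧ l = j
        · rw [if_pos hkl, if_pos hkl, hK, ← Real.exp_sub]; congr 1; ring
        · rw [if_neg hkl, if_neg hkl]
      rw [e]
      convert hreg'
    · intro k l
      dsimp only
      split_ifs
      · have := ha k l; positivity
      · exact ha k l
    · have h3 : ∀ k l, (if k = o ∧ l = j then a k l + 1 / (16 * h ^ 2) * ℓ else a k l) =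
          a k l + if k = o then (if l = j then 1 / (16 * h ^ 2) * ℓ else 0) else 0 := by
        intro k l
        by_cases h1 : k = o <;> by_cases h2 : l = j <;> simp [h1, h2]
      simp only [h3, Finset.sum_add_distrib]
      congr 1
      rw [Finset.sum_eq_single o]
      · simp [hj]
      · intro k _ hk
        simp [hk]
      · simp

end Steps

/-! ### Iteration of the basic step -/

section Iteration

variable {W V : Type*} [Fintype W] [DecidableEq W] [DecidableEq V]

theorem Scale.sigma_nonneg {h ℓ s ε σ τ : ℝ} {t m : ℕ} (hs : Scale h ℓ s ε σ τ t m) : 0 ≤ σ := by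
  refine le_trans ?_ hs.path_le
  have h1 := hs.ell_pos
  have h2 : 0 ≤ h - 1 := by linarith [hs.two_le]
  positivity

/-- Iterating the basic step at a fixed lower bound `exp f` of the sizes gives a blowup or a much
denser subsystem. -/
theorem hasBlowup_or_exists_denser {E : W → W → V → V → Prop}
    (hE : ∀ i j x y, E i j x y → E j i y x)
    {h ℓ s ε σ τ : ℝ} {t m : ℕ} (hs : Scale h ℓ s ε σ τ t m) {n : ℕ}
    (hW : Fintype.card W = n + 1) (hn : h = n + 1) {d : ℝ}
    (hIH : ∀ (o : W) (E : W → W → V → V → Prop) (A : W → Finset V),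
      (∀ i j x y, E i j x y → E j i y x) → (∀ i, Real.exp (s / 2) ≤ ((A i).card : ℝ)) →
      d ≤ dens (W := {k // k ≠ o}) (fun k l => E k l) (fun k => A k) →
      HasBlowup (W := {k // k ≠ o}) (fun k l => E k l) (fun k => A k) τ)
    {R : ℕ} (hR : 24 * h ^ 4 < R) (hpow : (8 * h) ^ R ≤ Real.exp (1 / (32 * h ^ 2) * ℓ))
    {A : W → Finset V} {f x : ℝ} (hf : s / 2 ≤ f) (hx : f + σ + R * (ε * s) ≤ x)
    (hsize : ∀ i, Real.exp x ≤ ((A i).card : ℝ)) {D : ℝ} (hD : Real.exp (-ℓ) ≤ D)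
    (hDA : D ≤ dens E A) (hd : d ≤ D / (8 * h) ^ R / 2) :
    HasBlowup E A τ ∨
    ∃ (E' : W → W → V → V → Prop) (A' : W → Finset V),
      (∀ k l x y, E' k l x y → E k l x y) ∧ (∀ k l x y, E' k l x y → E' l k y x) ∧
      (∀ i, A' i ⊆ A i) ∧ D * Real.exp (1 / (32 * h ^ 2) * ℓ) ≤ dens E' A' ∧
      ∀ i, Real.exp f ≤ ((A' i).card : ℝ) := by
  have hℓ := hs.ell_pos
  have h2 := hs.two_le
  have h0 : 0 < h := by linarith
  have hε := hs.eps_pos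
  have hεs : 0 < ε * s := by nlinarith [hs.s_ge, hs.ell_pos]
  have hσ := hs.sigma_nonneg
  have hD0 : 0 < D := (Real.exp_pos _).trans_le hD
  have h8 : 1 ≤ 8 * h := by linarith
  have hlow : ∀ k ≤ R, Real.exp (-((1 + 1 / (32 * h ^ 2)) * ℓ)) ≤ D / (8 * h) ^ k := by
    intro k hk
    rw [le_div_iff₀ (by positivity)]
    calc Real.exp (-((1 + 1 / (32 * h ^ 2)) * ℓ)) * (8 * h) ^ k
        ≤ Real.exp (-((1 + 1 / (32 * h ^ 2)) * ℓ)) * Real.exp (1 / (32 * h ^ 2) * ℓ) := by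
          refine mul_le_mul_of_nonneg_left ?_ (Real.exp_pos _).le
          exact (pow_le_pow_right₀ h8 hk).trans hpow
      _ = Real.exp (-ℓ) := by rw [← Real.exp_add]; congr 1; ring
      _ ≤ D := hD
  have key : ∀ k ≤ R, (HasBlowup E A τ ∨
      ∃ (E' : W → W → V → V → Prop) (A' : W → Finset V),
        (∀ k l x y, E' k l x y → E k l x y) ∧ (∀ k l x y, E' k l x y → E' l k y x) ∧
        (∀ i, A' i ⊆ A i) ∧ D * Real.exp (1 / (32 * h ^ 2) * ℓ) ≤ dens E' A' ∧
        ∀ i, Real.exp f ≤ ((A' i).card : ℝ)) ∨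
      ∃ (E' : W → W → V → V → Prop) (A' : W → Finset V) (a : W → W → ℝ),
        (∀ k l x y, E' k l x y → E k l x y) ∧ (∀ k l x y, E' k l x y → E' l k y x) ∧
        (∀ i, A' i ⊆ A i) ∧ D / (8 * h) ^ k ≤ dens E' A' ∧
        (∀ i, Real.exp (x - k * (ε * s)) ≤ ((A' i).card : ℝ)) ∧
        UpperRegular E' A' (fun i j => Real.exp (-a i j)) (Real.exp f) ∧ (∀ i j, 0 ≤ a i j) ∧
        ∑ i, ∑ j ∈ Finset.univ.erase i, a i j = k * (1 / (16 * h ^ 2) * ℓ) := by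
    intro k
    induction k with
    | zero =>
      intro _
      right
      refine ⟨E, A, fun _ _ => 0, fun _ _ _ _ h => h, hE, fun _ => subset_rfl, by simpa using hDA,
        by simpa using hsize, ?_, fun _ _ => le_rfl, by simp⟩
      intro i j _ X _ Y _ _ _
      dsimp only
      rw [neg_zero, Real.exp_zero, one_mul, edgeCount]
      have := Finset.card_filter_le (X ×ˢ Y) fun p => E i j p.1 p.2
      rw [Finset.card_product] at this
      exact_mod_cast this
    | succ k ih =>
      intro hk
      have hkR : (k : ℝ) + 1 ≤ R := by exact_mod_cast hk
      rcases ih (by omega) with h1 | ⟨E', A', a, hE'E, hE's, hsub, hdens, hsz, hreg, ha, hsum⟩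
      · exact Or.inl h1
      have hk1 : f + σ + (ε * s) ≤ x - k * (ε * s) := by nlinarith
      have hdR : d ≤ dens E' A' / 2 := by
        have : D / (8 * h) ^ R ≤ D / (8 * h) ^ k :=
          div_le_div_of_nonneg_left hD0.le (by positivity) (pow_le_pow_right₀ h8 (by omega))
        linarith
      rcases step_alternative hE's hs hW hn hIH ha hf (by linarith) (by linarith) hreg hsz
        ((hlow k (by omega)).trans hdens) hdR with h1 | ⟨A'', hsub', hdens', hsz'⟩ |
        ⟨E'', A'', a', hE'', hE''s, hsub', hdens', hsz', hreg', ha', hsum'⟩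
      · exact Or.inl (Or.inl (h1.mono hE'E hsub le_rfl))
      · refine Or.inl (Or.inr ⟨E', A'', hE'E, hE's, fun i => (hsub' i).trans (hsub i), ?_, hsz'⟩)
        refine le_trans ?_ hdens'
        -- One half of the exponent of the gain compensates the factors `8 * h` lost in the
        -- sparsifying steps, the other half is kept.
        have e : Real.exp (1 / (16 * h ^ 2) * ℓ) =
            Real.exp (1 / (32 * h ^ 2) * ℓ) * Real.exp (1 / (32 * h ^ 2) * ℓ) := by
          rw [← Real.exp_add]; congr 1; field_simp; norm_num
        have h3 : 1 ≤ Real.exp (1 / (32 * h ^ 2) * ℓ) / (8 * h) ^ (k + 1) := by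
          rw [one_le_div (by positivity)]
          exact (pow_le_pow_right₀ h8 hk).trans hpow
        calc D * Real.exp (1 / (32 * h ^ 2) * ℓ)
            ≤ D * Real.exp (1 / (32 * h ^ 2) * ℓ) *
              (Real.exp (1 / (32 * h ^ 2) * ℓ) / (8 * h) ^ (k + 1)) :=
              le_mul_of_one_le_right (by positivity) h3
          _ = D / (8 * h) ^ k * Real.exp (1 / (16 * h ^ 2) * ℓ) / (8 * h) := by
              rw [e]; field_simp; ring
          _ ≤ _ := by gcongr
      · refine Or.inr ⟨E'', A'', a', fun k l x y h => hE'E _ _ _ _ (hE'' _ _ _ _ h), hE''s,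
          fun i => (hsub' i).trans (hsub i), ?_, fun i => ?_, hreg', ha', ?_⟩
        · refine le_trans ?_ hdens'
          rw [pow_succ, ← div_div]
          gcongr
        · refine le_trans (Real.exp_le_exp.2 ?_) (hsz' i)
          push_cast
          linarith
        · rw [hsum', hsum]; push_cast; ring
  rcases key R le_rfl with h1 | ⟨E', A', a, hE'E, hE's, hsub, hdens, hsz, hreg, ha, hsum⟩
  · exact h1
  -- Each of the `R` steps has added `ℓ / (16 * h ^ 2)` to the sum of the exponents `a`, while each
  -- `a i j` is at most `3 / 2 * ℓ`; hence the condition `24 * h ^ 4 < R`.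
  exfalso
  have hdpos : Real.exp (-(3 / 2 * ℓ)) ≤ dens E' A' := by
    refine le_trans (Real.exp_le_exp.2 ?_) ((hlow R le_rfl).trans hdens)
    have : 1 / (32 * h ^ 2) ≤ 1 / 2 := by
      rw [div_le_div_iff₀ (by positivity) (by positivity)]
      nlinarith
    nlinarith
  have hne := nonempty_of_dens_pos ((Real.exp_pos _).trans_le hdpos)
  have hsf : ∀ i, Real.exp f ≤ ((A' i).card : ℝ) := fun i =>
    (Real.exp_le_exp.2 (by linarith)).trans (hsz i)
  have haij : ∀ i, ∀ j ∈ Finset.univ.erase i, a i j ≤ 3 / 2 * ℓ := by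
    intro i j hj
    have := hdpos.trans (dens_le_of_upperRegular hreg hne hsf (Finset.ne_of_mem_erase hj).symm)
    rw [Real.exp_le_exp] at this
    linarith
  have hWh : (Fintype.card W : ℝ) = h := by rw [hW, hn]; push_cast; ring
  have h3 : ∑ i, ∑ j ∈ Finset.univ.erase i, a i j ≤ h * (h * (3 / 2 * ℓ)) := by
    have h4 : ∀ i ∈ Finset.univ, ∑ j ∈ Finset.univ.erase i, a i j ≤ h * (3 / 2 * ℓ) := by
      intro i _
      refine (Finset.sum_le_card_nsmul _ _ _ (haij i)).trans ?_
      rw [nsmul_eq_mul]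
      refine mul_le_mul_of_nonneg_right ?_ (by positivity)
      rw [← hWh]
      exact Nat.cast_le.2 (Finset.card_le_univ _)
    refine (Finset.sum_le_card_nsmul _ _ _ h4).trans ?_
    rw [nsmul_eq_mul, Finset.card_univ, hWh]
  rw [hsum] at h3
  have h4 : 24 * h ^ 4 * (1 / (16 * h ^ 2) * ℓ) < R * (1 / (16 * h ^ 2) * ℓ) :=
    mul_lt_mul_of_pos_right hR (by positivity)
  have e : 24 * h ^ 4 * (1 / (16 * h ^ 2) * ℓ) = h * (h * (3 / 2 * ℓ)) := by
    field_simp; norm_num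
  linarith

/-- A round without a blowup multiplies the density by `exp (ℓ / (32 * h ^ 2))` and costs a factor
`exp (-(α * s))` of size. More than `32 * h ^ 2` rounds would push the density above `1`, and `N * α
≤ 1 / 2` keeps the sizes above `exp (s / 2)` until then. -/
theorem hasBlowup_of_scale {E : W → W → V → V → Prop}
    (hE : ∀ i j x y, E i j x y → E j i y x)
    {h ℓ s ε σ τ : ℝ} {t m : ℕ} (hs : Scale h ℓ s ε σ τ t m) {n : ℕ}
    (hW : Fintype.card W = n + 1) (hn : h = n + 1) {d : ℝ}
    (hIH : ∀ (o : W) (E : W → W → V → V → Prop) (A : W → Finset V),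
      (∀ i j x y, E i j x y → E j i y x) → (∀ i, Real.exp (s / 2) ≤ ((A i).card : ℝ)) →
      d ≤ dens (W := {k // k ≠ o}) (fun k l => E k l) (fun k => A k) →
      HasBlowup (W := {k // k ≠ o}) (fun k l => E k l) (fun k => A k) τ)
    {R : ℕ} (hR : 24 * h ^ 4 < R) (hpow : (8 * h) ^ R ≤ Real.exp (1 / (32 * h ^ 2) * ℓ))
    {N : ℕ} (hN : 32 * h ^ 2 < N) {α : ℝ} (hα0 : 0 ≤ α) (hα : N * α ≤ 1 / 2)
    (hασ : σ + R * (ε * s) ≤ α * s)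
    {A : W → Finset V} (hsize : ∀ i, Real.exp s ≤ ((A i).card : ℝ))
    (hD : Real.exp (-ℓ) ≤ dens E A) (hd : d ≤ Real.exp (-ℓ) / (8 * h) ^ R / 2) :
    HasBlowup E A τ := by
  have hℓ := hs.ell_pos
  have h2 := hs.two_le
  have h0 : 0 < h := by linarith
  have hs0 : 0 < s := by
    have := hs.s_ge
    have hε := hs.eps_pos
    have h3 : 0 < ε * s := by nlinarith
    exact (pos_iff_pos_of_mul_pos h3).1 hε
  have key : ∀ k ≤ N, HasBlowup E A τ ∨
      ∃ (E' : W → W → V → V → Prop) (A' : W → Finset V),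
        (∀ k l x y, E' k l x y → E k l x y) ∧ (∀ k l x y, E' k l x y → E' l k y x) ∧
        (∀ i, A' i ⊆ A i) ∧ Real.exp (-ℓ + k * (1 / (32 * h ^ 2) * ℓ)) ≤ dens E' A' ∧
        ∀ i, Real.exp (s - k * (α * s)) ≤ ((A' i).card : ℝ) := by
    intro k
    induction k with
    | zero =>
      intro _
      exact Or.inr ⟨E, A, fun _ _ _ _ h => h, hE, fun _ => subset_rfl, by simpa using hD,
        by simpa using hsize⟩
    | succ k ih =>
      intro hk
      have hkN : (k : ℝ) + 1 ≤ N := by exact_mod_cast hk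
      rcases ih (by omega) with h1 | ⟨E', A', hE'E, hE's, hsub, hdens, hsz⟩
      · exact Or.inl h1
      have hle : Real.exp (-ℓ) ≤ Real.exp (-ℓ + k * (1 / (32 * h ^ 2) * ℓ)) :=
        Real.exp_le_exp.2 (by
          have : 0 ≤ k * (1 / (32 * h ^ 2) * ℓ) := by positivity
          linarith)
      have hfs : s / 2 ≤ s - (k + 1) * (α * s) := by
        have : ((k : ℝ) + 1) * (α * s) ≤ N * (α * s) :=
          mul_le_mul_of_nonneg_right hkN (by positivity)
        nlinarith
      rcases hasBlowup_or_exists_denser hE's hs hW hn hIH hR hpow hfs (by linarith) hsz hle hdens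
        (hd.trans (by gcongr)) with h1 | ⟨E'', A'', hE'', hE''s, hsub', hdens', hsz'⟩
      · exact Or.inl (h1.mono hE'E hsub le_rfl)
      · refine Or.inr ⟨E'', A'', fun k l x y h => hE'E _ _ _ _ (hE'' _ _ _ _ h), hE''s,
          fun i => (hsub' i).trans (hsub i), ?_, by exact_mod_cast hsz'⟩
        refine le_trans (le_of_eq ?_) hdens'
        rw [← Real.exp_add]; congr 1; push_cast; ring
  rcases key N le_rfl with h1 | ⟨E', A', -, -, -, hdens, -⟩
  · exact h1
  exfalso
  have h3 := hdens.trans (dens_le_one E' A')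
  rw [Real.exp_le_one_iff] at h3
  have h4 : 32 * h ^ 2 * (1 / (32 * h ^ 2) * ℓ) < N * (1 / (32 * h ^ 2) * ℓ) :=
    mul_lt_mul_of_pos_right hN (by positivity)
  have e : 32 * h ^ 2 * (1 / (32 * h ^ 2) * ℓ) = ℓ := by field_simp
  linarith

end Iteration

/-! ### Choice of constants and induction on the number of indices -/

section Bound

/-- Take `t = ⌈τ⌉` and `m` of order `α * s / (h * ℓ)`, so that a path costs at most a factor `exp
(-(α / 2 * s))` of size. The star process is the bottleneck: `lam` and `L` each contribute a factor
`ℓ` to its loss, whence the `ℓ ^ 2` in the denominator of the bound. -/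
theorem exists_scale {h ℓ ε α δ : ℝ} (h2 : 2 ≤ h) (hℓ : 16 * h ^ 2 ≤ ℓ) (hε : 0 < ε) (hε1 : ε ≤ 1)
    (hα : 0 < α) (hα1 : α ≤ 1) (hδ : 0 < δ) (hδε : δ ≤ ε / (448 * h)) (hδα : δ ≤ α / (48 * h)) :
    ∃ s₀ : ℝ, ∀ s, s₀ ≤ s → ∃ t m : ℕ,
      Scale h ℓ s ε (α / 2 * s) (δ * Real.exp (-(ℓ / 2)) / ℓ ^ 2 * s) t m := by
  have h0 : 0 < h := by linarith
  have hℓ64 : 64 ≤ ℓ := by nlinarith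
  have hℓ0 : 0 < ℓ := by linarith
  have hε448 : ε / (448 * h) ≤ ε / 448 := by
    rw [div_le_div_iff_of_pos_left hε (by positivity) (by norm_num)]; linarith
  have hexp1 : Real.exp (-(ℓ / 2)) ≤ 1 := Real.exp_le_one_iff.2 (by linarith)
  -- The four thresholds serve in turn `s_ge`, `m ≥ 1`, the conditions that `t` and `m` are small
  -- against `exp (s / 2)`, and `κ ≤ 1 / 4`.
  refine ⟨max (48 * ℓ ^ 2 / ε) (max (48 * h * ℓ / α) (max (64 * Real.exp (2 * ℓ))
    (64 * h * ℓ * (1 + 6 * ℓ) / (Real.exp (-(ℓ / 2)) * ε)))), fun s hs => ?_⟩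
  rw [max_le_iff, max_le_iff, max_le_iff, div_le_iff₀ hε, div_le_iff₀ hα,
    div_le_iff₀ (by positivity)] at hs
  obtain ⟨hs1, hs2, hs3, hs4⟩ := hs
  have hs64 : 64 ≤ s := by
    have := Real.one_le_exp (show 0 ≤ 2 * ℓ by linarith)
    linarith
  have hs0 : 0 < s := by linarith
  set τ := δ * Real.exp (-(ℓ / 2)) / ℓ ^ 2 * s with hτ
  have hτ0 : 0 ≤ τ := by positivity
  set μ := α / (24 * h) with hμ
  have hμ0 : 0 < μ := by positivity
  have hμℓ : 2 ≤ μ * s / ℓ := by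
    rw [le_div_iff₀ hℓ0, hμ, div_mul_eq_mul_div, le_div_iff₀ (by positivity)]
    linarith
  have hm1 : (⌊μ * s / ℓ⌋₊ : ℝ) ≤ μ * s / ℓ := Nat.floor_le (by positivity)
  have hm2 : μ * s / ℓ - 1 < ⌊μ * s / ℓ⌋₊ := Nat.sub_one_lt_floor _
  have ht : (⌈τ⌉₊ : ℝ) ≤ τ + 1 := (Nat.ceil_lt_add_one hτ0).le
  set m := ⌊μ * s / ℓ⌋₊
  have hm3 : (1 : ℝ) ≤ m := by linarith
  have hsq : s ≤ Real.exp (-(2 * ℓ)) / 8 * Real.exp (s / 2) := by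
    have h3 := Real.quadratic_le_exp_of_nonneg (show 0 ≤ s / 2 by linarith)
    have h4 : s ^ 2 / 8 ≤ Real.exp (s / 2) := by nlinarith
    have h5 : s * Real.exp (2 * ℓ) ≤ Real.exp (s / 2) / 8 := by nlinarith
    rw [Real.exp_neg, div_mul_eq_mul_div, inv_mul_eq_div, div_div, le_div_iff₀ (by positivity)]
    linarith
  have hτs : τ ≤ ε / 448 * s := by
    refine mul_le_mul_of_nonneg_right ?_ hs0.le
    rw [div_le_iff₀ (by positivity)]
    calc δ * Real.exp (-(ℓ / 2)) ≤ ε / 448 * 1 := by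
          refine mul_le_mul (hδε.trans hε448) hexp1 (Real.exp_pos _).le (by positivity)
      _ ≤ ε / 448 * ℓ ^ 2 := by gcongr; nlinarith
  have hτℓ : ℓ * τ ≤ ε / 448 * s := by
    have e : ℓ * τ = δ * Real.exp (-(ℓ / 2)) / ℓ * s := by rw [hτ]; field_simp
    rw [e]
    refine mul_le_mul_of_nonneg_right ?_ hs0.le
    rw [div_le_iff₀ hℓ0]
    calc δ * Real.exp (-(ℓ / 2)) ≤ ε / 448 * 1 := by
          refine mul_le_mul (hδε.trans hε448) hexp1 (Real.exp_pos _).le (by positivity)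
      _ ≤ ε / 448 * ℓ := by gcongr; linarith
  set κ := h * (16 * ℓ / (ε * s) * (1 + 2 * (3 * ℓ)) / Real.exp (-(ℓ / 2))) with hκ
  have hκ0 : 0 < κ := by positivity
  have hκ1 : κ ≤ 1 / 4 := by
    have e : κ = 16 * h * ℓ * (1 + 6 * ℓ) / (s * (Real.exp (-(ℓ / 2)) * ε)) := by
      rw [hκ]; field_simp; ring
    rw [e, div_le_iff₀ (by positivity)]
    linarith
  -- Here `s` and `exp (-(ℓ / 2))` cancel. The constant is `448 = 4 * 16 * 7`, where `1 + 6 * ℓ ≤ 7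
  -- * ℓ`.
  have hτκ : τ * κ ≤ 1 / 4 := by
    have e : τ * κ = δ * (448 * h) / ε * (16 * (1 + 6 * ℓ) / (448 * ℓ)) := by
      rw [hκ, hτ]; field_simp; ring
    rw [e]
    have h3 : δ * (448 * h) / ε ≤ 1 := by
      rw [div_le_one hε]
      rwa [le_div_iff₀ (by positivity)] at hδε
    have h4 : 16 * (1 + 6 * ℓ) / (448 * ℓ) ≤ 1 / 4 := by
      rw [div_le_iff₀ (by positivity)]; linarith
    calc δ * (448 * h) / ε * (16 * (1 + 6 * ℓ) / (448 * ℓ)) ≤ 1 * (1 / 4) :=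
          mul_le_mul h3 h4 (by positivity) zero_le_one
      _ = 1 / 4 := one_mul _
  refine ⟨⌈τ⌉₊, m, h2, hℓ, hε, by linarith, by exact_mod_cast hm3, Nat.le_ceil τ, ?_, ?_,
    by linarith, ?_, ?_, ?_, ?_⟩
  · have h3 : δ / ℓ ^ 2 * s ≤ m := by
      refine le_trans ?_ (show μ * s / ℓ / 2 ≤ m by linarith)
      have h4 : δ ≤ μ / 2 := by
        rw [hμ]; refine hδα.trans (le_of_eq ?_); field_simp; norm_num
      calc δ / ℓ ^ 2 * s ≤ (μ / 2) / ℓ * s := by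
            refine mul_le_mul_of_nonneg_right ?_ hs0.le
            refine div_le_div₀ (by positivity) h4 hℓ0 ?_
            nlinarith
        _ = _ := by ring
    calc τ = Real.exp (-(ℓ / 2)) * (δ / ℓ ^ 2 * s) := by rw [hτ]; ring
      _ ≤ _ := by gcongr
  · have := mul_le_mul_of_nonneg_right ht hκ0.le
    linarith
  · have h3 := mul_le_mul_of_nonneg_left ht (show 0 ≤ 3 * ℓ by linarith)
    have h4 : 64 * ℓ ≤ ℓ ^ 2 := by rw [sq]; exact mul_le_mul_of_nonneg_right hℓ64 hℓ0.le
    linarith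
  · refine le_trans ?_ hsq
    have h3 : ε / 448 * s ≤ 1 / 448 * s := by gcongr
    linarith
  · refine le_trans (hm1.trans ?_) hsq
    rw [div_le_iff₀ hℓ0, mul_comm]
    have : μ ≤ 1 := by
      rw [hμ, div_le_one (by positivity)]; linarith
    exact mul_le_mul_of_nonneg_left (by linarith) hs0.le
  · have h3 : (m : ℝ) * ℓ ≤ μ * s := by rwa [le_div_iff₀ hℓ0] at hm1
    calc (h - 1) * (3 * (m + 2) * ℓ) ≤ h * (3 * (3 * m) * ℓ) := by
          refine mul_le_mul (by linarith) ?_ (by positivity) h0.le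
          gcongr
          linarith
      _ = 9 * h * (m * ℓ) := by ring
      _ ≤ 9 * h * (μ * s) := by gcongr
      _ = 9 / 24 * (α * s) := by rw [hμ]; field_simp
      _ ≤ α / 2 * s := by nlinarith [mul_pos hα hs0]

universe u v

/-- The blowup bound with constant `δ` at density `exp (-ℓ)`, for systems on `n` indices with parts
of size at least `exp s`. -/
def BlowupBound (n : ℕ) (δ ℓ s : ℝ) : Prop :=
  ∀ (W : Type u) (V : Type v) [Fintype W] [DecidableEq W] [DecidableEq V], Fintype.card W = n →
    ∀ (E : W → W → V → V → Prop) (A : W → Finset V), (∀ i j x y, E i j x y → E j i y x) →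
      (∀ i, Real.exp s ≤ ((A i).card : ℝ)) → Real.exp (-ℓ) ≤ dens E A →
      HasBlowup E A (δ * Real.exp (-(ℓ / 2)) / ℓ ^ 2 * s)

/-- No two indices have to be joined, so the parts themselves serve. -/
theorem blowupBound_of_le_one {n : ℕ} (hn : n ≤ 1) :
    ∃ δ : ℝ, 0 < δ ∧ ∀ ℓ, Real.log 2 ≤ ℓ → ∃ s₀, ∀ s, s₀ ≤ s → BlowupBound.{u, v} n δ ℓ s := by
  refine ⟨1 / 4, by norm_num, fun ℓ hℓ => ⟨0, fun s hs W V _ _ _ hW E A _ hA _ => ?_⟩⟩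
  have hsub : Subsingleton W := Fintype.card_le_one_iff_subsingleton.1 (hW.trans_le hn)
  refine ⟨A, fun _ => subset_rfl, fun i => le_trans ?_ (hA i),
    fun i j hij => (hij (Subsingleton.elim _ _)).elim⟩
  have hℓ2 : 1 / 2 ≤ ℓ := by linarith [Real.log_two_gt_d9]
  have h1 : 1 / 4 * Real.exp (-(ℓ / 2)) / ℓ ^ 2 ≤ 1 := by
    rw [div_le_one (by positivity)]
    have : Real.exp (-(ℓ / 2)) ≤ 1 := Real.exp_le_one_iff.2 (by linarith)
    nlinarith
  calc 1 / 4 * Real.exp (-(ℓ / 2)) / ℓ ^ 2 * s ≤ 1 * s := by gcongr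
    _ ≤ Real.exp s := by linarith [Real.add_one_le_exp s]

/-- The numbers `R` of sparsifying steps and `N` of rounds depend only on `h`; they determine `α`
and `ε`, and these, with `δ₁`, determine `δ`. Large `ℓ` is needed so that the accumulated loss `(8 *
h) ^ R` is at most `exp (ℓ / (32 * h ^ 2))`. -/
theorem blowupBound_succ {n : ℕ} (hn1 : 1 ≤ n)
    (ih : ∃ δ : ℝ, 0 < δ ∧ ∀ ℓ, Real.log 2 ≤ ℓ → ∃ s₀, ∀ s, s₀ ≤ s → BlowupBound.{u, v} n δ ℓ s) :
    ∃ δ ℓ₀ : ℝ, 0 < δ ∧ 1 ≤ ℓ₀ ∧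
      ∀ ℓ, ℓ₀ ≤ ℓ → ∃ s₀, ∀ s, s₀ ≤ s → BlowupBound.{u, v} (n + 1) δ ℓ s := by
  obtain ⟨δ₁, hδ₁, ih⟩ := ih
  set h : ℝ := n + 1 with hh
  have h2 : 2 ≤ h := by
    have : (1 : ℝ) ≤ n := by exact_mod_cast hn1
    linarith
  have h0 : 0 < h := by linarith
  obtain ⟨R, hR⟩ := exists_nat_gt (24 * h ^ 4)
  obtain ⟨N, hN⟩ := exists_nat_gt (32 * h ^ 2)
  have hR1 : 1 ≤ (R : ℝ) := by
    have : (1 : ℝ) ≤ h ^ 4 := one_le_pow₀ (by linarith)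
    linarith
  have hN1 : 1 ≤ (N : ℝ) := by nlinarith
  set α : ℝ := 1 / (2 * N) with hα
  have hα0 : 0 < α := by positivity
  have hα1 : α ≤ 1 := by rw [hα, div_le_one (by positivity)]; linarith
  set ε : ℝ := α / (2 * R) with hε
  have hε0 : 0 < ε := by positivity
  have hε1 : ε ≤ 1 := by rw [hε, div_le_one (by positivity)]; linarith
  have h8 : 1 ≤ (8 * h) ^ R := one_le_pow₀ (by linarith)
  set L := Real.log (2 * (8 * h) ^ R) with hL
  have hL0 : 0 ≤ L := Real.log_nonneg (by linarith)
  have hexpL : Real.exp L = 2 * (8 * h) ^ R := Real.exp_log (by positivity)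
  -- The induction hypothesis is used at density `exp (-(ℓ + L))` and size `exp (s / 2)`. This costs
  -- `exp (-(L / 2))`, a factor `4` from `(ℓ + L) ^ 2 ≤ 4 * ℓ ^ 2` and a factor `2` from the size.
  set δ := min (δ₁ * Real.exp (-(L / 2)) / 8) (min (ε / (448 * h)) (α / (48 * h))) with hδ
  have hδ0 : 0 < δ := by positivity
  refine ⟨δ, max (16 * h ^ 2) (32 * h ^ 2 * L), hδ0,
    le_trans (by nlinarith) (le_max_left _ _), fun ℓ hℓ => ?_⟩
  rw [max_le_iff] at hℓ
  have hℓ64 : 64 ≤ ℓ := by nlinarith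
  have hLℓ : L ≤ 1 / (32 * h ^ 2) * ℓ := by
    rw [div_mul_eq_mul_div, one_mul, le_div_iff₀ (by positivity)]
    linarith
  have hLℓ' : L ≤ ℓ := by
    have h3 : 1 ≤ 32 * h ^ 2 := by nlinarith
    exact (le_mul_of_one_le_left hL0 h3).trans hℓ.2
  obtain ⟨s₁, hs₁⟩ := exists_scale h2 hℓ.1 hε0 hε1 hα0 hα1 hδ0
    ((min_le_right _ _).trans (min_le_left _ _)) ((min_le_right _ _).trans (min_le_right _ _))
  obtain ⟨s₂, hs₂⟩ := ih (ℓ + L) (by linarith [Real.log_two_lt_d9])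
  refine ⟨max (max 1 s₁) (2 * s₂), fun s hs W V _ _ _ hW E A hE hA hD => ?_⟩
  rw [max_le_iff, max_le_iff] at hs
  obtain ⟨⟨hs0, hs1⟩, hs2⟩ := hs
  obtain ⟨t, m, hsc⟩ := hs₁ s hs1
  refine hasBlowup_of_scale hE hsc hW hh (d := Real.exp (-(ℓ + L))) ?_ hR ?_ hN hα0.le ?_ ?_ hA hD
    ?_
  · intro o E A hE hA hd
    have hcard : Fintype.card {k // k ≠ o} = n := by
      rw [Fintype.card_subtype_compl, hW, Fintype.card_unique, Nat.add_sub_cancel]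
    refine (hs₂ (s / 2) (by linarith) {k // k ≠ o} V (by convert hcard) (fun k l => E k l)
      (fun k => A k) (fun i j => hE i j) (fun i => hA i) (by convert hd)).mono
      (fun _ _ _ _ h => h) (fun _ => subset_rfl) ?_
    have h3 : (ℓ + L) ^ 2 ≤ 4 * ℓ ^ 2 := by nlinarith
    have e : Real.exp (-((ℓ + L) / 2)) = Real.exp (-(ℓ / 2)) * Real.exp (-(L / 2)) := by
      rw [← Real.exp_add]; congr 1; ring
    calc δ * Real.exp (-(ℓ / 2)) / ℓ ^ 2 * s
        ≤ (δ₁ * Real.exp (-(L / 2)) / 8) * Real.exp (-(ℓ / 2)) / ℓ ^ 2 * s := by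
          gcongr
          exact min_le_left _ _
      _ = δ₁ * Real.exp (-((ℓ + L) / 2)) / (4 * ℓ ^ 2) * (s / 2) := by rw [e]; ring
      _ ≤ _ := by gcongr
  · rw [← Real.exp_log (show 0 < (8 * h) ^ R by positivity)]
    refine Real.exp_le_exp.2 (le_trans ?_ hLℓ)
    exact Real.log_le_log (by positivity) (by linarith)
  · rw [hα]; apply le_of_eq; field_simp
  · apply le_of_eq; rw [hε]; field_simp; ring
  · rw [neg_add, Real.exp_add, Real.exp_neg L, hexpL]
    apply le_of_eq; field_simp

theorem BlowupBound.mono {n : ℕ} {δ ℓ δ' ℓ' s : ℝ} (h : BlowupBound.{u, v} n δ ℓ s) (hℓ : ℓ' ≤ ℓ)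
    (hδ : δ' * Real.exp (-(ℓ' / 2)) / ℓ' ^ 2 * s ≤ δ * Real.exp (-(ℓ / 2)) / ℓ ^ 2 * s) :
    BlowupBound.{u, v} n δ' ℓ' s :=
  fun W V _ _ _ hW E A hE hA hD => (h W V hW E A hE hA
    ((Real.exp_le_exp.2 (by linarith)).trans hD)).mono (fun _ _ _ _ h => h) (fun _ => subset_rfl) hδ

/-- For `ℓ` below `ℓ₀` the bound at the smaller density `exp (-ℓ₀)` applies; as `ℓ` stays away from
`0`, a constant factor `c` makes up for the difference. -/
theorem exists_blowupBound (n : ℕ) :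
    ∃ δ : ℝ, 0 < δ ∧ ∀ ℓ, Real.log 2 ≤ ℓ → ∃ s₀, ∀ s, s₀ ≤ s → BlowupBound.{u, v} n δ ℓ s := by
  induction n with
  | zero => exact blowupBound_of_le_one zero_le_one
  | succ n ih =>
    rcases Nat.eq_zero_or_pos n with rfl | hn
    · exact blowupBound_of_le_one le_rfl
    obtain ⟨δ, ℓ₀, hδ, hℓ₀, hbound⟩ := blowupBound_succ hn ih
    set c := Real.exp (-(ℓ₀ / 2)) / ℓ₀ ^ 2 / 4 with hc
    have hc0 : 0 < c := by positivity
    have hc1 : c ≤ 1 := by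
      rw [hc, div_div, div_le_one (by positivity)]
      have : Real.exp (-(ℓ₀ / 2)) ≤ 1 := Real.exp_le_one_iff.2 (by linarith)
      nlinarith
    refine ⟨δ * c, by positivity, fun ℓ hℓ => ?_⟩
    have hℓ2 : 1 / 2 ≤ ℓ := by linarith [Real.log_two_gt_d9]
    have hℓpos : 0 < ℓ := by linarith
    rcases le_total ℓ₀ ℓ with hle | hle
    · obtain ⟨s₀, hs₀⟩ := hbound ℓ hle
      refine ⟨max 0 s₀, fun s hs => ?_⟩
      rw [max_le_iff] at hs
      have := hs.1
      refine (hs₀ s hs.2).mono le_rfl ?_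
      gcongr
      exact mul_le_of_le_one_right hδ.le hc1
    · obtain ⟨s₀, hs₀⟩ := hbound ℓ₀ le_rfl
      refine ⟨max 0 s₀, fun s hs => ?_⟩
      rw [max_le_iff] at hs
      have := hs.1
      refine (hs₀ s hs.2).mono hle ?_
      refine mul_le_mul_of_nonneg_right ?_ hs.1
      have hexp : Real.exp (-(ℓ / 2)) ≤ 1 := Real.exp_le_one_iff.2 (by linarith)
      calc δ * c * Real.exp (-(ℓ / 2)) / ℓ ^ 2 ≤ δ * c * 1 / (1 / 2) ^ 2 := by gcongr
        _ = δ * Real.exp (-(ℓ₀ / 2)) / ℓ₀ ^ 2 := by rw [hc]; ring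

end Bound

/-! ### From systems back to graphs -/

section Graphs

variable {W : Type*} [Fintype W] {N : ℕ}

/-- The pairs of distinct vertices of `G` that are adjacent if `i` and `j` are adjacent in `H`. -/
def edgeSystem (H : SimpleGraph W) (G : SimpleGraph (Fin N)) (i j : W) (x y : Fin N) : Prop :=
  (H.Adj i j → G.Adj x y) ∧ x ≠ y

/-- Every copy has a labelling, and a labelled copy is an injective homomorphism, that is, a
transversal copy when all parts are the whole vertex set. -/
theorem copyCount_le_card_copies (H : SimpleGraph W) (G : SimpleGraph (Fin N)) :
    G.copyCount H ≤ (copies (edgeSystem H G) fun _ => Finset.univ).card := by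
  refine SimpleGraph.copyCount_le_labelledCopyCount.trans ?_
  unfold SimpleGraph.labelledCopyCount Fintype.card
  refine Finset.card_le_card_of_injOn (fun f : SimpleGraph.Copy H G => (f : W → Fin N)) ?_ ?_
  · intro f _
    rw [Finset.mem_coe, mem_copies]
    exact ⟨fun _ => Finset.mem_univ _, fun i j hij => ⟨fun hadj => f.toHom.map_adj hadj,
      fun he => hij (f.injective he)⟩⟩
  · intro f _ g _ hfg
    exact DFunLike.coe_injective hfg

/-- The condition `x ≠ y` in `edgeSystem` makes the sets found disjoint, also for indices that are
not adjacent in `H`. -/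
theorem isContained_of_hasBlowup {H : SimpleGraph W} {G : SimpleGraph (Fin N)} {τ : ℝ}
    (hb : HasBlowup (edgeSystem H G) (fun _ => Finset.univ) τ) :
    (blowup H ⌈τ⌉₊).IsContained G := by
  obtain ⟨S, -, hS, hcomp⟩ := hb
  have hemb : ∀ i, Nonempty (Fin ⌈τ⌉₊ ↪ S i) := fun i => by
    refine Function.Embedding.nonempty_of_card_le ?_
    rw [Fintype.card_fin, Fintype.card_coe]
    exact Nat.ceil_le.2 (hS i)
  let e : ∀ i, Fin ⌈τ⌉₊ ↪ S i := fun i => (hemb i).some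
  refine ⟨⟨⟨fun p => (e p.1 p.2 : Fin N), ?_⟩, ?_⟩⟩
  · rintro ⟨i, k⟩ ⟨j, l⟩ hadj
    have hadj' : H.Adj i j := hadj
    exact (hcomp i j hadj'.ne _ (e i k).2 _ (e j l).2).1 hadj'
  · rintro ⟨i, k⟩ ⟨j, l⟩ h
    have h' : (e i k : Fin N) = e j l := h
    by_cases hij : i = j
    · subst hij
      rw [(e i).injective (Subtype.ext h')]
    · exact ((hcomp i j hij _ (e i k).2 _ (e j l).2).2 h').elim

/-- With `s = log N` and `ℓ = log (1 / γ)` one has `exp (-(ℓ / 2)) = √γ`. Passing to logarithms to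
base `2` replaces `δ` by `δ / log 2`. -/
theorem exists_blowup_constant (H : SimpleGraph W) :
    ∃ δ : ℝ, 0 < δ ∧
      ∀ γ : ℝ, 0 < γ → γ ≤ 1 / 2 →
        ∃ N₀ : ℕ, ∀ N : ℕ, N₀ ≤ N → ∀ G : SimpleGraph (Fin N),
          γ * (N : ℝ) ^ Fintype.card W ≤ (G.copyCount H : ℝ) →
            ∃ t : ℕ,
              δ * √γ / (Real.logb 2 (1 / γ)) ^ 2 * Real.logb 2 N ≤ (t : ℝ) ∧
                (blowup H t).IsContained G := by
  obtain ⟨δ, hδ, hbound⟩ := exists_blowupBound (Fintype.card W)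
  have hlog2 : 0 < Real.log 2 := Real.log_pos one_lt_two
  refine ⟨δ / Real.log 2, by positivity, fun γ hγ hγ2 => ?_⟩
  have hinv : (2 : ℝ) ≤ 1 / γ := by rw [le_div_iff₀ hγ]; linarith
  have hℓ : Real.log 2 ≤ Real.log (1 / γ) := Real.log_le_log two_pos hinv
  have hℓ0 : 0 < Real.log (1 / γ) := hlog2.trans_le hℓ
  obtain ⟨s₀, hs₀⟩ := hbound _ hℓ
  have hexp : Real.exp (-Real.log (1 / γ)) = γ := by
    rw [one_div, Real.log_inv, neg_neg, Real.exp_log hγ]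
  have hsqrt : Real.exp (-(Real.log (1 / γ) / 2)) = √γ := by
    rw [← neg_div, Real.exp_half, hexp]
  refine ⟨⌈Real.exp s₀⌉₊ + 1, fun N hN G hG => ⟨_, ?_, isContained_of_hasBlowup (hs₀ (Real.log N)
    ?_ W (Fin N) rfl (edgeSystem H G) (fun _ => Finset.univ) ?_ ?_ ?_)⟩⟩
  · refine le_trans (le_of_eq ?_) (Nat.le_ceil _)
    rw [hsqrt, Real.logb, Real.logb]
    field_simp
  · have hN0 : (0 : ℝ) < N := by exact_mod_cast (by omega : 0 < N)
    rw [Real.le_log_iff_exp_le hN0]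
    exact (Nat.le_ceil _).trans (by exact_mod_cast (by omega : ⌈Real.exp s₀⌉₊ ≤ N))
  · exact fun i j x y h => ⟨fun hadj => (h.1 hadj.symm).symm, h.2.symm⟩
  · intro i
    rw [Finset.card_univ, Fintype.card_fin, Real.exp_log (by exact_mod_cast (by omega : 0 < N))]
  · rw [hexp]
    have : Nonempty (Fin N) := ⟨⟨0, by omega⟩⟩
    refine dens_ge_of_card (fun _ => Finset.univ_nonempty) ?_
    have hvol : vol (fun _ : W => (Finset.univ : Finset (Fin N))) = (N : ℝ) ^ Fintype.card W := by
      simp [vol]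
    rw [hvol]
    exact hG.trans (Nat.cast_le.2 (copyCount_le_card_copies H G))

/-- The error term is `c` below `N₀`, where the empty blowup `H[0]` suffices, and `0` from there on.
-/
theorem isAdmissible_of_eventually {H : SimpleGraph W} {γ c : ℝ} {N₀ : ℕ}
    (h : ∀ N : ℕ, N₀ ≤ N → ∀ G : SimpleGraph (Fin N),
      γ * (N : ℝ) ^ Fintype.card W ≤ (G.copyCount H : ℝ) →
        ∃ t : ℕ, c * Real.logb 2 N ≤ (t : ℝ) ∧ (blowup H t).IsContained G) :
    IsAdmissible H γ c := by
  refine ⟨fun N => if N₀ ≤ N then 0 else c, ?_, fun N G hG => ?_⟩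
  · refine tendsto_const_nhds.congr' ?_
    filter_upwards [eventually_ge_atTop N₀] with N hN
    rw [if_pos hN]
  · by_cases hN : N₀ ≤ N
    · simpa [hN] using h N hN G hG
    · refine ⟨0, by simp [hN], ⟨⟨⟨fun p => p.2.elim0, fun {p} => p.2.elim0⟩, fun p => p.2.elim0⟩⟩⟩

end Graphs

/-! ### The exponent as `γ` tends to zero -/

theorem tendsto_log_div_log_sub {δ : ℝ} (hδ : 0 < δ) :
    Tendsto (fun γ : ℝ => Real.log (δ * √(min γ (1 / 2)) /
      (Real.logb 2 (1 / min γ (1 / 2))) ^ 2) / Real.log γ - 1 / 2) (𝓝[>] 0) (𝓝 0) := by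
  have hlog2 : 0 < Real.log 2 := Real.log_pos one_lt_two
  -- This is the function in the variable `u = -log γ`; near `0` the minimum is `γ`. The term `2 *
  -- log u / u` stems from the squared logarithm in the bound.
  have h1 : Tendsto (fun u : ℝ => (-Real.log δ - 2 * Real.log (Real.log 2)) / u +
      2 * (Real.log u / u)) atTop (𝓝 0) := by
    have h2 : Tendsto (fun u : ℝ => Real.log u / u) atTop (𝓝 0) :=
      Real.isLittleO_log_id_atTop.tendsto_div_nhds_zero
    have h3 : Tendsto (fun u : ℝ => (-Real.log δ - 2 * Real.log (Real.log 2)) / u) atTop (𝓝 0) :=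
      tendsto_const_nhds.div_atTop tendsto_id
    simpa using h3.add (h2.const_mul 2)
  have h2 : Tendsto (fun γ : ℝ => -Real.log γ) (𝓝[>] 0) atTop :=
    tendsto_neg_atBot_atTop.comp Real.tendsto_log_nhdsGT_zero
  refine (h1.comp h2).congr' ?_
  filter_upwards [Ioo_mem_nhdsGT (show (0 : ℝ) < 1 / 2 by norm_num)] with γ hγ
  have hγ0 : 0 < γ := hγ.1
  have hlog : Real.log γ < 0 := Real.log_neg hγ0 (by linarith [hγ.2])
  have hu : 0 < -Real.log γ := by linarith
  rw [Function.comp_apply, min_eq_left hγ.2.le, Real.logb, one_div, Real.log_inv,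
    Real.log_div (by positivity) (by positivity), Real.log_mul hδ.ne' (by positivity),
    Real.log_sqrt hγ0.le, Real.log_pow, Real.log_div hu.ne' hlog2.ne']
  push_cast
  have hne := hlog.ne
  field_simp
  ring

end Nikiforov

end Proof

theorem theorem1p2 {W : Type*} [Fintype W] (H : SimpleGraph W) :
    (∃ e : ℝ → ℝ, Tendsto e (𝓝[>] 0) (𝓝 0) ∧
      ∀ γ : ℝ, 0 < γ → γ < 1 →
        ENNReal.ofReal (γ ^ ((1 : ℝ) / 2 + e γ)) ≤ Nikiforov.optConst H γ) ∧
    (∃ δ : ℝ, 0 < δ ∧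
      ∀ γ : ℝ, 0 < γ → γ ≤ 1 / 2 →
        ∃ N₀ : ℕ, ∀ N : ℕ, N₀ ≤ N → ∀ G : SimpleGraph (Fin N),
          γ * (N : ℝ) ^ Fintype.card W ≤ (G.copyCount H : ℝ) →
            ∃ t : ℕ,
              δ * √γ / (Real.logb 2 (1 / γ)) ^ 2 * Real.logb 2 N ≤ (t : ℝ) ∧
                (Nikiforov.blowup H t).IsContained G) := by
  have hmain := Nikiforov.exists_blowup_constant H
  refine ⟨?_, hmain⟩
  obtain ⟨δ, hδ, hbound⟩ := hmain
  -- The error exponent is chosen so that `γ ^ (1 / 2 + e γ)` equals the constant of the second part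
  -- at `min γ (1 / 2)`. For `γ > 1 / 2` the bound for `1 / 2` applies, since a graph with `γ * N ^
  -- h` copies has at least half of `N ^ h`.
  refine ⟨_, Nikiforov.tendsto_log_div_log_sub hδ, fun γ hγ hγ1 => ?_⟩
  have hg0 : 0 < min γ (1 / 2) := lt_min hγ (by norm_num)
  have hg2 : min γ (1 / 2) ≤ 1 / 2 := min_le_right _ _
  have hlogb : 0 < Real.logb 2 (1 / min γ (1 / 2)) := by
    refine Real.logb_pos one_lt_two ?_
    rw [lt_div_iff₀ hg0]
    linarith
  have hlog : Real.log γ ≠ 0 := (Real.log_neg hγ hγ1).ne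
  set c := δ * √(min γ (1 / 2)) / (Real.logb 2 (1 / min γ (1 / 2))) ^ 2 with hc
  have hc0 : 0 < c := by positivity
  have hpow : γ ^ ((1 : ℝ) / 2 + (Real.log c / Real.log γ - 1 / 2)) = c := by
    rw [add_sub_cancel, Real.rpow_def_of_pos hγ, mul_div_cancel₀ _ hlog, Real.exp_log hc0]
  rw [hpow]
  obtain ⟨N₀, hN₀⟩ := hbound _ hg0 hg2
  refine le_sSup ⟨c, ⟨hc0, Nikiforov.isAdmissible_of_eventually (N₀ := N₀) fun N hN G hG => ?_⟩,
    rfl⟩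
  refine hN₀ N hN G (le_trans ?_ hG)
  gcongr
  exact min_le_left _ _
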